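/- **Setting.** Let $S$, $A$ be finite sets, $L\ge 1$, and let $S=S_0\sqcup\dots\sqcup S_L$ be split into nonempty layers with $S_0=\{s_0\}$, $S_L=\{s_L\}$. A known transition function $P$ moves from $(s,a)$ with $s\in S_k$, $k<L$, to states of $S_{k+1}$ only. Policies $\pi\in\Pi$ assign to each $s\ne s_L$ a distribution $\pi(\cdot|s)$ on $A$; $q^{\pi}(s,a)$ is the probability that a trajectory $(s_k,a_k)_{k<L}$ drawn from $\pi$ and $P$ visits $(s,a)$, $q(s)=\sum_a q(s,a)$, and $\mathcal Q=\{q^\pi:\pi\in\Pi\}$. Let $T\ge 2$. In each episode $t=1,\dots,T$ the player chooses $\pi_t\in\Pi$; the environment chooses $\ell_t:S\times A\to[0,1]$, possibly depending on the past, on $\pi_t$ and on extra randomness, such that $\sum_{k<L}\ell_t(s_k,a_k)\le 1$ on every possible trajectory; the trajectory of the episode is drawn from $\pi_t$ and $P$; and the player observes it together with an aggregate loss $c_t\in[0,1]$ whose conditional mean, given the past, $\pi_t,\ell_t$ and the trajectory, is the total loss $\sum_{k<L}\ell_t(s_k^t,a_k^t)$. With $V^{\pi}(s_0;\ell)$ the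 expected total loss of $\pi$ under $\ell$, let $$\mathrm{Reg}_T(\pi)=\mathbf E\Big[\sum_{t=1}^T\big(V^{\pi_t}(s_0;\ell_t)-V^{\pi}(s_0;\ell_t)\big)\Big],\qquad \mathrm{Reg}_T=\max_{\pi\in\Pi}\mathrm{Reg}_T(\pi).$$ **Algorithm.** Write $q_t=q^{\pi_t}$, $\mathbb I_t(s)$ and $\mathbb I_t(s,a)$ for the indicators that the trajectory of episode $t$ visits $s$, respectively $(s,a)$, and $$\widehat\ell_t(s,a)=c_t\Big(\frac{\mathbb I_t(s,a)}{q_t(s,a)}-\frac{\mathbb I_t(s)}{q_t(s)}\Big).$$ The player chooses $\pi_t$ such that almost surely $$q_t\in\operatorname*{argmin}_{q\in\mathcal Q}\Big\{\Big\langle\sum_{\tau<t}\widehat\ell_\tau,q\Big\rangle+\psi_t(q)\Big\},$$ where all sums are over pairs $(s,a)$ with $s\ne s_L$, $-\ln 0=+\infty$, pairs with $q(s,a)=0$ for all $q\in\mathcal Q$ are omitted from $\psi_t$, and $\psi_t$ is one of * (Tsallis entropy) $\psi_t(q)=-\frac{2}{\eta_t}\sum_{s,a}\sqrt{q(s,a)}-2\sum_{s,a}\ln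 q(s,a)$ with $\eta_t=1/\sqrt t$; * (log-barrier) $\psi_t(q)=-\sum_{s,a}\frac{1}{\eta_t(s,a)}\ln q(s,a)$ with $\eta_t(s,a)=\big(4+\frac1{\ln T}\sum_{\tau<t}\rho_\tau(s,a)\big)^{-1/2}$ and $\rho_t(s,a)=c_t^2\,\mathbb I_t(s)\big(\mathbb I_t(s,a)-\frac{q_t(s,a)}{q_t(s)}\big)^2$. **Self-bounding regime.** Let $\pi^*:S\to A$ be a deterministic policy, let $\Delta:S\times A\to[0,1]$ satisfy $\Delta(s,a)>0$ for all $s\neq s_L$, $a\ne\pi^*(s)$, and let $C\ge0$. The $(\pi^*,\Delta,C)$-self-bounding condition is $$\mathrm{Reg}_T(\pi^*)\ \ge\ \mathbf E\Big[\sum_{t=1}^T\sum_{s\ne s_L}\sum_{a\ne\pi^*(s)}\Delta(s,a)\,q_t(s,a)\Big]-C .$$ Let $\Delta_{\min}=\min_{s\ne s_L,\,a\ne\pi^*(s)}\Delta(s,a)$ (if $|A|=1$ there are no such pairs, and the term containing $\Delta_{\min}$ below is read as $0$). **Claim.** There is an absolute constant $K>0$ such that the following holds for all MDPs, all $T\ge2$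 and all environments as above. 1. With the Tsallis-entropy regularizer, $\mathrm{Reg}_T\le K\big(\sqrt{|S||A|LT}+|S||A|\log T\big)$. Simultaneously, under any $(\pi^*,\Delta,C)$-self-bounding condition, $\mathrm{Reg}_T(\pi^*)\le K\big(U+\sqrt{UC}\big)$ with $$U=\sum_{s\ne s_L}\sum_{a\ne\pi^*(s)}\frac{\log T}{\Delta(s,a)}+\frac{L|S|\log T}{\Delta_{\min}}.$$ 2. With the log-barrier regularizer, $\mathrm{Reg}_T\le K\sqrt{|S||A|LT\log T}$. Simultaneously, under any $(\pi^*,\Delta,C)$-self-bounding condition, $\mathrm{Reg}_T(\pi^*)\le K\big(U+\sqrt{UC}\big)$ with $$U=\sum_{s\ne s_L}\sum_{a\ne\pi^*(s)}\frac{\log T}{\Delta(s,a)}.$$ -/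

import Mathlib

open MeasureTheory

noncomputable section

/-- An episodic layered Markov decision process with `L + 1` layers `0, …, L`, finite state space
`S` and finite action space `A`.  `P s a s'` is the probability of moving to `s'` from `s` under
the action `a`; its values at the terminal state play no role. -/
structure LayeredMDP (S A : Type*) [Fintype S] (L : ℕ) where
  /-- layer `0` and layer `L` are different layers -/
  L_pos : 0 < L
  /-- the index of the layer of a state -/
  layer : S → ℕ
  layer_le : ∀ s, layer s ≤ L
  layer_nonempty : ∀ k ≤ L, ∃ s, layer s = k
  /-- the initial state -/
  start : S
  /-- the terminal state -/
  terminal : S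
  layer_eq_zero_iff : ∀ s, layer s = 0 ↔ s = start
  layer_eq_L_iff : ∀ s, layer s = L ↔ s = terminal
  P : S → A → S → ℝ
  P_nonneg : ∀ s a s', 0 ≤ P s a s'
  P_sum : ∀ s a, s ≠ terminal → ∑ s', P s a s' = 1
  P_eq_zero : ∀ s a s', s ≠ terminal → layer s' ≠ layer s + 1 → P s a s' = 0

/-- A trajectory `((s_0, a_0), …, (s_{L-1}, a_{L-1}))` (the last state is always terminal). -/
abbrev Trajectory (S A : Type*) (L : ℕ) : Type _ := Fin L → S × A

/-- `1` if the trajectory visits the state `s`, and `0` otherwise. -/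
def visitState {S A : Type*} [DecidableEq S] {L : ℕ} (τ : Trajectory S A L) (s : S) : ℝ :=
  if ∃ k, (τ k).1 = s then 1 else 0

/-- `1` if the trajectory visits the pair `(s, a)`, and `0` otherwise. -/
def visitPair {S A : Type*} [DecidableEq S] [DecidableEq A] {L : ℕ} (τ : Trajectory S A L)
    (s : S) (a : A) : ℝ :=
  if ∃ k, τ k = (s, a) then 1 else 0

/-- The deterministic policy given by a map from states to actions. -/
def detPolicy {S A : Type*} [DecidableEq A] (p : S → A) : S → A → ℝ :=
  fun s a => if a = p s then 1 else 0

namespace LayeredMDP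

variable {S A : Type*} [Fintype S] [Fintype A] [DecidableEq S] [DecidableEq A] {L : ℕ}

/-- Stochastic Markov policies: `p s a` is the probability of the action `a` in the nonterminal
state `s` (values at the terminal state play no role). -/
def IsPolicy (M : LayeredMDP S A L) (p : S → A → ℝ) : Prop :=
  ∀ s, s ≠ M.terminal → (∀ a, 0 ≤ p s a) ∧ ∑ a, p s a = 1

/-- The probability of the trajectory `τ` under the policy `p` and the transitions of `M`. -/
def trajProb (M : LayeredMDP S A L) (p : S → A → ℝ) (τ : Trajectory S A L) : ℝ :=
  (if (τ ⟨0, M.L_pos⟩).1 = M.start then 1 else 0) *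
    ∏ k : Fin L, p (τ k).1 (τ k).2 *
      (if h : (k : ℕ) + 1 < L then M.P (τ k).1 (τ k).2 (τ ⟨k + 1, h⟩).1 else 1)

/-- Trajectories that start at the initial state and follow transitions of positive probability. -/
def IsPossible (M : LayeredMDP S A L) (τ : Trajectory S A L) : Prop :=
  (τ ⟨0, M.L_pos⟩).1 = M.start ∧
    ∀ (k : Fin L) (h : (k : ℕ) + 1 < L), 0 < M.P (τ k).1 (τ k).2 (τ ⟨k + 1, h⟩).1

/-- The occupancy measure of a policy: the probability that a trajectory visits `(s, a)`.
By layering, a state of layer `k` can only be visited at step `k`. -/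
def occ (M : LayeredMDP S A L) (p : S → A → ℝ) (s : S) (a : A) : ℝ :=
  ∑ τ : Trajectory S A L, M.trajProb p τ * visitPair τ s a

/-- The set of all occupancy measures. -/
def occSet (M : LayeredMDP S A L) : Set (S → A → ℝ) :=
  {q | ∃ p, M.IsPolicy p ∧ q = M.occ p}

/-- The expected loss of the last `n` steps of an episode from the state `s`.  For a state `s` of
layer `L - n` this is the value `V(s)`, which is `0` at the terminal state and satisfies
`V(s) = ∑ a, p(a|s) Q(s, a)` with `Q(s, a) = ℓ(s, a) + ∑ s', P(s'|s, a) V(s')`. -/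
def valueToGo (M : LayeredMDP S A L) (p ℓ : S → A → ℝ) : ℕ → S → ℝ
  | 0, _ => 0
  | n + 1, s => ∑ a, p s a * (ℓ s a + ∑ s', M.P s a s' * valueToGo M p ℓ n s')

/-- The state value function `V^{P, p}(s; ℓ)`. -/
def value (M : LayeredMDP S A L) (p ℓ : S → A → ℝ) (s : S) : ℝ :=
  M.valueToGo p ℓ (L - M.layer s) s

/-- The pairing `⟨ℓ, q⟩` over nonterminal states and all actions. -/
def pairing (M : LayeredMDP S A L) (ℓ q : S → A → ℝ) : ℝ :=
  ∑ s ∈ Finset.univ.erase M.terminal, ∑ a, ℓ s a * q s a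

/-- The occupancy measures at which a logarithmic barrier is finite: `q(s, a) > 0` for every
nonterminal `s` and every `a`, except those pairs that have `q'(s, a) = 0` for all occupancy
measures `q'`, that is, except at states that cannot be reached. -/
def barrierDomain (M : LayeredMDP S A L) : Set (S → A → ℝ) :=
  {q | q ∈ M.occSet ∧
    ∀ s a, s ≠ M.terminal → (∃ q' ∈ M.occSet, 0 < q' s a) → 0 < q s a}

/-- The learning rate `1 / √t` of the Tsallis-entropy regularizer. -/
def tsallisRate (t : ℕ) : ℝ := 1 / √(t : ℝ)

/-- The Tsallis-entropy regularizer with a logarithmic barrier of weight `β = 2`, to be used on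
`barrierDomain`.  Pairs at unreachable states contribute `0` (`√0 = 0` and `Real.log 0 = 0`). -/
def tsallisReg (M : LayeredMDP S A L) (t : ℕ) (q : S → A → ℝ) : ℝ :=
  -(2 / tsallisRate t) * ∑ s ∈ Finset.univ.erase M.terminal, ∑ a, √(q s a)
    - ∑ s ∈ Finset.univ.erase M.terminal, ∑ a, 2 * Real.log (q s a)

/-- The logarithmic barrier with learning rates `η (s, a)`, to be used on `barrierDomain`.
Pairs at unreachable states contribute `0` (`Real.log 0 = 0`). -/
def logBarrierReg (M : LayeredMDP S A L) (η q : S → A → ℝ) : ℝ :=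
  -∑ s ∈ Finset.univ.erase M.terminal, ∑ a, 1 / η s a * Real.log (q s a)

end LayeredMDP

/-- `T` episodes of a player against an arbitrary (adaptive, randomized) environment with aggregate
bandit feedback.  `𝓕 t` is the information available just before the trajectory of episode `t` is
drawn: the past, the policy and the loss function of episode `t`, and any internal randomness used
so far.  Episodes are numbered `1, …, T`. -/
structure Interaction {S A : Type*} [Fintype S] [Fintype A] [DecidableEq S] [DecidableEq A]
    {L : ℕ} (M : LayeredMDP S A L) (T : ℕ) {Ω : Type*} [mΩ : MeasurableSpace Ω] (μ : Measure Ω)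
    (𝓕 : Filtration ℕ mΩ) where
  /-- the policy of the player in episode `t` -/
  policy : ℕ → Ω → S → A → ℝ
  /-- the loss function of episode `t` -/
  loss : ℕ → Ω → S → A → ℝ
  /-- the trajectory of episode `t` -/
  traj : ℕ → Ω → Trajectory S A L
  /-- the aggregate loss feedback of episode `t` -/
  feedback : ℕ → Ω → ℝ
  policy_isPolicy : ∀ t ∈ Finset.Icc 1 T, ∀ ω, M.IsPolicy (policy t ω)
  policy_measurable : ∀ t ∈ Finset.Icc 1 T, ∀ s a, Measurable[𝓕 t] fun ω => policy t ω s a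
  loss_mem : ∀ t ∈ Finset.Icc 1 T, ∀ ω s a, loss t ω s a ∈ Set.Icc (0 : ℝ) 1
  loss_sum_le : ∀ t ∈ Finset.Icc 1 T, ∀ ω τ, M.IsPossible τ →
    ∑ k, loss t ω (τ k).1 (τ k).2 ≤ 1
  loss_measurable : ∀ t ∈ Finset.Icc 1 T, ∀ s a, Measurable[𝓕 t] fun ω => loss t ω s a
  traj_measurable : ∀ t ∈ Finset.Icc 1 T, Measurable[𝓕 (t + 1), ⊤] (traj t)
  feedback_mem : ∀ t ∈ Finset.Icc 1 T, ∀ ω, feedback t ω ∈ Set.Icc (0 : ℝ) 1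
  feedback_measurable : ∀ t ∈ Finset.Icc 1 T, Measurable[𝓕 (t + 1)] (feedback t)
  /-- given the information before episode `t`, the trajectory is drawn from the policy of the
  player and the transitions of the MDP -/
  traj_law : ∀ t ∈ Finset.Icc 1 T, ∀ τ,
    μ[Set.indicator {ω | traj t ω = τ} (fun _ => (1 : ℝ)) | 𝓕 t]
      =ᵐ[μ] fun ω => M.trajProb (policy t ω) τ
  /-- given the information before episode `t` and the trajectory, the feedback has the total loss
  of the trajectory as its mean -/
  feedback_mean : ∀ t ∈ Finset.Icc 1 T,
    μ[feedback t | 𝓕 t ⊔ MeasurableSpace.comap (traj t) ⊤]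
      =ᵐ[μ] fun ω => ∑ k, loss t ω (traj t ω k).1 (traj t ω k).2

namespace Interaction

variable {S A : Type*} [Fintype S] [Fintype A] [DecidableEq S] [DecidableEq A] {L : ℕ}
  {M : LayeredMDP S A L} {T : ℕ} {Ω : Type*} [mΩ : MeasurableSpace Ω] {μ : Measure Ω}
  {𝓕 : Filtration ℕ mΩ}

/-- The occupancy measure `q_t` of the policy of episode `t`. -/
def occ (X : Interaction M T μ 𝓕) (t : ℕ) (ω : Ω) : S → A → ℝ := M.occ (X.policy t ω)

/-- The loss estimator `c_t (𝟙_t(s, a) / q_t(s, a) - 𝟙_t(s) / q_t(s))`. -/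
def estimator (X : Interaction M T μ 𝓕) (t : ℕ) (ω : Ω) (s : S) (a : A) : ℝ :=
  X.feedback t ω *
    (visitPair (X.traj t ω) s a / X.occ t ω s a
      - visitState (X.traj t ω) s / ∑ a', X.occ t ω s a')

/-- The quantity `ρ_t(s, a) = c_t² 𝟙_t(s) (𝟙_t(s, a) - q_t(s, a) / q_t(s))²`. -/
def rho (X : Interaction M T μ 𝓕) (t : ℕ) (ω : Ω) (s : S) (a : A) : ℝ :=
  X.feedback t ω ^ 2 * visitState (X.traj t ω) s *
    (visitPair (X.traj t ω) s a - X.occ t ω s a / ∑ a', X.occ t ω s a') ^ 2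

/-- The adaptive learning rate `(4 + (1 / log T) ∑_{τ < t} ρ_τ(s, a))^{-1/2}`. -/
def adaptiveRate (X : Interaction M T μ 𝓕) (t : ℕ) (ω : Ω) (s : S) (a : A) : ℝ :=
  (4 + 1 / Real.log T * ∑ j ∈ Finset.Ico 1 t, X.rho j ω s a) ^ (-(1 / 2) : ℝ)

/-- The player follows the regularized leader over occupancy measures, with the loss estimators
above and the (possibly history dependent) regularizers `ψ t`, which contain a barrier. -/
def FollowsRegularizedLeader (X : Interaction M T μ 𝓕)
    (ψ : ℕ → Ω → (S → A → ℝ) → ℝ) : Prop :=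
  ∀ᵐ ω ∂μ, ∀ t ∈ Finset.Icc 1 T,
    X.occ t ω ∈ M.barrierDomain ∧
      IsMinOn
        (fun q => M.pairing (fun s a => ∑ j ∈ Finset.Ico 1 t, X.estimator j ω s a) q + ψ t ω q)
        M.barrierDomain (X.occ t ω)

/-- The player uses the Tsallis-entropy regularizer. -/
def UsesTsallis (X : Interaction M T μ 𝓕) : Prop :=
  X.FollowsRegularizedLeader fun t _ q => M.tsallisReg t q

/-- The player uses the logarithmic barrier with adaptive learning rates. -/
def UsesLogBarrier (X : Interaction M T μ 𝓕) : Prop :=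
  X.FollowsRegularizedLeader fun t ω q => M.logBarrierReg (X.adaptiveRate t ω) q

/-- The regret against the policy `p`. -/
def regret (X : Interaction M T μ 𝓕) (p : S → A → ℝ) : ℝ :=
  ∫ ω, ∑ t ∈ Finset.Icc 1 T,
    (M.value (X.policy t ω) (X.loss t ω) M.start - M.value p (X.loss t ω) M.start) ∂μ

/-- The self-bounding constraint with deterministic policy `p`, gaps `Δ` and corruption `C`,
required only of the interaction at hand and not of every algorithm. -/
structure IsSelfBounding (X : Interaction M T μ 𝓕) (p : S → A) (Δ : S → A → ℝ) (C : ℝ) :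
    Prop where
  gap_mem : ∀ s a, Δ s a ∈ Set.Icc (0 : ℝ) 1
  gap_pos : ∀ s a, s ≠ M.terminal → a ≠ p s → 0 < Δ s a
  corruption_nonneg : 0 ≤ C
  le_regret :
    (∫ ω, ∑ t ∈ Finset.Icc 1 T, ∑ s ∈ Finset.univ.erase M.terminal,
        ∑ a ∈ Finset.univ.erase (p s), Δ s a * X.occ t ω s a ∂μ) - C
      ≤ X.regret (detPolicy p)

end Interaction

namespace LayeredMDP

variable {S A : Type*} [Fintype S] [Fintype A] [DecidableEq S] [DecidableEq A] {L : ℕ}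

/-- The smallest gap `Δ(s, a)` over nonterminal `s` and `a ≠ p s` (for a single action there are no
such pairs and the value is `0`; all regrets vanish then). -/
def gapMin (M : LayeredMDP S A L) (p : S → A) (Δ : S → A → ℝ) : ℝ :=
  sInf {x | ∃ s a, s ≠ M.terminal ∧ a ≠ p s ∧ x = Δ s a}

/-- `∑_{s ≠ s_L} ∑_{a ≠ p(s)} log T / Δ(s, a)`. -/
def gapSum (M : LayeredMDP S A L) (T : ℕ) (p : S → A) (Δ : S → A → ℝ) : ℝ :=
  ∑ s ∈ Finset.univ.erase M.terminal, ∑ a ∈ Finset.univ.erase (p s), Real.log T / Δ s a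

/-- The quantity `U` for the Tsallis-entropy regularizer. -/
def tsallisU (M : LayeredMDP S A L) (T : ℕ) (p : S → A) (Δ : S → A → ℝ) : ℝ :=
  M.gapSum T p Δ + L * Fintype.card S * Real.log T / M.gapMin p Δ

/-- The quantity `U` for the logarithmic barrier. -/
def logBarrierU (M : LayeredMDP S A L) (T : ℕ) (p : S → A) (Δ : S → A → ℝ) : ℝ :=
  M.gapSum T p Δ

end LayeredMDP

end

set_option linter.unusedSectionVars false

/-! ### Expectations over the trajectories of a policy -/

/-! Aggregate feedback suffices because differences of values see the loss only through advantages.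
By the performance difference lemma, `V^π - V^{π_t}` is the pairing of the advantage of `π_t` with
`q^π`, and that advantage pairs to zero with `q_t`. The action in a state is drawn afresh, so
weighting the total loss by `𝟙(s,a)/q(s,a) - 𝟙(s)/q(s)` removes in mean everything outside the cost
from `s` on, and leaves exactly the advantage (`pathExp_loss_mul_visit`,
`integral_pairing_estimator`).

The rest is follow the regularized leader over the convex set of occupancy measures
(`sum_regret_le`, `sum_pairing_le`). Stability is settled one coordinate at a time: `|q ℓ̂| ≤ 1` and
`(q ℓ̂)² = ρ`, so `tsallis_stability` and `log_barrier_stability` apply, and the conditional mean of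
`ρ` is at most `spread`, the visit probability of `s` times the variance of the action indicator.
The penalty of the logarithmic barrier is a multiple of `log T` per pair, once the comparator is
mixed with weight `1/T` with an occupancy measure that is nowhere too small (`exists_comparator`);
the Tsallis entropy adds differences `√q - √u`. Cauchy-Schwarz and `∑ q = L` then give the
worst-case bounds.

In the self-bounding regime every leading term has to be charged to pairs `(s, a)` with `a ≠ π*(s)`.
For the variances this works because the variance of `π*(s)` is at most the mass of the other
actions. For the Tsallis penalty, `q_t` may visit a state more often than `π*` does, but such an
excess is created only by deviations in earlier layers (`sum_excess_le`); this costs a factor `L`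
and produces the term with `Δ_min`. The adaptive log-barrier avoids it, since its penalty is again
governed by `∑ ρ`. The result is a regret of order `U + √(U G)`, where the expected total gap `G` is
at most the regret plus `C`; `le_of_self_bounding` solves this inequality. If `|S||A| > T`, the
trivial regret bound `T` is enough. -/

lemma visitState_cons {S A : Type*} [DecidableEq S] {n : ℕ} (x : S × A)
    (σ : Trajectory S A n) (s : S) :
    visitState (L := n + 1) (Fin.cons x σ) s = if x.1 = s then 1 else visitState σ s := by
  unfold visitState
  by_cases h : x.1 = s <;> simp [Fin.exists_fin_succ, h]

lemma visitPair_cons {S A : Type*} [DecidableEq S] [DecidableEq A] {n : ℕ} (x : S × A)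
    (σ : Trajectory S A n) (s : S) (a : A) :
    visitPair (L := n + 1) (Fin.cons x σ) s a = if x = (s, a) then 1 else visitPair σ s a := by
  unfold visitPair
  by_cases h : x = (s, a) <;> simp [Fin.exists_fin_succ, h]

lemma visitState_mem {S A : Type*} [DecidableEq S] {n : ℕ} (σ : Trajectory S A n) (s : S) :
    visitState σ s = 0 ∨ visitState σ s = 1 := by
  unfold visitState; split_ifs <;> simp

lemma visitPair_mem {S A : Type*} [DecidableEq S] [DecidableEq A] {n : ℕ}
    (σ : Trajectory S A n) (s : S) (a : A) :
    visitPair σ s a = 0 ∨ visitPair σ s a = 1 := by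
  unfold visitPair; split_ifs <;> simp

lemma visitPair_le_visitState {S A : Type*} [DecidableEq S] [DecidableEq A] {n : ℕ}
    (σ : Trajectory S A n) (s : S) (a : A) : visitPair σ s a ≤ visitState σ s := by
  unfold visitPair visitState
  by_cases h : ∃ k, σ k = (s, a)
  · obtain ⟨k, hk⟩ := h
    rw [if_pos ⟨k, hk⟩, if_pos ⟨k, by rw [hk]⟩]
  · rw [if_neg h]; split_ifs <;> norm_num

namespace LayeredMDP

variable {S A : Type*} [Fintype S] [Fintype A] [DecidableEq S] [DecidableEq A] {L : ℕ}

/-- The expectation of `F` over the first `n` steps of a trajectory that starts in `s`. -/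
noncomputable def pathExp (M : LayeredMDP S A L) (p : S → A → ℝ) :
    (n : ℕ) → S → ((Fin n → S × A) → ℝ) → ℝ
  | 0, _, F => F Fin.elim0
  | n + 1, s, F =>
    ∑ a, p s a * ∑ s', M.P s a s' * pathExp M p n s' (fun σ => F (Fin.cons (s, a) σ))

/-- The probability of a path of `n` steps that starts in `s`. -/
noncomputable def pathProb (M : LayeredMDP S A L) (p : S → A → ℝ) (n : ℕ) (s : S)
    (σ : Fin n → S × A) : ℝ :=
  (if h : 0 < n then (if (σ ⟨0, h⟩).1 = s then 1 else 0) else 1) *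
    ∏ k : Fin n, p (σ k).1 (σ k).2 *
      (if h : (k : ℕ) + 1 < n then M.P (σ k).1 (σ k).2 (σ ⟨k + 1, h⟩).1 else 1)

lemma trajProb_eq_pathProb (M : LayeredMDP S A L) (p : S → A → ℝ) (τ : Trajectory S A L) :
    M.trajProb p τ = M.pathProb p L M.start τ := by
  unfold trajProb pathProb
  rw [dif_pos M.L_pos]

lemma layer_start (M : LayeredMDP S A L) : M.layer M.start = 0 :=
  (M.layer_eq_zero_iff _).2 rfl

lemma ne_terminal_iff (M : LayeredMDP S A L) (s : S) : s ≠ M.terminal ↔ M.layer s < L := by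
  rw [Ne, ← M.layer_eq_L_iff]
  have := M.layer_le s
  omega

lemma start_ne_terminal (M : LayeredMDP S A L) : M.start ≠ M.terminal := by
  rw [ne_terminal_iff, layer_start]
  exact M.L_pos

lemma layer_eq_of_P_ne_zero (M : LayeredMDP S A L) {s s' : S} {a : A} (hs : s ≠ M.terminal)
    (h : M.P s a s' ≠ 0) : M.layer s' = M.layer s + 1 := by
  by_contra hl
  exact h (M.P_eq_zero s a s' hs hl)

/-- The sum over `s'` has one nonzero term, at the first state of `σ`. If `σ` is empty, every tail
has probability 1 and the sum collapses because `P` sums to 1, which is where `s ≠ terminal` enters.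
-/
lemma pathProb_cons (M : LayeredMDP S A L) (p : S → A → ℝ) {n : ℕ} {s : S}
    (hs : s ≠ M.terminal) (x : S × A) (σ : Fin n → S × A) :
    M.pathProb p (n + 1) s (Fin.cons x σ) =
      if x.1 = s then p s x.2 * ∑ s', M.P s x.2 s' * M.pathProb p n s' σ else 0 := by
  obtain ⟨y, a⟩ := x
  by_cases hy : y = s
  swap
  · simp [pathProb, hy]
  subst hy
  simp only [pathProb, Fin.prod_univ_succ, Fin.cons_zero, Fin.cons_succ, Nat.zero_lt_succ,
    dif_pos, Fin.zero_eta, if_true, one_mul]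
  rw [mul_assoc]
  congr 1
  have htail : ∀ k : Fin n,
      (if h : ((Fin.succ k : Fin (n + 1)) : ℕ) + 1 < n + 1 then
        M.P (σ k).1 (σ k).2
          ((Fin.cons (y, a) σ : Fin (n + 1) → S × A) ⟨(Fin.succ k : Fin (n + 1)) + 1, h⟩).1
        else 1) =
      (if h : (k : ℕ) + 1 < n then M.P (σ k).1 (σ k).2 (σ ⟨k + 1, h⟩).1 else 1) := by
    intro k
    by_cases h : (k : ℕ) + 1 < n
    · rw [dif_pos h, dif_pos (by simpa using h)]
      congr 2
    · rw [dif_neg h, dif_neg (by simpa using h)]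
  simp only [htail]
  rcases Nat.eq_zero_or_pos n with rfl | hn
  · simp [M.P_sum y a hs]
  · simp only [hn, dif_pos]
    rw [dif_pos (by simpa using hn)]
    have : ((Fin.cons (y, a) σ : Fin (n + 1) → S × A) ⟨((0 : Fin (n + 1)) : ℕ) + 1, by simpa using hn⟩)
        = σ ⟨0, hn⟩ := rfl
    rw [this]
    simp [ite_mul, Finset.sum_ite_eq]

lemma sum_path_succ {X : Type*} [Fintype X] {n : ℕ} (f : (Fin (n + 1) → X) → ℝ) :
    ∑ σ, f σ = ∑ x, ∑ σ : Fin n → X, f (Fin.cons x σ) := by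
  rw [← Fintype.sum_prod_type']
  exact (Fintype.sum_equiv (Fin.consEquiv fun _ : Fin (n + 1) => X) _ _ (fun _ => rfl)).symm

/-- The invariant `n + layer s = L` says that a state with a step left is nonterminal, so that its
transitions form a distribution on the next layer. All inductions on paths below carry it. -/
lemma sum_pathProb_mul (M : LayeredMDP S A L) (p : S → A → ℝ) {n : ℕ} {s : S}
    (hn : n + M.layer s = L) (F : (Fin n → S × A) → ℝ) :
    ∑ σ, M.pathProb p n s σ * F σ = M.pathExp p n s F := by
  induction n generalizing s with
  | zero => simp [pathProb, pathExp]; congr 1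
  | succ n ih =>
    have hs : s ≠ M.terminal := by rw [ne_terminal_iff]; omega
    rw [sum_path_succ, Fintype.sum_prod_type]
    simp only [pathProb_cons M p hs]
    rw [Finset.sum_eq_single s (by intro y _ hy; simp [hy]) (by simp)]
    simp only [if_true, pathExp]
    refine Finset.sum_congr rfl fun a _ => ?_
    simp only [mul_assoc, ← Finset.mul_sum, Finset.sum_mul]
    congr 1
    rw [Finset.sum_comm]
    refine Finset.sum_congr rfl fun s' _ => ?_
    rw [← Finset.mul_sum]
    by_cases hP : M.P s a s' = 0
    · simp [hP]
    · rw [ih (by have := M.layer_eq_of_P_ne_zero hs hP; omega)]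

lemma sum_trajProb_mul (M : LayeredMDP S A L) (p : S → A → ℝ) (F : Trajectory S A L → ℝ) :
    ∑ τ, M.trajProb p τ * F τ = M.pathExp p L M.start F := by
  simp only [trajProb_eq_pathProb]
  exact M.sum_pathProb_mul p (by rw [layer_start]; rfl) F

lemma pathExp_add (M : LayeredMDP S A L) (p : S → A → ℝ) (n : ℕ) (s : S)
    (F G : (Fin n → S × A) → ℝ) :
    M.pathExp p n s (fun σ => F σ + G σ) = M.pathExp p n s F + M.pathExp p n s G := by
  induction n generalizing s with
  | zero => rfl
  | succ n ih => simp only [pathExp, ih, mul_add, Finset.sum_add_distrib]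

lemma pathExp_const_mul (M : LayeredMDP S A L) (p : S → A → ℝ) (n : ℕ) (s : S) (c : ℝ)
    (F : (Fin n → S × A) → ℝ) :
    M.pathExp p n s (fun σ => c * F σ) = c * M.pathExp p n s F := by
  induction n generalizing s with
  | zero => rfl
  | succ n ih =>
    simp only [pathExp, ih, Finset.mul_sum]
    refine Finset.sum_congr rfl fun a _ => Finset.sum_congr rfl fun s' _ => ?_
    ring

/-- Two functions that agree on the paths that move from layer to layer have the same
expectation. -/
lemma pathExp_congr (M : LayeredMDP S A L) (p : S → A → ℝ) {n : ℕ} {s : S}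
    (hn : n + M.layer s = L) {F G : (Fin n → S × A) → ℝ}
    (h : ∀ σ : Fin n → S × A, (∀ k, M.layer (σ k).1 = M.layer s + k) → F σ = G σ) :
    M.pathExp p n s F = M.pathExp p n s G := by
  induction n generalizing s with
  | zero => exact h _ (fun k => k.elim0)
  | succ n ih =>
    have hs : s ≠ M.terminal := by rw [ne_terminal_iff]; omega
    simp only [pathExp]
    refine Finset.sum_congr rfl fun a _ => ?_
    congr 1
    refine Finset.sum_congr rfl fun s' _ => ?_
    by_cases hP : M.P s a s' = 0
    · simp [hP]
    have hl := M.layer_eq_of_P_ne_zero hs hP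
    congr 1
    refine ih (by omega) fun σ hσ => h _ fun k => ?_
    refine Fin.cases ?_ (fun k => ?_) k
    · simp
    · simp only [Fin.cons_succ, hσ, hl, Fin.val_succ]; omega

/-- Peels off one step of an expectation, using that the remaining path stays in later layers. This
is how visit indicators are resolved layer by layer. -/
lemma pathExp_succ_congr (M : LayeredMDP S A L) (p : S → A → ℝ) {n : ℕ} {s : S}
    (hn : n + 1 + M.layer s = L) {F : (Fin (n + 1) → S × A) → ℝ}
    {G : A → (Fin n → S × A) → ℝ}
    (h : ∀ a, ∀ σ : Fin n → S × A, (∀ k, M.layer (σ k).1 = M.layer s + 1 + k) →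
      F (Fin.cons (s, a) σ) = G a σ) :
    M.pathExp p (n + 1) s F = ∑ a, p s a * ∑ s', M.P s a s' * M.pathExp p n s' (G a) := by
  have hs : s ≠ M.terminal := by rw [ne_terminal_iff]; omega
  simp only [pathExp]
  refine Finset.sum_congr rfl fun a _ => ?_
  congr 1
  refine Finset.sum_congr rfl fun s' _ => ?_
  by_cases hP : M.P s a s' = 0
  · simp [hP]
  have hl := M.layer_eq_of_P_ne_zero hs hP
  congr 1
  exact M.pathExp_congr p (by omega) fun σ hσ => h a σ (by rw [← hl]; exact hσ)

lemma sum_P_mul_congr (M : LayeredMDP S A L) {s : S} (hs : s ≠ M.terminal) (a : A)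
    {f g : S → ℝ} (h : ∀ s', M.layer s' = M.layer s + 1 → f s' = g s') :
    ∑ s', M.P s a s' * f s' = ∑ s', M.P s a s' * g s' := by
  refine Finset.sum_congr rfl fun s' _ => ?_
  by_cases hP : M.P s a s' = 0
  · simp [hP]
  · rw [h s' (M.layer_eq_of_P_ne_zero hs hP)]

lemma pathExp_const (M : LayeredMDP S A L) {p : S → A → ℝ} (hp : M.IsPolicy p) {n : ℕ} {s : S}
    (hn : n + M.layer s = L) (c : ℝ) : M.pathExp p n s (fun _ => c) = c := by
  induction n generalizing s with
  | zero => rfl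
  | succ n ih =>
    have hs : s ≠ M.terminal := by rw [ne_terminal_iff]; omega
    simp only [pathExp]
    have : ∀ a, ∑ s', M.P s a s' * M.pathExp p n s' (fun _ => c) = c := fun a => by
      rw [M.sum_P_mul_congr hs a (g := fun _ => c) fun s' hl => ih (by omega), ← Finset.sum_mul,
        M.P_sum s a hs, one_mul]
    simp only [this, ← Finset.sum_mul, (hp s hs).2, one_mul]

lemma pathExp_sum_loss (M : LayeredMDP S A L) {p : S → A → ℝ} (hp : M.IsPolicy p)
    (ℓ : S → A → ℝ) {n : ℕ} {s : S} (hn : n + M.layer s = L) :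
    M.pathExp p n s (fun σ => ∑ k, ℓ (σ k).1 (σ k).2) = M.valueToGo p ℓ n s := by
  induction n generalizing s with
  | zero => simp [pathExp, valueToGo]
  | succ n ih =>
    have hs : s ≠ M.terminal := by rw [ne_terminal_iff]; omega
    simp only [pathExp, valueToGo, Fin.sum_univ_succ, Fin.cons_zero, Fin.cons_succ]
    refine Finset.sum_congr rfl fun a _ => ?_
    congr 1
    rw [M.sum_P_mul_congr hs a (g := fun s' => ℓ s a + M.valueToGo p ℓ n s') fun s' hl => ?_]
    · simp only [mul_add, Finset.sum_add_distrib, ← Finset.sum_mul, M.P_sum s a hs, one_mul]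
    · rw [pathExp_add, pathExp_const M hp (by omega), ih (by omega)]

/-- Layers increase along a path, so whether `s₁` is visited is decided in the layer of `s₁` and
nowhere else. -/
lemma visitState_cons_of_layer (M : LayeredMDP S A L) {n : ℕ} (s s₁ : S) (a : A)
    (σ : Fin n → S × A) (hσ : ∀ k, M.layer (σ k).1 = M.layer s + 1 + k) :
    visitState (L := n + 1) (Fin.cons (s, a) σ) s₁ =
      if M.layer s = M.layer s₁ then (if s = s₁ then 1 else 0) else visitState σ s₁ := by
  rw [visitState_cons]
  by_cases h : M.layer s = M.layer s₁
  · rw [if_pos h]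
    have : visitState σ s₁ = 0 := by
      unfold visitState
      rw [if_neg]
      rintro ⟨k, hk⟩
      have := hσ k
      rw [hk] at this
      omega
    rw [this]
  · rw [if_neg h, if_neg]
    rintro rfl
    exact h rfl

lemma visitPair_cons_of_layer (M : LayeredMDP S A L) {n : ℕ} (s s₁ : S) (a a₁ : A)
    (σ : Fin n → S × A) (hσ : ∀ k, M.layer (σ k).1 = M.layer s + 1 + k) :
    visitPair (L := n + 1) (Fin.cons (s, a) σ) s₁ a₁ =
      if M.layer s = M.layer s₁ then (if s = s₁ ∧ a = a₁ then 1 else 0)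
      else visitPair σ s₁ a₁ := by
  rw [visitPair_cons]
  by_cases h : M.layer s = M.layer s₁
  · rw [if_pos h]
    have : visitPair σ s₁ a₁ = 0 := by
      unfold visitPair
      rw [if_neg]
      rintro ⟨k, hk⟩
      have := hσ k
      rw [hk] at this
      simp only at this
      omega
    rw [this]
    simp only [Prod.mk.injEq]
  · rw [if_neg h, if_neg]
    simp only [Prod.mk.injEq, not_and]
    rintro rfl
    exact absurd rfl h

/-- The action in `s₁` is drawn afresh however `s₁` was reached: the identity is immediate in the
layer of `s₁`, and a step in another layer only averages it. -/
lemma pathExp_visitPair (M : LayeredMDP S A L) {p : S → A → ℝ} (hp : M.IsPolicy p)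
    (s₁ : S) (a₁ : A) {n : ℕ} {s : S} (hn : n + M.layer s = L) :
    M.pathExp p n s (fun σ => visitPair σ s₁ a₁)
      = p s₁ a₁ * M.pathExp p n s (fun σ => visitState σ s₁) := by
  induction n generalizing s with
  | zero => simp [pathExp, visitPair, visitState]
  | succ n ih =>
    have hs : s ≠ M.terminal := by rw [ne_terminal_iff]; omega
    rw [M.pathExp_succ_congr p hn fun a σ hσ => M.visitPair_cons_of_layer s s₁ a a₁ σ hσ,
      M.pathExp_succ_congr p hn fun a σ hσ => M.visitState_cons_of_layer s s₁ a σ hσ]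
    by_cases hl : M.layer s = M.layer s₁
    · simp only [if_pos hl]
      have key : ∀ a (c : ℝ), ∑ s', M.P s a s' * M.pathExp p n s' (fun _ => c) = c :=
        fun a c => by
        rw [M.sum_P_mul_congr hs a (g := fun _ => c) fun s' hl =>
          M.pathExp_const hp (by omega) c, ← Finset.sum_mul, M.P_sum s a hs, one_mul]
      simp only [key]
      by_cases he : s = s₁
      · subst he
        simp [(hp s hs).2]
      · simp [he]
    · simp only [if_neg hl]
      rw [Finset.mul_sum]
      refine Finset.sum_congr rfl fun a _ => ?_
      rw [M.sum_P_mul_congr hs a fun s' hl => ih (by omega)]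
      simp only [Finset.mul_sum]
      refine Finset.sum_congr rfl fun s' _ => ?_
      ring

/-! ### Advantages: unbiased estimation and performance differences -/

/-- The advantage `Q(s, a) - V(s)` of the action `a` in the state `s`. -/
noncomputable def advantage (M : LayeredMDP S A L) (p ℓ : S → A → ℝ) (s : S) (a : A) : ℝ :=
  ℓ s a + ∑ s', M.P s a s' * M.valueToGo p ℓ (L - (M.layer s + 1)) s'
    - M.valueToGo p ℓ (L - M.layer s) s

/-- The factor `visitPair - p * visitState` has mean zero given the arrival in `s₁`. Losses incurred
before are therefore invisible, and the losses from `s₁` on contribute their mean after `a₁` minus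
their mean under `p`. -/
lemma pathExp_loss_mul_visit (M : LayeredMDP S A L) {p : S → A → ℝ} (hp : M.IsPolicy p)
    (ℓ : S → A → ℝ) (s₁ : S) (a₁ : A) {n : ℕ} {s : S} (hn : n + M.layer s = L) :
    M.pathExp p n s (fun σ => (∑ k, ℓ (σ k).1 (σ k).2) *
        (visitPair σ s₁ a₁ - p s₁ a₁ * visitState σ s₁))
      = p s₁ a₁ * M.advantage p ℓ s₁ a₁ * M.pathExp p n s (fun σ => visitState σ s₁) := by
  induction n generalizing s with
  | zero => simp [pathExp, visitState]
  | succ n ih =>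
    have hs : s ≠ M.terminal := by rw [ne_terminal_iff]; omega
    rw [M.pathExp_succ_congr p hn (G := fun a σ =>
        (ℓ s a + ∑ k, ℓ (σ k).1 (σ k).2) *
          ((if M.layer s = M.layer s₁ then (if s = s₁ ∧ a = a₁ then 1 else 0)
              else visitPair σ s₁ a₁)
            - p s₁ a₁ * (if M.layer s = M.layer s₁ then (if s = s₁ then 1 else 0)
              else visitState σ s₁))) fun a σ hσ => ?_,
      M.pathExp_succ_congr p hn fun a σ hσ => M.visitState_cons_of_layer s s₁ a σ hσ]
    swap
    · rw [M.visitPair_cons_of_layer s s₁ a a₁ σ hσ, M.visitState_cons_of_layer s s₁ a σ hσ,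
        Fin.sum_univ_succ]
      simp
    by_cases hl : M.layer s = M.layer s₁
    · simp only [if_pos hl]
      by_cases he : s = s₁
      · subst he
        have key : ∀ a (c : ℝ),
            ∑ s', M.P s a s' * M.pathExp p n s' (fun σ =>
              (ℓ s a + ∑ k, ℓ (σ k).1 (σ k).2) * c)
            = c * (ℓ s a + ∑ s', M.P s a s' * M.valueToGo p ℓ n s') := fun a c => by
          rw [M.sum_P_mul_congr hs a (g := fun s' => c * (ℓ s a + M.valueToGo p ℓ n s'))
            fun s' hl => ?_]
          · simp only [mul_add, Finset.sum_add_distrib, mul_left_comm _ c, ← Finset.mul_sum,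
              ← Finset.sum_mul, M.P_sum s a hs, one_mul]
          · simp only [mul_comm _ c]
            rw [pathExp_const_mul, pathExp_add, pathExp_const M hp (by omega),
              pathExp_sum_loss M hp ℓ (by omega)]
        have key1 : ∀ a, ∑ s', M.P s a s' * M.pathExp p n s' (fun _ => (1 : ℝ)) = 1 :=
          fun a => by
          rw [M.sum_P_mul_congr hs a (g := fun _ => (1 : ℝ)) fun s' hl =>
            M.pathExp_const hp (by omega) 1, ← Finset.sum_mul, M.P_sum s a hs, one_mul]
        simp only [key, true_and, if_true, mul_one, key1, (hp s hs).2]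
        have hV : M.advantage p ℓ s a₁ = ℓ s a₁ + ∑ s', M.P s a₁ s' * M.valueToGo p ℓ n s'
            - ∑ a, p s a * (ℓ s a + ∑ s', M.P s a s' * M.valueToGo p ℓ n s') := by
          unfold advantage
          have h1 : L - (M.layer s + 1) = n := by omega
          have h2 : L - M.layer s = n + 1 := by omega
          rw [h1, h2, valueToGo]
        rw [hV, mul_sub, Finset.mul_sum]
        simp only [sub_mul, mul_sub, ite_mul, one_mul, zero_mul, Finset.sum_sub_distrib,
          mul_ite, mul_zero, Finset.sum_ite_eq', Finset.mem_univ, if_true]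
        congr 1
        refine Finset.sum_congr rfl fun a _ => ?_
        ring
      · have h0 : ∀ s', M.pathExp p n s' (fun _ => (0 : ℝ)) = 0 := fun s' => by
          simpa using M.pathExp_const_mul p n s' 0 (fun _ => 0)
        simp [he, h0]
    · simp only [if_neg hl]
      rw [Finset.mul_sum]
      refine Finset.sum_congr rfl fun a _ => ?_
      rw [M.sum_P_mul_congr hs a (g := fun s' => p s₁ a₁ * M.advantage p ℓ s₁ a₁ *
        M.pathExp p n s' (fun σ => visitState σ s₁)) fun s' hl => ?_]
      · simp only [Finset.mul_sum]
        refine Finset.sum_congr rfl fun s' _ => ?_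
        ring
      · rw [← ih (by omega)]
        -- The loss of this step is a constant times a variable of mean zero, by
        -- `pathExp_visitPair`.
        have h1 : M.pathExp p n s' (fun σ =>
            ℓ s a * (visitPair σ s₁ a₁ + -p s₁ a₁ * visitState σ s₁)) = 0 := by
          rw [pathExp_const_mul, pathExp_add, pathExp_const_mul,
            pathExp_visitPair M hp _ _ (by omega)]
          ring
        simp only [add_mul, pathExp_add]
        have h2 : (fun σ : Fin n → S × A =>
            ℓ s a * (visitPair σ s₁ a₁ - p s₁ a₁ * visitState σ s₁)) =
            fun σ => ℓ s a * (visitPair σ s₁ a₁ + -p s₁ a₁ * visitState σ s₁) := by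
          funext σ; ring
        rw [h2, h1, zero_add]

/-- The performance difference lemma. -/
lemma pathExp_sum_advantage (M : LayeredMDP S A L) {p p' : S → A → ℝ} (hp : M.IsPolicy p)
    (ℓ : S → A → ℝ) {n : ℕ} {s : S} (hn : n + M.layer s = L) :
    M.pathExp p n s (fun σ => ∑ k, M.advantage p' ℓ (σ k).1 (σ k).2)
      = M.valueToGo p ℓ n s - M.valueToGo p' ℓ n s := by
  induction n generalizing s with
  | zero => simp [pathExp, valueToGo]
  | succ n ih =>
    have hs : s ≠ M.terminal := by rw [ne_terminal_iff]; omega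
    simp only [pathExp, Fin.sum_univ_succ, Fin.cons_zero, Fin.cons_succ]
    have key : ∀ a, ∑ s', M.P s a s' * M.pathExp p n s' (fun σ =>
          M.advantage p' ℓ s a + ∑ k, M.advantage p' ℓ (σ k).1 (σ k).2)
        = (ℓ s a + ∑ s', M.P s a s' * M.valueToGo p ℓ n s')
          - M.valueToGo p' ℓ (n + 1) s := fun a => by
      rw [M.sum_P_mul_congr hs a (g := fun s' => M.advantage p' ℓ s a +
        (M.valueToGo p ℓ n s' - M.valueToGo p' ℓ n s')) fun s' hl => ?_]
      · simp only [mul_add, mul_sub, Finset.sum_add_distrib, Finset.sum_sub_distrib,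
          ← Finset.sum_mul, M.P_sum s a hs, one_mul]
        unfold advantage
        have h1 : L - (M.layer s + 1) = n := by omega
        have h2 : L - M.layer s = n + 1 := by omega
        rw [h1, h2]
        ring
      · rw [pathExp_add, pathExp_const M hp (by omega), ih (by omega)]
    simp only [key, mul_sub, Finset.sum_sub_distrib, ← Finset.sum_mul, (hp s hs).2, one_mul]
    congr 1

end LayeredMDP

namespace LayeredMDP

variable {S A : Type*} [Fintype S] [Fintype A] [DecidableEq S] [DecidableEq A] {L : ℕ}

/-! ### Trajectories of positive probability -/

lemma layer_of_trajProb_ne_zero (M : LayeredMDP S A L) {p : S → A → ℝ} {τ : Trajectory S A L}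
    (h : M.trajProb p τ ≠ 0) (k : Fin L) : M.layer (τ k).1 = k := by
  obtain ⟨k, hk⟩ := k
  unfold trajProb at h
  rw [mul_ne_zero_iff] at h
  induction k with
  | zero =>
    have : (τ ⟨0, M.L_pos⟩).1 = M.start := by
      by_contra hne
      exact h.1 (if_neg hne)
    rw [this, M.layer_start]
  | succ k ih =>
    have h1 := Finset.prod_ne_zero_iff.1 h.2 ⟨k, by omega⟩ (Finset.mem_univ _)
    rw [mul_ne_zero_iff, dif_pos hk] at h1
    have h2 := ih (by omega)
    simp only at h2
    rw [M.layer_eq_of_P_ne_zero ((M.ne_terminal_iff _).2 (by rw [h2]; omega)) h1.2, h2]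

lemma trajProb_nonneg (M : LayeredMDP S A L) {p : S → A → ℝ} (hp : M.IsPolicy p)
    (τ : Trajectory S A L) : 0 ≤ M.trajProb p τ := by
  by_cases h : M.trajProb p τ = 0
  · exact h.ge
  have hl := M.layer_of_trajProb_ne_zero h
  unfold trajProb
  refine mul_nonneg (by split_ifs <;> norm_num) (Finset.prod_nonneg fun k _ => mul_nonneg ?_ ?_)
  · exact (hp _ ((M.ne_terminal_iff _).2 (by rw [hl]; exact k.2))).1 _
  · split_ifs
    · exact M.P_nonneg _ _ _
    · exact zero_le_one

lemma isPossible_of_trajProb_ne_zero (M : LayeredMDP S A L) {p : S → A → ℝ}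
    {τ : Trajectory S A L} (h : M.trajProb p τ ≠ 0) : M.IsPossible τ := by
  unfold trajProb at h
  rw [mul_ne_zero_iff] at h
  refine ⟨?_, fun k hk => ?_⟩
  · by_contra hne
    exact h.1 (if_neg hne)
  · have h1 := Finset.prod_ne_zero_iff.1 h.2 k (Finset.mem_univ _)
    rw [mul_ne_zero_iff, dif_pos hk] at h1
    exact lt_of_le_of_ne (M.P_nonneg _ _ _) h1.2.symm

lemma sum_trajProb (M : LayeredMDP S A L) {p : S → A → ℝ} (hp : M.IsPolicy p) :
    ∑ τ, M.trajProb p τ = 1 := by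
  have := M.sum_trajProb_mul p (fun _ => 1)
  simp only [mul_one] at this
  rw [this, M.pathExp_const hp (by rw [M.layer_start]; rfl)]

lemma value_start (M : LayeredMDP S A L) {p : S → A → ℝ} (hp : M.IsPolicy p) (ℓ : S → A → ℝ) :
    M.value p ℓ M.start = ∑ τ, M.trajProb p τ * ∑ k, ℓ (τ k).1 (τ k).2 := by
  rw [M.sum_trajProb_mul p, M.pathExp_sum_loss hp ℓ (by rw [M.layer_start]; rfl), value,
    M.layer_start]
  rfl

lemma value_mem (M : LayeredMDP S A L) {p : S → A → ℝ} (hp : M.IsPolicy p) {ℓ : S → A → ℝ}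
    (h0 : ∀ s a, 0 ≤ ℓ s a)
    (h1 : ∀ τ, M.IsPossible τ → ∑ k, ℓ (τ k).1 (τ k).2 ≤ 1) :
    M.value p ℓ M.start ∈ Set.Icc (0 : ℝ) 1 := by
  rw [M.value_start hp]
  constructor
  · exact Finset.sum_nonneg fun τ _ => mul_nonneg (M.trajProb_nonneg hp τ)
      (Finset.sum_nonneg fun k _ => h0 _ _)
  · rw [← M.sum_trajProb hp]
    refine Finset.sum_le_sum fun τ _ => ?_
    by_cases h : M.trajProb p τ = 0
    · simp [h]
    · exact mul_le_of_le_one_right (M.trajProb_nonneg hp τ)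
        (h1 τ (M.isPossible_of_trajProb_ne_zero h))

/-- A path that runs through the layers in order visits a pair at most once, so the indicator of a
visit is a sum over the steps. -/
lemma sum_path_eq (M : LayeredMDP S A L) {τ : Trajectory S A L}
    (hτ : ∀ k, M.layer (τ k).1 = k) (f : S → A → ℝ) :
    ∑ k, f (τ k).1 (τ k).2
      = ∑ s ∈ Finset.univ.erase M.terminal, ∑ a, f s a * visitPair τ s a := by
  have h1 : ∀ s a, visitPair τ s a = ∑ k, if τ k = (s, a) then (1 : ℝ) else 0 := by
    intro s a
    unfold visitPair
    split_ifs with h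
    · obtain ⟨k, hk⟩ := h
      rw [Finset.sum_eq_single k]
      · rw [if_pos hk]
      · intro j _ hj
        rw [if_neg]
        intro h2
        have e1 := hτ j
        have e2 := hτ k
        rw [h2] at e1
        rw [hk] at e2
        exact hj (Fin.ext (e1.symm.trans e2))
      · simp
    · symm
      refine Finset.sum_eq_zero fun k _ => if_neg fun hk => h ⟨k, hk⟩
  simp only [h1, Finset.mul_sum]
  have h2 : ∀ s, (∑ a, ∑ k, f s a * if τ k = (s, a) then (1 : ℝ) else 0)
      = ∑ k, ∑ a, f s a * if τ k = (s, a) then (1 : ℝ) else 0 := fun s => Finset.sum_comm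
  simp only [h2]
  rw [Finset.sum_comm]
  refine Finset.sum_congr rfl fun k _ => ?_
  have hk : (τ k).1 ≠ M.terminal := (M.ne_terminal_iff _).2 (by rw [hτ]; exact k.2)
  rw [Finset.sum_eq_single (τ k).1, Finset.sum_eq_single (τ k).2]
  · simp
  · intro a _ ha
    rw [if_neg, mul_zero]
    intro h
    exact ha (by rw [h])
  · simp
  · intro s _ hs
    refine Finset.sum_eq_zero fun a _ => ?_
    rw [if_neg, mul_zero]
    intro h
    exact hs (by rw [h])
  · simp [hk]

lemma sum_trajProb_mul_sum (M : LayeredMDP S A L) (p : S → A → ℝ) (f : S → A → ℝ) :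
    ∑ τ, M.trajProb p τ * ∑ k, f (τ k).1 (τ k).2 = M.pairing f (M.occ p) := by
  have h : ∀ τ, M.trajProb p τ * ∑ k, f (τ k).1 (τ k).2
      = ∑ s ∈ Finset.univ.erase M.terminal, ∑ a, f s a * (M.trajProb p τ * visitPair τ s a) := by
    intro τ
    by_cases h0 : M.trajProb p τ = 0
    · simp [h0]
    · rw [M.sum_path_eq (M.layer_of_trajProb_ne_zero h0) f]
      simp only [Finset.mul_sum]
      refine Finset.sum_congr rfl fun s _ => Finset.sum_congr rfl fun a _ => ?_
      ring
  simp only [h]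
  rw [Finset.sum_comm]
  unfold pairing occ
  refine Finset.sum_congr rfl fun s _ => ?_
  rw [Finset.sum_comm]
  simp only [Finset.mul_sum]

lemma value_eq_pairing (M : LayeredMDP S A L) {p : S → A → ℝ} (hp : M.IsPolicy p)
    (ℓ : S → A → ℝ) : M.value p ℓ M.start = M.pairing ℓ (M.occ p) := by
  rw [M.value_start hp, M.sum_trajProb_mul_sum]

lemma value_sub_value (M : LayeredMDP S A L) {p p' : S → A → ℝ} (hp : M.IsPolicy p)
    (ℓ : S → A → ℝ) :
    M.value p ℓ M.start - M.value p' ℓ M.start = M.pairing (M.advantage p' ℓ) (M.occ p) := by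
  rw [← M.sum_trajProb_mul_sum, M.sum_trajProb_mul,
    M.pathExp_sum_advantage hp ℓ (by rw [M.layer_start]; rfl), value, value, M.layer_start]
  rfl

/-! ### Occupancy measures -/

/-- The probability of visiting a state. -/
noncomputable def reach (M : LayeredMDP S A L) (p : S → A → ℝ) (s : S) : ℝ :=
  ∑ τ, M.trajProb p τ * visitState τ s

lemma occ_eq (M : LayeredMDP S A L) {p : S → A → ℝ} (hp : M.IsPolicy p) (s : S) (a : A) :
    M.occ p s a = p s a * M.reach p s := by
  unfold occ reach
  rw [M.sum_trajProb_mul, M.sum_trajProb_mul,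
    M.pathExp_visitPair hp s a (by rw [M.layer_start]; rfl)]

lemma sum_occ (M : LayeredMDP S A L) {p : S → A → ℝ} (hp : M.IsPolicy p) {s : S}
    (hs : s ≠ M.terminal) : ∑ a, M.occ p s a = M.reach p s := by
  simp only [M.occ_eq hp, ← Finset.sum_mul, (hp s hs).2, one_mul]

lemma occ_nonneg (M : LayeredMDP S A L) {p : S → A → ℝ} (hp : M.IsPolicy p) (s : S) (a : A) :
    0 ≤ M.occ p s a := by
  refine Finset.sum_nonneg fun τ _ => mul_nonneg (M.trajProb_nonneg hp τ) ?_
  rcases visitPair_mem τ s a with h | h <;> simp [h]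

lemma reach_le_one (M : LayeredMDP S A L) {p : S → A → ℝ} (hp : M.IsPolicy p) (s : S) :
    M.reach p s ≤ 1 := by
  rw [← M.sum_trajProb hp]
  refine Finset.sum_le_sum fun τ _ => mul_le_of_le_one_right (M.trajProb_nonneg hp τ) ?_
  rcases visitState_mem τ s with h | h <;> simp [h]

lemma occ_terminal (M : LayeredMDP S A L) (p : S → A → ℝ) (a : A) :
    M.occ p M.terminal a = 0 := by
  refine Finset.sum_eq_zero fun τ _ => ?_
  by_cases h : M.trajProb p τ = 0
  · simp [h]
  · rw [visitPair, if_neg, mul_zero]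
    rintro ⟨k, hk⟩
    have h1 := M.layer_of_trajProb_ne_zero h k
    have h2 := (M.layer_eq_L_iff M.terminal).2 rfl
    rw [hk] at h1
    have := k.2
    simp only at h1
    omega

/-- Telescoping: the successors of the visited states are the visited states shifted by one, which
drops the first state and adds the terminal one. For `f` an indicator these are the flow equations.
-/
lemma pathExp_transition (M : LayeredMDP S A L) {p : S → A → ℝ} (hp : M.IsPolicy p)
    (f : S → ℝ) {n : ℕ} {s : S} (hn : n + M.layer s = L) :
    M.pathExp p n s (fun σ => ∑ k, ∑ s', M.P (σ k).1 (σ k).2 s' * f s')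
      = M.pathExp p n s (fun σ => ∑ k, f (σ k).1) - f s + f M.terminal := by
  induction n generalizing s with
  | zero =>
    have : s = M.terminal := (M.layer_eq_L_iff s).1 (by omega)
    simp [pathExp, this]
  | succ n ih =>
    have hs : s ≠ M.terminal := by rw [ne_terminal_iff]; omega
    simp only [pathExp, Fin.sum_univ_succ, Fin.cons_zero, Fin.cons_succ]
    have k1 : ∀ a, ∑ s', M.P s a s' * M.pathExp p n s' (fun σ =>
          ∑ s', M.P s a s' * f s' + ∑ k, ∑ s', M.P (σ k).1 (σ k).2 s' * f s')
        = ∑ s', M.P s a s' * M.pathExp p n s' (fun σ => ∑ k, f (σ k).1) + f M.terminal := by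
      intro a
      rw [M.sum_P_mul_congr hs a (g := fun s'' => ∑ s', M.P s a s' * f s' +
        (M.pathExp p n s'' (fun σ => ∑ k, f (σ k).1) - f s'' + f M.terminal)) fun s' hl => ?_]
      · simp only [mul_add, mul_sub, Finset.sum_add_distrib, Finset.sum_sub_distrib,
          ← Finset.sum_mul, M.P_sum s a hs, one_mul]
        ring
      · rw [pathExp_add, pathExp_const M hp (by omega), ih (by omega)]
    have k2 : ∀ a, ∑ s', M.P s a s' * M.pathExp p n s' (fun σ => f s + ∑ k, f (σ k).1)
        = f s + ∑ s', M.P s a s' * M.pathExp p n s' (fun σ => ∑ k, f (σ k).1) := by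
      intro a
      rw [M.sum_P_mul_congr hs a (g := fun s'' => f s +
        M.pathExp p n s'' (fun σ => ∑ k, f (σ k).1)) fun s' hl => ?_]
      · simp only [mul_add, Finset.sum_add_distrib, ← Finset.sum_mul, M.P_sum s a hs, one_mul]
      · rw [pathExp_add, pathExp_const M hp (by omega)]
    simp only [k1, k2, mul_add, Finset.sum_add_distrib, ← Finset.sum_mul, (hp s hs).2, one_mul]
    ring

/-- The flow constraints that characterize occupancy measures. -/
structure IsFlow (M : LayeredMDP S A L) (q : S → A → ℝ) : Prop where
  nonneg : ∀ s a, 0 ≤ q s a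
  terminal : ∀ a, q M.terminal a = 0
  flow : ∀ s', s' ≠ M.terminal → ∑ a, q s' a = (if M.start = s' then 1 else 0) +
    ∑ s ∈ Finset.univ.erase M.terminal, ∑ a, q s a * M.P s a s'

lemma isFlow_occ (M : LayeredMDP S A L) {p : S → A → ℝ} (hp : M.IsPolicy p) :
    M.IsFlow (M.occ p) where
  nonneg := M.occ_nonneg hp
  terminal := M.occ_terminal p
  flow s' hs' := by
    have h := M.pathExp_transition hp (fun s => if s = s' then 1 else 0) (n := L) (s := M.start)
      (by rw [M.layer_start]; rfl)
    rw [← M.sum_trajProb_mul, ← M.sum_trajProb_mul,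
      M.sum_trajProb_mul_sum p (fun s a => ∑ s'', M.P s a s'' * if s'' = s' then 1 else 0),
      M.sum_trajProb_mul_sum p (fun s _ => if s = s' then 1 else 0), if_neg (Ne.symm hs')] at h
    unfold pairing at h
    simp only [mul_ite, mul_one, mul_zero, ite_mul, one_mul, zero_mul, Finset.sum_ite_eq',
      Finset.mem_univ, if_true, add_zero] at h
    rw [Finset.sum_eq_single_of_mem (f := fun s => ∑ a, if s = s' then M.occ p s a else 0) s'
      (by simp [hs']) (by intro b _ hb; simp [hb])] at h
    simp only [if_true] at h
    simp only [mul_comm _ (M.P _ _ _)]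
    rw [h]
    ring

lemma sum_erase_layer (M : LayeredMDP S A L) {s' : S} (q : S → A → ℝ) :
    ∑ s ∈ Finset.univ.erase M.terminal, ∑ a, q s a * M.P s a s'
      = ∑ s ∈ Finset.univ.erase M.terminal with M.layer s + 1 = M.layer s',
          ∑ a, q s a * M.P s a s' := by
  rw [Finset.sum_filter]
  refine Finset.sum_congr rfl fun s hs => ?_
  split_ifs with h
  · rfl
  · refine Finset.sum_eq_zero fun a _ => ?_
    rw [M.P_eq_zero s a s' (Finset.ne_of_mem_erase hs) (fun h' => h h'.symm), mul_zero]

/-- Normalizing `q` in each state gives a policy, and the flow equations determine the state masses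
layer by layer, so its occupancy measure is `q`. The policy `p₀` only fills in states without mass.
Hence `occSet` is cut out by linear constraints and is convex. -/
lemma IsFlow.mem_occSet {M : LayeredMDP S A L} {q p₀ : S → A → ℝ} (hq : M.IsFlow q)
    (hp₀ : M.IsPolicy p₀) : q ∈ M.occSet := by
  set p : S → A → ℝ := fun s a => if ∑ a, q s a = 0 then p₀ s a else q s a / ∑ a, q s a with hpdef
  have hqp : ∀ s a, q s a = p s a * ∑ a, q s a := by
    intro s a
    simp only [hpdef]
    split_ifs with h
    · rw [h, mul_zero]
      exact (Finset.sum_eq_zero_iff_of_nonneg fun a _ => hq.nonneg s a).1 h a (Finset.mem_univ a)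
    · rw [div_mul_cancel₀ _ h]
  have hp : M.IsPolicy p := by
    intro s hs
    by_cases h : ∑ a, q s a = 0
    · simp only [hpdef, h, if_true]
      exact hp₀ s hs
    · simp only [hpdef, h, if_false]
      exact ⟨fun a => div_nonneg (hq.nonneg s a) (Finset.sum_nonneg fun a _ => hq.nonneg s a),
        by rw [← Finset.sum_div, div_self h]⟩
  have hf := M.isFlow_occ hp
  have key : ∀ n s, M.layer s = n → s ≠ M.terminal → ∑ a, q s a = M.reach p s := by
    intro n
    induction n using Nat.strong_induction_on with
    | _ n ih =>
      intro s hn hs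
      rw [← M.sum_occ hp hs, hq.flow s hs, hf.flow s hs, M.sum_erase_layer, M.sum_erase_layer]
      congr 1
      refine Finset.sum_congr rfl fun s₁ h₁ => Finset.sum_congr rfl fun a _ => ?_
      rw [Finset.mem_filter] at h₁
      rw [hqp s₁ a, M.occ_eq hp, ih (M.layer s₁) (by omega) s₁ rfl (Finset.ne_of_mem_erase h₁.1)]
  refine ⟨p, hp, ?_⟩
  funext s a
  by_cases hs : s = M.terminal
  · rw [hs, hq.terminal, hf.terminal]
  · rw [hqp, M.occ_eq hp, key _ s rfl hs]

lemma isFlow_of_mem_occSet (M : LayeredMDP S A L) {q : S → A → ℝ} (hq : q ∈ M.occSet) :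
    M.IsFlow q := by
  obtain ⟨p, hp, rfl⟩ := hq
  exact M.isFlow_occ hp

lemma convex_occSet (M : LayeredMDP S A L) : Convex ℝ M.occSet := by
  intro q hq q' hq' x y hx hy hxy
  obtain ⟨p, hp, -⟩ := id hq
  have h := M.isFlow_of_mem_occSet hq
  have h' := M.isFlow_of_mem_occSet hq'
  refine IsFlow.mem_occSet ⟨fun s a => ?_, fun a => ?_, fun s' hs' => ?_⟩ hp
  · exact add_nonneg (mul_nonneg hx (h.nonneg s a)) (mul_nonneg hy (h'.nonneg s a))
  · simp [h.terminal, h'.terminal]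
  · simp only [Pi.add_apply, Pi.smul_apply, smul_eq_mul, add_mul, Finset.sum_add_distrib,
      mul_assoc, ← Finset.mul_sum]
    rw [h.flow s' hs', h'.flow s' hs', mul_add, mul_add, add_add_add_comm, ← add_mul, hxy, one_mul]

lemma convex_barrierDomain (M : LayeredMDP S A L) : Convex ℝ M.barrierDomain := by
  intro q hq q' hq' x y hx hy hxy
  refine ⟨M.convex_occSet hq.1 hq'.1 hx hy hxy, fun s a hs hr => ?_⟩
  have h1 := hq.2 s a hs hr
  have h2 := hq'.2 s a hs hr
  exact (convex_Ioi (0 : ℝ)) h1 h2 hx hy hxy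

lemma mem_occSet_nonneg (M : LayeredMDP S A L) {q : S → A → ℝ} (hq : q ∈ M.occSet) (s : S)
    (a : A) : 0 ≤ q s a := (M.isFlow_of_mem_occSet hq).nonneg s a

lemma mem_occSet_sum_le_one (M : LayeredMDP S A L) {q : S → A → ℝ} (hq : q ∈ M.occSet) (s : S) :
    ∑ a, q s a ≤ 1 := by
  obtain ⟨p, hp, rfl⟩ := hq
  by_cases hs : s = M.terminal
  · simp [hs, M.occ_terminal]
  · rw [M.sum_occ hp hs]
    exact M.reach_le_one hp s

lemma mem_occSet_le_sum (M : LayeredMDP S A L) {q : S → A → ℝ} (hq : q ∈ M.occSet) (s : S)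
    (a : A) : q s a ≤ ∑ a, q s a :=
  Finset.single_le_sum (f := fun a => q s a) (fun a _ => M.mem_occSet_nonneg hq s a)
    (Finset.mem_univ a)

lemma mem_occSet_le_one (M : LayeredMDP S A L) {q : S → A → ℝ} (hq : q ∈ M.occSet) (s : S)
    (a : A) : q s a ≤ 1 :=
  (M.mem_occSet_le_sum hq s a).trans (M.mem_occSet_sum_le_one hq s)

lemma mem_occSet_sum (M : LayeredMDP S A L) {q : S → A → ℝ} (hq : q ∈ M.occSet) :
    ∑ s ∈ Finset.univ.erase M.terminal, ∑ a, q s a = L := by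
  obtain ⟨p, hp, rfl⟩ := hq
  have h := M.sum_trajProb_mul_sum p (fun _ _ => 1)
  simp only [pairing, one_mul, Finset.sum_const, Finset.card_univ, Fintype.card_fin,
    nsmul_eq_mul, mul_one, ← Finset.sum_mul, M.sum_trajProb hp] at h
  exact h.symm

/-! ### First and second moments of the visits -/

lemma sum_trajProb_mul_estimator (M : LayeredMDP S A L) {p : S → A → ℝ} (hp : M.IsPolicy p)
    (ℓ : S → A → ℝ) {s : S} {a : A} (hs : s ≠ M.terminal) (h : 0 < M.occ p s a) :
    ∑ τ, M.trajProb p τ * ((∑ k, ℓ (τ k).1 (τ k).2) *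
      (visitPair τ s a / M.occ p s a - visitState τ s / ∑ a', M.occ p s a'))
      = M.advantage p ℓ s a := by
  have h1 := M.pathExp_loss_mul_visit hp ℓ s a (n := L) (s := M.start)
    (by rw [M.layer_start]; rfl)
  rw [← M.sum_trajProb_mul, ← M.sum_trajProb_mul] at h1
  have h2 := M.occ_eq hp s a
  have hpne : p s a ≠ 0 := by rintro h0; rw [h2, h0, zero_mul] at h; exact h.ne rfl
  have hrne : M.reach p s ≠ 0 := by rintro h0; rw [h2, h0, mul_zero] at h; exact h.ne rfl
  rw [M.sum_occ hp hs, h2]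
  change _ = p s a * M.advantage p ℓ s a * M.reach p s at h1
  calc _ = (p s a * M.reach p s)⁻¹ * ∑ τ, M.trajProb p τ * ((∑ k, ℓ (τ k).1 (τ k).2) *
        (visitPair τ s a - p s a * visitState τ s)) := by
        rw [Finset.mul_sum]
        refine Finset.sum_congr rfl fun τ _ => ?_
        field_simp
    _ = _ := by
        rw [h1]
        field_simp

/-- The variance of the indicator of `(s, a)`, given that `s` is visited, times the probability
that `s` is visited. -/
noncomputable def spread (q : S → A → ℝ) (s : S) (a : A) : ℝ :=
  q s a * (∑ a', q s a' - q s a) / ∑ a', q s a'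

/-- For indicators with `visitPair ≤ visitState` the square is linear in the two of them, so the
first moments `occ` and `reach` determine the sum. -/
lemma sum_trajProb_mul_sq (M : LayeredMDP S A L) {p : S → A → ℝ} (hp : M.IsPolicy p)
    {s : S} (a : A) (hs : s ≠ M.terminal) :
    ∑ τ, M.trajProb p τ * (visitState τ s *
      (visitPair τ s a - M.occ p s a / ∑ a', M.occ p s a') ^ 2)
      = spread (M.occ p) s a := by
  rw [spread]
  set c := M.occ p s a / ∑ a', M.occ p s a' with hc
  have h1 : ∀ τ : Trajectory S A L, M.trajProb p τ * (visitState τ s * (visitPair τ s a - c) ^ 2)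
      = (1 - 2 * c) * (M.trajProb p τ * visitPair τ s a)
        + c ^ 2 * (M.trajProb p τ * visitState τ s) := by
    intro τ
    have h3 := visitPair_le_visitState τ s a
    rcases visitPair_mem τ s a with h | h <;> rcases visitState_mem τ s with h' | h' <;>
      rw [h, h'] at h3 <;> rw [h, h'] <;> first | ring1 | norm_num at h3
  simp only [h1, Finset.sum_add_distrib, ← Finset.mul_sum]
  change (1 - 2 * c) * M.occ p s a + c ^ 2 * M.reach p s = _
  rw [M.sum_occ hp hs] at hc ⊢
  by_cases hr : M.reach p s = 0
  · rw [M.occ_eq hp, hr] at *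
    simp
  · rw [hc]
    field_simp
    ring

lemma spread_nonneg (M : LayeredMDP S A L) {q : S → A → ℝ} (hq : q ∈ M.occSet) (s : S) (a : A) :
    0 ≤ spread q s a :=
  div_nonneg (mul_nonneg (M.mem_occSet_nonneg hq s a) (sub_nonneg.2 (M.mem_occSet_le_sum hq s a)))
    (Finset.sum_nonneg fun a _ => M.mem_occSet_nonneg hq s a)

lemma spread_le (M : LayeredMDP S A L) {q : S → A → ℝ} (hq : q ∈ M.occSet) (s : S) (a : A) :
    spread q s a ≤ q s a := by
  have h0 := M.mem_occSet_nonneg hq s a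
  have h1 := M.mem_occSet_le_sum hq s a
  unfold spread
  refine div_le_of_le_mul₀ (h0.trans h1) h0 ?_
  nlinarith

/-- Applied to the action of the comparator policy, this charges its variance to the deviations from
that policy. -/
lemma spread_le_sum_erase (M : LayeredMDP S A L) {q : S → A → ℝ} (hq : q ∈ M.occSet) (s : S)
    (a : A) : spread q s a ≤ ∑ a' ∈ Finset.univ.erase a, q s a' := by
  have h0 := M.mem_occSet_nonneg hq s a
  have h1 := M.mem_occSet_le_sum hq s a
  rw [Finset.sum_erase_eq_sub (Finset.mem_univ a)]
  unfold spread
  refine div_le_of_le_mul₀ (h0.trans h1) (by linarith) ?_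
  nlinarith

/-! ### Comparators and deviations -/

/-- Half of a positive supremum is exceeded somewhere, so no compactness of `occSet` is needed; the
price is the factor 2. -/
lemma exists_half_max (M : LayeredMDP S A L) (hne : M.occSet.Nonempty) (s : S) (a : A) :
    ∃ q₀ ∈ M.occSet, ∀ q ∈ M.occSet, q s a ≤ 2 * q₀ s a := by
  by_cases h : ∃ q ∈ M.occSet, 0 < q s a
  · obtain ⟨q, hq, hpos⟩ := h
    have hb : BddAbove ((fun q : S → A → ℝ => q s a) '' M.occSet) := by
      refine ⟨1, ?_⟩
      rintro _ ⟨q, hq, rfl⟩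
      exact M.mem_occSet_le_one hq s a
    have hle : ∀ q ∈ M.occSet, q s a ≤ sSup ((fun q : S → A → ℝ => q s a) '' M.occSet) :=
      fun q hq => le_csSup hb ⟨q, hq, rfl⟩
    have hp := lt_of_lt_of_le hpos (hle q hq)
    obtain ⟨_, ⟨q₀, hq₀, rfl⟩, hlt⟩ := exists_lt_of_lt_csSup (hne.image _) (half_lt_self hp)
    refine ⟨q₀, hq₀, fun q hq => ?_⟩
    have := hle q hq
    simp only at hlt
    linarith
  · push Not at h
    obtain ⟨q₀, hq₀⟩ := hne
    exact ⟨q₀, hq₀, fun q hq => (h q hq).trans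
      (mul_nonneg zero_le_two (M.mem_occSet_nonneg hq₀ s a))⟩

/-- The average over all pairs of near-maximizers of the single coordinates retains a `1 / (|S||A|)`
share of each of them. -/
lemma exists_mix (M : LayeredMDP S A L) (hne : M.occSet.Nonempty) [Nonempty A] :
    ∃ q₀ ∈ M.occSet, ∀ q ∈ M.occSet, ∀ s a,
      q s a ≤ 2 * (Fintype.card S * Fintype.card A) * q₀ s a := by
  have : Nonempty S := ⟨M.start⟩
  choose f hf hmax using fun x : S × A => M.exists_half_max hne x.1 x.2
  have hN : (0 : ℝ) < Fintype.card S * Fintype.card A := by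
    have h1 := Fintype.card_pos (α := S)
    have h2 := Fintype.card_pos (α := A)
    positivity
  set N : ℝ := Fintype.card S * Fintype.card A with hNdef
  refine ⟨∑ x : S × A, (1 / N) • f x, M.convex_occSet.sum_mem (fun _ _ => by positivity) ?_
    (fun x _ => hf x), fun q hq s a => ?_⟩
  · simp only [Finset.sum_const, Finset.card_univ, Fintype.card_prod, nsmul_eq_mul, Nat.cast_mul]
    rw [← hNdef]
    field_simp
  · refine (hmax (s, a) q hq).trans ?_
    rw [mul_assoc]
    refine mul_le_mul_of_nonneg_left ?_ zero_le_two
    simp only [Finset.sum_apply, Pi.smul_apply, smul_eq_mul, ← Finset.mul_sum]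
    rw [← mul_assoc, mul_one_div_cancel hN.ne', one_mul]
    exact Finset.single_le_sum (f := fun x => f x s a)
      (fun x _ => M.mem_occSet_nonneg (hf x) s a) (Finset.mem_univ (s, a))

lemma pairing_add_smul (M : LayeredMDP S A L) (ℓ q q' : S → A → ℝ) (x y : ℝ) :
    M.pairing ℓ (x • q + y • q') = x * M.pairing ℓ q + y * M.pairing ℓ q' := by
  simp only [pairing, Pi.add_apply, Pi.smul_apply, smul_eq_mul, mul_add, Finset.sum_add_distrib,
    Finset.mul_sum]
  congr 1 <;> refine Finset.sum_congr rfl fun s _ => Finset.sum_congr rfl fun a _ => by ring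

/-- A comparator in the domain of the barriers that is close to a given occupancy measure and is
not much smaller than any other one. -/
lemma exists_comparator (M : LayeredMDP S A L) [Nonempty A] {q : S → A → ℝ} (hq : q ∈ M.occSet)
    {T : ℝ} (hT : 1 ≤ T) :
    ∃ u ∈ M.barrierDomain, ∃ q₀ ∈ M.occSet,
      (∀ ℓ, M.pairing ℓ u = (1 - 1 / T) * M.pairing ℓ q + 1 / T * M.pairing ℓ q₀) ∧
      (∀ s a, (1 - 1 / T) * q s a ≤ u s a) ∧
      ∀ q' ∈ M.occSet, ∀ s a, q' s a ≤ 2 * (Fintype.card S * Fintype.card A) * T * u s a := by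
  obtain ⟨q₀, hq₀, hmax⟩ := M.exists_mix ⟨q, hq⟩
  have hT0 : 0 < T := by linarith
  have h1 : 0 ≤ 1 - 1 / T := by
    rw [sub_nonneg, div_le_one hT0]; exact hT
  have hle : ∀ q' ∈ M.occSet, ∀ s a, q' s a ≤ 2 * (Fintype.card S * Fintype.card A) * T *
      ((1 - 1 / T) • q + (1 / T) • q₀) s a := by
    intro q' hq' s a
    refine (hmax q' hq' s a).trans ?_
    rw [mul_assoc _ T]
    refine mul_le_mul_of_nonneg_left ?_ (by positivity)
    simp only [Pi.add_apply, Pi.smul_apply, smul_eq_mul, mul_add]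
    have e1 : T * (1 / T * q₀ s a) = q₀ s a := by field_simp
    rw [e1]
    have := mul_nonneg hT0.le (mul_nonneg h1 (M.mem_occSet_nonneg hq s a))
    linarith
  have hmem : (1 - 1 / T) • q + (1 / T) • q₀ ∈ M.occSet :=
    M.convex_occSet hq hq₀ h1 (by positivity) (by ring)
  refine ⟨(1 - 1 / T) • q + (1 / T) • q₀, ⟨hmem, ?_⟩, q₀, hq₀,
    fun ℓ => M.pairing_add_smul ℓ q q₀ _ _, fun s a => ?_, hle⟩
  · rintro s a - ⟨q', hq', hpos⟩
    by_contra hneg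
    have := hle q' hq' s a
    have h3 : (2 * (Fintype.card S * Fintype.card A) * T : ℝ) *
      ((1 - 1 / T) • q + (1 / T) • q₀) s a ≤ 0 :=
      mul_nonpos_of_nonneg_of_nonpos (by positivity) (not_lt.1 hneg)
    linarith
  · simp only [Pi.add_apply, Pi.smul_apply, smul_eq_mul]
    have := mul_nonneg (by positivity : 0 ≤ 1 / T) (M.mem_occSet_nonneg hq₀ s a)
    linarith

lemma detPolicy_isPolicy (M : LayeredMDP S A L) (π : S → A) : M.IsPolicy (detPolicy π) := by
  intro s _
  refine ⟨fun a => ?_, by simp [detPolicy]⟩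
  unfold detPolicy
  split_ifs <;> norm_num

lemma occ_detPolicy_of_ne (M : LayeredMDP S A L) (π : S → A) {s : S} {a : A} (h : a ≠ π s) :
    M.occ (detPolicy π) s a = 0 := by
  rw [M.occ_eq (M.detPolicy_isPolicy π), detPolicy, if_neg h, zero_mul]

lemma sum_occ_detPolicy (M : LayeredMDP S A L) (π : S → A) (s : S) :
    ∑ a, M.occ (detPolicy π) s a = M.occ (detPolicy π) s (π s) :=
  Finset.sum_eq_single_of_mem _ (Finset.mem_univ _) fun _ _ h => M.occ_detPolicy_of_ne π h

/-- The total probability of the deviations of an occupancy measure from a deterministic policy. -/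
noncomputable def deviation (M : LayeredMDP S A L) (π : S → A) (q : S → A → ℝ) : ℝ :=
  ∑ s ∈ Finset.univ.erase M.terminal, ∑ a ∈ Finset.univ.erase (π s), q s a

/-- Induction on the layer. Mass in excess of that of `π` enters the next layer in two ways: excess
already present that follows `π`, and mass that deviates from `π` in the present layer. Transitions
preserve total mass, so the excess grows by at most these deviations. -/
lemma layer_excess_le (M : LayeredMDP S A L) (π : S → A) {q : S → A → ℝ} (hq : q ∈ M.occSet)
    (k : ℕ) (hk : k < L) :
    ∑ s with M.layer s = k, max (∑ a, q s a - M.occ (detPolicy π) s (π s)) 0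
      ≤ ∑ s with M.layer s < k, ∑ a ∈ Finset.univ.erase (π s), q s a := by
  have hf := M.isFlow_of_mem_occSet hq
  have hg := M.isFlow_occ (M.detPolicy_isPolicy π)
  induction k with
  | zero =>
    have : (Finset.univ.filter fun s => M.layer s = 0) = {M.start} := by
      ext s; simp [M.layer_eq_zero_iff]
    rw [this, Finset.sum_singleton, ← M.sum_occ_detPolicy, hf.flow _ M.start_ne_terminal,
      hg.flow _ M.start_ne_terminal, M.sum_erase_layer, M.sum_erase_layer]
    simp [M.layer_start]
  | succ k ih =>
    have ih := ih (by omega)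
    have hlt : (Finset.univ.filter fun s => M.layer s < k + 1)
        = (Finset.univ.filter fun s => M.layer s < k) ∪
          (Finset.univ.filter fun s => M.layer s = k) := by
      ext s
      simp only [Finset.mem_filter, Finset.mem_univ, true_and, Finset.mem_union]
      omega
    rw [hlt, Finset.sum_union (by
      rw [Finset.disjoint_filter]; intro s _ h1 h2; omega)]
    set g : S → ℝ := fun s => max (∑ a, q s a - M.occ (detPolicy π) s (π s)) 0 with hgdef
    have hstep : ∀ s', M.layer s' = k + 1 → g s' ≤ ∑ s with M.layer s = k,
        (g s * M.P s (π s) s' + ∑ a ∈ Finset.univ.erase (π s), q s a * M.P s a s') := by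
      intro s' hs'
      have hs't : s' ≠ M.terminal := (M.ne_terminal_iff _).2 (by omega)
      refine max_le ?_ (Finset.sum_nonneg fun s _ => add_nonneg
        (mul_nonneg (le_max_right _ _) (M.P_nonneg _ _ _))
        (Finset.sum_nonneg fun a _ => mul_nonneg (hf.nonneg s a) (M.P_nonneg _ _ _)))
      rw [← M.sum_occ_detPolicy, hf.flow _ hs't, hg.flow _ hs't, M.sum_erase_layer,
        M.sum_erase_layer, add_sub_add_left_eq_sub, ← Finset.sum_sub_distrib]
      have hset : ((Finset.univ.erase M.terminal).filter fun s => M.layer s + 1 = M.layer s')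
          = Finset.univ.filter fun s => M.layer s = k := by
        ext s
        simp only [Finset.mem_filter, Finset.mem_erase, Finset.mem_univ, and_true, true_and,
          M.ne_terminal_iff]
        omega
      rw [hset]
      refine Finset.sum_le_sum fun s _ => ?_
      rw [← Finset.add_sum_erase _ _ (Finset.mem_univ (π s)),
        ← Finset.add_sum_erase _ (fun a => M.occ (detPolicy π) s a * M.P s a s')
          (Finset.mem_univ (π s))]
      have h0 : ∑ a ∈ Finset.univ.erase (π s), M.occ (detPolicy π) s a * M.P s a s' = 0 :=
        Finset.sum_eq_zero fun a ha => by
          rw [M.occ_detPolicy_of_ne π (Finset.ne_of_mem_erase ha), zero_mul]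
      rw [h0, add_zero]
      have h1 : q s (π s) - M.occ (detPolicy π) s (π s) ≤ g s :=
        (sub_le_sub_right (M.mem_occSet_le_sum hq s (π s)) _).trans (le_max_left _ _)
      have h2 := mul_le_mul_of_nonneg_right h1 (M.P_nonneg s (π s) s')
      linarith
    calc ∑ s' with M.layer s' = k + 1, g s'
        ≤ ∑ s' with M.layer s' = k + 1, ∑ s with M.layer s = k,
          (g s * M.P s (π s) s' + ∑ a ∈ Finset.univ.erase (π s), q s a * M.P s a s') :=
          Finset.sum_le_sum fun s' hs' => hstep s' (Finset.mem_filter.1 hs').2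
      _ ≤ ∑ s', ∑ s with M.layer s = k,
          (g s * M.P s (π s) s' + ∑ a ∈ Finset.univ.erase (π s), q s a * M.P s a s') := by
          refine Finset.sum_le_sum_of_subset_of_nonneg (Finset.filter_subset _ _) fun s' _ _ => ?_
          exact Finset.sum_nonneg fun s _ => add_nonneg
            (mul_nonneg (le_max_right _ _) (M.P_nonneg _ _ _))
            (Finset.sum_nonneg fun a _ => mul_nonneg (hf.nonneg s a) (M.P_nonneg _ _ _))
      _ = ∑ s with M.layer s = k, (g s + ∑ a ∈ Finset.univ.erase (π s), q s a) := by
          rw [Finset.sum_comm]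
          refine Finset.sum_congr rfl fun s hs => ?_
          have hst : s ≠ M.terminal :=
            (M.ne_terminal_iff _).2 (by rw [(Finset.mem_filter.1 hs).2]; omega)
          rw [Finset.sum_add_distrib, ← Finset.mul_sum, M.P_sum _ _ hst, mul_one, Finset.sum_comm]
          simp only [← Finset.mul_sum, M.P_sum _ _ hst, mul_one]
      _ ≤ _ := by
          rw [Finset.sum_add_distrib]
          exact add_le_add_left ih _

/-- The excess of each of the `L` layers is bounded by the full deviation. This factor `L` becomes
the `L` in `tsallisU`. -/
lemma sum_excess_le (M : LayeredMDP S A L) (π : S → A) {q : S → A → ℝ} (hq : q ∈ M.occSet) :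
    ∑ s ∈ Finset.univ.erase M.terminal, max (∑ a, q s a - M.occ (detPolicy π) s (π s)) 0
      ≤ L * M.deviation π q := by
  have hmaps : ∀ s ∈ Finset.univ.erase M.terminal, M.layer s ∈ Finset.range L := fun s hs =>
    Finset.mem_range.2 ((M.ne_terminal_iff s).1 (Finset.ne_of_mem_erase hs))
  rw [← Finset.sum_fiberwise_of_maps_to hmaps]
  calc _ ≤ ∑ k ∈ Finset.range L, M.deviation π q := by
        refine Finset.sum_le_sum fun k hk => ?_
        rw [Finset.mem_range] at hk
        have hset : ((Finset.univ.erase M.terminal).filter fun s => M.layer s = k)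
            = Finset.univ.filter fun s => M.layer s = k := by
          ext s
          simp only [Finset.mem_filter, Finset.mem_erase, Finset.mem_univ, and_true, true_and,
            M.ne_terminal_iff]
          omega
        rw [hset]
        refine (M.layer_excess_le π hq k hk).trans ?_
        refine Finset.sum_le_sum_of_subset_of_nonneg (fun s hs => ?_) fun s _ _ =>
          Finset.sum_nonneg fun a _ => M.mem_occSet_nonneg hq s a
        have := (Finset.mem_filter.1 hs).2
        simp only [Finset.mem_erase, Finset.mem_univ, and_true, M.ne_terminal_iff]
        omega
    _ = _ := by simp

end LayeredMDP

/-! ### Scalar inequalities -/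

/-- With `z = β x` the supremum of the left side over `y` is attained at `y = 1 / (1 + x)` and
equals `β (x - log (1 + x))`. The hypotheses give `x ≥ -1/2`, where `x - log (1 + x) ≤ x² / (1 + x)
≤ 2 x²`. -/
lemma log_barrier_stability {z β y : ℝ} (hz : |z| ≤ 1) (hβ : 2 ≤ β) (hy : 0 < y) :
    z * (1 - y) - β * (y - 1 - Real.log y) ≤ 2 * z ^ 2 / β := by
  have hβ0 : 0 < β := by linarith
  obtain ⟨x, rfl⟩ : ∃ x, z = β * x := ⟨z / β, by field_simp⟩
  have hx : -(1 / 2) ≤ x := by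
    rw [abs_le] at hz
    by_contra hlt
    nlinarith [hz.1]
  have hx1 : 0 < 1 + x := by linarith
  have h1 := Real.log_le_sub_one_of_pos (mul_pos hy hx1)
  rw [Real.log_mul hy.ne' hx1.ne'] at h1
  have h2 := Real.one_sub_inv_le_log_of_pos hx1
  have h3 : x - 2 * x ^ 2 ≤ 1 - (1 + x)⁻¹ := by
    have : 1 - (1 + x)⁻¹ = x / (1 + x) := by field_simp; ring
    rw [this, le_div_iff₀ hx1]
    nlinarith [mul_nonneg (sq_nonneg x) (by linarith : 0 ≤ 1 + 2 * x)]
  have h4 : x * (1 - y) - (y - 1 - Real.log y) ≤ 2 * x ^ 2 := by linarith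
  have h5 := mul_le_mul_of_nonneg_left h4 hβ0.le
  have h6 : 2 * (β * x) ^ 2 / β = β * (2 * x ^ 2) := by field_simp
  rw [h6]
  linarith

lemma two_mul_log_le {y : ℝ} (hy : 4 ≤ y) : 2 * Real.log y ≤ y - 1 := by
  have h1 : Real.log y = 2 * Real.log 2 + Real.log (y / 4) := by
    rw [Real.log_div (by linarith) (by norm_num), show (4 : ℝ) = 2 ^ 2 by norm_num, Real.log_pow]
    push_cast
    ring
  have h2 := Real.log_le_sub_one_of_pos (by linarith : 0 < y / 4)
  have h3 := Real.log_two_lt_d9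
  linarith

/-- For `y ≤ 4` the entropy term is quadratic, `(y - 1)² ≤ 9 (√y - 1)²`, and completing the square
yields `9/4`. For `y ≥ 4` the entropy term is too flat, but the barrier of weight 2 alone beats the
linear term, by `two_mul_log_le`. -/
lemma tsallis_stability {z c y : ℝ} (hz : |z| ≤ 1) (hc : 0 < c) (hy : 0 < y) :
    z * (1 - y) - c * (√y - 1) ^ 2 - 2 * (y - 1 - Real.log y) ≤ 9 / 4 * z ^ 2 / c := by
  have hlog := Real.log_le_sub_one_of_pos hy
  have hs : 0 ≤ √y := Real.sqrt_nonneg y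
  have hyy : √y ^ 2 = y := Real.sq_sqrt hy.le
  rw [le_div_iff₀ hc]
  rcases le_total y 4 with h | h
  · have h2 : √y ≤ 2 := by
      rw [show (2 : ℝ) = √4 by rw [show (4 : ℝ) = 2 ^ 2 by norm_num]; simp]
      exact Real.sqrt_le_sqrt h
    have h3 : (y - 1) ^ 2 ≤ 9 * (√y - 1) ^ 2 := by
      have : (y - 1) ^ 2 = (√y + 1) ^ 2 * (√y - 1) ^ 2 := by
        rw [← mul_pow, ← hyy]
        simp only [Real.sqrt_sq hs]
        ring
      rw [this]
      exact mul_le_mul_of_nonneg_right (by nlinarith) (sq_nonneg _)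
    have h4 : (c * (1 - y)) ^ 2 ≤ 9 * (c ^ 2 * (√y - 1) ^ 2) := by
      nlinarith [mul_le_mul_of_nonneg_left h3 (sq_nonneg c)]
    nlinarith [sq_nonneg (3 / 2 * z - c * (1 - y) / 3), mul_nonneg hc.le (sub_nonneg.2 hlog)]
  · have h1 := two_mul_log_le h
    have h2 : z * (1 - y) ≤ y - 1 := by
      rw [abs_le] at hz
      nlinarith
    have h3 := mul_nonneg hc.le (sq_nonneg (√y - 1))
    have h4 : z * (1 - y) - c * (√y - 1) ^ 2 - 2 * (y - 1 - Real.log y) ≤ 0 := by linarith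
    exact (mul_nonpos_of_nonpos_of_nonneg h4 hc.le).trans (by positivity)

lemma sqrt_sub_sqrt_pred_le {t : ℕ} (ht : 1 ≤ t) :
    √(t : ℝ) - √((t - 1 : ℕ) : ℝ) ≤ 1 / √(t : ℝ) := by
  have h1 : (0 : ℝ) < t := by exact_mod_cast ht
  have h2 : 0 < √(t : ℝ) := Real.sqrt_pos.2 h1
  rw [le_div_iff₀ h2, sub_mul, Real.mul_self_sqrt h1.le]
  have h3 : ((t - 1 : ℕ) : ℝ) = t - 1 := by push_cast [Nat.cast_sub ht]; ring
  have h4 : √((t - 1 : ℕ) : ℝ) * √((t - 1 : ℕ) : ℝ) = t - 1 := by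
    rw [Real.mul_self_sqrt (Nat.cast_nonneg _), h3]
  have h5 : √((t - 1 : ℕ) : ℝ) ≤ √(t : ℝ) := Real.sqrt_le_sqrt (by rw [h3]; linarith)
  nlinarith [Real.sqrt_nonneg ((t - 1 : ℕ) : ℝ)]

lemma sum_one_div_sqrt_le (n : ℕ) : ∑ t ∈ Finset.Icc 1 n, 1 / √(t : ℝ) ≤ 2 * √(n : ℝ) := by
  induction n with
  | zero => simp
  | succ n ih =>
    rw [Finset.sum_Icc_succ_top (by omega)]
    have h1 : (0 : ℝ) < ((n + 1 : ℕ) : ℝ) := by positivity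
    have h2 : 0 < √((n + 1 : ℕ) : ℝ) := Real.sqrt_pos.2 h1
    have h3 := Real.sq_sqrt h1.le
    have h4 := Real.sq_sqrt (Nat.cast_nonneg (α := ℝ) n)
    have h5 : 1 / √((n + 1 : ℕ) : ℝ) ≤ 2 * √((n + 1 : ℕ) : ℝ) - 2 * √(n : ℝ) := by
      rw [div_le_iff₀ h2]
      push_cast at h3 h4 ⊢
      nlinarith [sq_nonneg (√((n : ℝ) + 1) - √(n : ℝ))]
    linarith

lemma sum_one_div_le {n : ℕ} (hn : 2 ≤ n) :
    ∑ t ∈ Finset.Icc 1 n, 1 / (t : ℝ) ≤ 3 * Real.log n := by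
  have h1 := harmonic_le_one_add_log n
  have h2 : ((harmonic n : ℚ) : ℝ) = ∑ t ∈ Finset.Icc 1 n, 1 / (t : ℝ) := by
    rw [harmonic_eq_sum_Icc]
    push_cast
    simp
  have h3 : Real.log 2 ≤ Real.log n := Real.log_le_log (by norm_num) (by exact_mod_cast hn)
  have h4 := Real.log_two_gt_d9
  rw [h2] at h1
  linarith

/-- The sum of `ρ_t` times an adaptive learning rate. -/
lemma sum_div_sqrt_le {ρ : ℕ → ℝ} {b : ℝ} (hb : 1 / 4 ≤ b) (n : ℕ)
    (h0 : ∀ t ∈ Finset.Icc 1 n, 0 ≤ ρ t) (h1 : ∀ t ∈ Finset.Icc 1 n, ρ t ≤ 1) :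
    ∑ t ∈ Finset.Icc 1 n, ρ t / √(4 + 1 / b * ∑ j ∈ Finset.Ico 1 t, ρ j)
      ≤ 2 * √(b * ∑ t ∈ Finset.Icc 1 n, ρ t) := by
  induction n with
  | zero => simp
  | succ n ih =>
    have ih := ih (fun t ht => h0 t (Finset.Icc_subset_Icc_right (by omega) ht))
      (fun t ht => h1 t (Finset.Icc_subset_Icc_right (by omega) ht))
    rw [Finset.sum_Icc_succ_top (by omega), Finset.sum_Icc_succ_top (by omega)]
    have hI : Finset.Ico 1 (n + 1) = Finset.Icc 1 n := by
      ext; simp only [Finset.mem_Ico, Finset.mem_Icc]; omega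
    rw [hI]
    set R := ∑ t ∈ Finset.Icc 1 n, ρ t with hR
    have hR0 : 0 ≤ R := Finset.sum_nonneg fun t ht =>
      h0 t (Finset.Icc_subset_Icc_right (by omega) ht)
    have hr0 := h0 (n + 1) (by simp)
    have hr1 := h1 (n + 1) (by simp)
    set r := ρ (n + 1)
    have hb0 : 0 < b := by linarith
    set m := √(4 + 1 / b * R) with hm
    have hm0 : 0 < m := Real.sqrt_pos.2 (by positivity)
    have hm2 : m ^ 2 = 4 + 1 / b * R := Real.sq_sqrt (by positivity)
    have ha2 : √(b * (R + r)) ^ 2 = b * (R + r) := Real.sq_sqrt (by positivity)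
    have hb2 : √(b * R) ^ 2 = b * R := Real.sq_sqrt (by positivity)
    have hab : √(b * R) ≤ √(b * (R + r)) := Real.sqrt_le_sqrt (by nlinarith)
    -- The rate does not yet know the newest term `r`. Since `r ≤ 1 ≤ 4 b`, the constant 4 inside
    -- the root makes up for this delay.
    have ha : √(b * (R + r)) ≤ b * m := by
      rw [Real.sqrt_le_left (by positivity), mul_pow, hm2]
      have : b ^ 2 * (4 + 1 / b * R) = 4 * b ^ 2 + b * R := by field_simp
      rw [this]
      nlinarith
    have hstep : r / m ≤ 2 * √(b * (R + r)) - 2 * √(b * R) := by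
      rw [div_le_iff₀ hm0]
      have e1 : b * r = (√(b * (R + r)) - √(b * R)) * (√(b * (R + r)) + √(b * R)) := by
        nlinarith
      have e2 : b * r ≤ b * ((2 * √(b * (R + r)) - 2 * √(b * R)) * m) := by
        rw [e1]
        have := mul_le_mul_of_nonneg_left
          (by linarith : √(b * (R + r)) + √(b * R) ≤ 2 * (b * m)) (sub_nonneg.2 hab)
        linarith
      exact le_of_mul_le_mul_left e2 hb0
    linarith

/-- Replacing `x t` by `B` is allowed because the increments are nonnegative, even when `x t` is
negative; then the weights telescope. -/
lemma sum_telescope_mul_le {β x : ℕ → ℝ} {B : ℝ} (hβ0 : β 0 = 0) (n : ℕ)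
    (hmono : ∀ t ∈ Finset.Icc 1 n, β (t - 1) ≤ β t) (hx : ∀ t ∈ Finset.Icc 1 n, x t ≤ B) :
    ∑ t ∈ Finset.Icc 1 n, (β t - β (t - 1)) * x t ≤ β n * B := by
  induction n with
  | zero => simp [hβ0]
  | succ n ih =>
    rw [Finset.sum_Icc_succ_top (by omega)]
    have h1 := ih (fun t ht => hmono t (Finset.Icc_subset_Icc_right (by omega) ht))
      (fun t ht => hx t (Finset.Icc_subset_Icc_right (by omega) ht))
    have h2 := mul_le_mul_of_nonneg_left (hx (n + 1) (by simp))
      (sub_nonneg.2 (hmono (n + 1) (by simp)))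
    simp only [Nat.add_sub_cancel] at h2 ⊢
    linarith

/-! ### Follow the regularized leader -/

section FollowTheRegularizedLeader

variable {ι : Type*}

/-- The Tsallis entropy with weight `α` plus the logarithmic barrier with weights `β`. -/
noncomputable def hybridReg (I : Finset ι) (α : ℝ) (β q : ι → ℝ) : ℝ :=
  ∑ i ∈ I, (-(2 * α) * √(q i) - β i * Real.log (q i))

/-- The Bregman divergence of `hybridReg`. -/
noncomputable def hybridBreg (I : Finset ι) (α : ℝ) (β x q : ι → ℝ) : ℝ :=
  ∑ i ∈ I, (α * (√(x i) - √(q i)) ^ 2 / √(q i) + β i * (x i / q i - 1 - Real.log (x i / q i)))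

lemma deriv_nonneg_of_min {g : ℝ → ℝ} {g' : ℝ} (hg : HasDerivAt g g' 0)
    (hmin : ∀ c, 0 < c → c ≤ 1 → g 0 ≤ g c) : 0 ≤ g' := by
  have h1 := hasDerivWithinAt_iff_tendsto_slope.1 (hg.hasDerivWithinAt (s := Set.Ioi 0))
  have h2 : Set.Ioi (0 : ℝ) \ {0} = Set.Ioi 0 := by simp
  rw [h2] at h1
  refine ge_of_tendsto h1 ?_
  filter_upwards [Ioc_mem_nhdsGT (zero_lt_one (α := ℝ))] with c hc
  rw [slope_def_field]
  exact div_nonneg (sub_nonneg.2 (hmin c hc.1 hc.2)) (by linarith [hc.1])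

/-- A minimizer over a convex set minimizes with a gap of the Bregman divergence. -/
lemma hybridReg_min_add_breg {I : Finset ι} {D : Set (ι → ℝ)} (hD : Convex ℝ D)
    (hpos : ∀ q ∈ D, ∀ i ∈ I, 0 < q i) {α : ℝ} {β c q x : ι → ℝ} (hq : q ∈ D) (hx : x ∈ D)
    (hmin : IsMinOn (fun y => ∑ i ∈ I, c i * y i + hybridReg I α β y) D q) :
    ∑ i ∈ I, c i * q i + hybridReg I α β q + hybridBreg I α β x q
      ≤ ∑ i ∈ I, c i * x i + hybridReg I α β x := by
  -- `G` is the gradient of the objective at `q`, and `g` is the objective on the segment from `q`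
  -- to `x`.
  set G : ι → ℝ := fun i => c i - α / √(q i) - β i / q i with hG
  set g : ℝ → ℝ := fun r => ∑ i ∈ I, (c i * (q i + r * (x i - q i)) +
    (-(2 * α) * √(q i + r * (x i - q i)) - β i * Real.log (q i + r * (x i - q i)))) with hgdef
  have hgd : HasDerivAt g (∑ i ∈ I, G i * (x i - q i)) 0 := by
    refine HasDerivAt.fun_sum fun i hi => ?_
    have hqi := hpos q hq i hi
    have hlin : HasDerivAt (fun r : ℝ => q i + r * (x i - q i)) (x i - q i) 0 := by
      simpa using ((hasDerivAt_id (0 : ℝ)).mul_const (x i - q i)).const_add (q i)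
    have h0 : q i + 0 * (x i - q i) ≠ 0 := by simpa using hqi.ne'
    have h1 := hlin.sqrt h0
    have h2 := hlin.log h0
    have h3 := (hlin.const_mul (c i)).add ((h1.const_mul (-(2 * α))).sub (h2.const_mul (β i)))
    refine h3.congr_deriv ?_
    simp only [zero_mul, add_zero, hG]
    have := (Real.sqrt_pos.2 hqi).ne'
    field_simp
    ring
  have hval : ∀ r, g r = ∑ i ∈ I, c i * (q + r • (x - q)) i + hybridReg I α β (q + r • (x - q)) :=
    fun r => by
      simp only [hgdef, hybridReg, Pi.add_apply, Pi.smul_apply, Pi.sub_apply, smul_eq_mul,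
        ← Finset.sum_add_distrib]
  have hfirst : 0 ≤ ∑ i ∈ I, G i * (x i - q i) := by
    refine deriv_nonneg_of_min hgd fun r hr0 hr1 => ?_
    have hmem : q + r • (x - q) ∈ D := by
      have := hD hq hx (sub_nonneg.2 hr1) hr0.le (by ring)
      convert this using 1
      module
    rw [hval, hval]
    simpa using hmin hmem
  -- The linear part of the objective has no curvature, so the Bregman divergence of the regularizer
  -- is the whole error of the first-order expansion at `q`. What remains is the derivative towards
  -- `x`, nonnegative at a minimizer.
  have hident : ∑ i ∈ I, c i * x i + hybridReg I α β x
      - (∑ i ∈ I, c i * q i + hybridReg I α β q + hybridBreg I α β x q)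
      = ∑ i ∈ I, G i * (x i - q i) := by
    simp only [hybridReg, hybridBreg, ← Finset.sum_add_distrib, ← Finset.sum_sub_distrib]
    refine Finset.sum_congr rfl fun i hi => ?_
    have hqi := hpos q hq i hi
    have hxi := hpos x hx i hi
    have hs := Real.sqrt_pos.2 hqi
    rw [Real.log_div hxi.ne' hqi.ne']
    have e1 : α * (√(x i) - √(q i)) ^ 2 / √(q i)
        = α * (x i - q i) / √(q i) - 2 * α * √(x i) + 2 * α * √(q i) := by
      rw [eq_comm, eq_div_iff hs.ne', add_mul, sub_mul, div_mul_cancel₀ _ hs.ne']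
      have h1 := Real.sq_sqrt hqi.le
      have h2 := Real.sq_sqrt hxi.le
      linear_combination (-α) * h2 + α * h1
    rw [e1]
    simp only [hG]
    field_simp
    ring
  linarith

/-- The regret of follow the regularized leader, in terms of bounds `r t` on the stability of the
minimizers. -/
lemma sum_regret_le {I : Finset ι} {D : Set (ι → ℝ)} (hD : Convex ℝ D)
    (hpos : ∀ q ∈ D, ∀ i ∈ I, 0 < q i) {α r : ℕ → ℝ} {β ℓ q : ℕ → ι → ℝ} (hα0 : α 0 = 0)
    (hβ0 : ∀ i, β 0 i = 0) (n : ℕ) (hq : ∀ t ∈ Finset.Icc 1 n, q t ∈ D)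
    (hmin : ∀ t ∈ Finset.Icc 1 n, IsMinOn (fun y => ∑ i ∈ I, (∑ j ∈ Finset.Ico 1 t, ℓ j i) * y i
      + hybridReg I (α t) (β t) y) D (q t))
    (hstab : ∀ t ∈ Finset.Icc 1 n, ∀ x ∈ D,
      ∑ i ∈ I, ℓ t i * (q t i - x i) - hybridBreg I (α t) (β t) x (q t) ≤ r t)
    {u : ι → ℝ} (hu : u ∈ D) :
    ∑ t ∈ Finset.Icc 1 n, ∑ i ∈ I, ℓ t i * (q t i - u i) ≤ ∑ t ∈ Finset.Icc 1 n, r t +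
      ∑ t ∈ Finset.Icc 1 n, ∑ i ∈ I, (2 * (α t - α (t - 1)) * (√(q t i) - √(u i))
        + (β t i - β (t - 1) i) * Real.log (q t i / u i)) := by
  have hreg0 : ∀ y, hybridReg I (α 0) (β 0) y = 0 := fun y => by simp [hybridReg, hα0, hβ0]
  -- The comparator is quantified inside the induction: the hypothesis for `n` is used with `q (n +
  -- 1)` in place of `u`, and minimality of `q (n + 1)` passes from there to `u`. The divergence
  -- gained in that passage pays for the stability of episode `n + 1`.
  have main : ∀ u ∈ D, ∑ t ∈ Finset.Icc 1 n, ∑ i ∈ I, ℓ t i * (q t i - u i)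
      ≤ ∑ t ∈ Finset.Icc 1 n, r t + hybridReg I (α n) (β n) u
        - ∑ t ∈ Finset.Icc 1 n, (hybridReg I (α t) (β t) (q t)
          - hybridReg I (α (t - 1)) (β (t - 1)) (q t)) := by
    clear hu u
    induction n with
    | zero => intro u _; simp [hreg0]
    | succ n ih =>
      intro u hu
      have hsub : ∀ t ∈ Finset.Icc 1 n, t ∈ Finset.Icc 1 (n + 1) := fun t ht =>
        Finset.Icc_subset_Icc_right (by omega) ht
      have hlast : n + 1 ∈ Finset.Icc 1 (n + 1) := by simp
      have h1 := ih (fun t ht => hq t (hsub t ht)) (fun t ht => hmin t (hsub t ht))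
        (fun t ht => hstab t (hsub t ht)) (q (n + 1)) (hq _ hlast)
      have h2 := hybridReg_min_add_breg hD hpos (hq _ hlast) hu (hmin _ hlast)
      have h3 := hstab _ hlast u hu
      have hI : Finset.Ico 1 (n + 1) = Finset.Icc 1 n := by
        ext; simp only [Finset.mem_Ico, Finset.mem_Icc]; omega
      rw [hI] at h2
      have h4 : ∑ t ∈ Finset.Icc 1 n, ∑ i ∈ I, ℓ t i * (q t i - u i)
          = ∑ t ∈ Finset.Icc 1 n, ∑ i ∈ I, ℓ t i * (q t i - q (n + 1) i)
            + (∑ i ∈ I, (∑ j ∈ Finset.Icc 1 n, ℓ j i) * q (n + 1) i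
              - ∑ i ∈ I, (∑ j ∈ Finset.Icc 1 n, ℓ j i) * u i) := by
        simp only [Finset.sum_mul]
        rw [Finset.sum_comm (s := I), Finset.sum_comm (s := I), ← Finset.sum_sub_distrib,
          ← Finset.sum_add_distrib]
        refine Finset.sum_congr rfl fun t _ => ?_
        rw [← Finset.sum_sub_distrib, ← Finset.sum_add_distrib]
        refine Finset.sum_congr rfl fun i _ => ?_
        ring
      simp only [Finset.sum_Icc_succ_top (show 1 ≤ n + 1 by omega), Nat.add_sub_cancel]
      rw [h4]
      linarith
  refine (main u hu).trans ?_
  have htel : hybridReg I (α n) (β n) u = ∑ t ∈ Finset.Icc 1 n,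
      (hybridReg I (α t) (β t) u - hybridReg I (α (t - 1)) (β (t - 1)) u) := by
    clear main hq hmin hstab
    induction n with
    | zero => simp [hreg0]
    | succ n ih =>
      rw [Finset.sum_Icc_succ_top (by omega), ← ih]
      simp
  rw [htel, add_sub_assoc, ← Finset.sum_sub_distrib]
  refine add_le_add_right (Finset.sum_le_sum fun t ht => ?_) _
  simp only [hybridReg, ← Finset.sum_sub_distrib]
  refine Finset.sum_le_sum fun i hi => ?_
  rw [Real.log_div (hpos _ (hq t ht) i hi).ne' (hpos u hu i hi).ne']
  refine le_of_eq ?_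
  ring

end FollowTheRegularizedLeader

/-! ### Expectations given the past of an episode -/

namespace Interaction

variable {S A : Type*} [Fintype S] [Fintype A] [DecidableEq S] [DecidableEq A] {L : ℕ}
  {M : LayeredMDP S A L} {T : ℕ} {Ω : Type*} [mΩ : MeasurableSpace Ω] {μ : Measure Ω}
  {𝓕 : Filtration ℕ mΩ}

lemma measurable_trajProb (X : Interaction M T μ 𝓕) {t : ℕ} (ht : t ∈ Finset.Icc 1 T)
    (τ : Trajectory S A L) : Measurable[𝓕 t] fun ω => M.trajProb (X.policy t ω) τ := by
  unfold LayeredMDP.trajProb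
  refine Measurable.const_mul (Finset.measurable_fun_prod _ fun k _ => ?_) _
  exact (X.policy_measurable t ht _ _).mul_const _

lemma measurable_occ (X : Interaction M T μ 𝓕) {t : ℕ} (ht : t ∈ Finset.Icc 1 T)
    (s : S) (a : A) : Measurable[𝓕 t] fun ω => X.occ t ω s a := by
  unfold occ LayeredMDP.occ
  exact Finset.measurable_fun_sum _ fun τ _ => (X.measurable_trajProb ht τ).mul_const _

lemma occ_mem (X : Interaction M T μ 𝓕) {t : ℕ} (ht : t ∈ Finset.Icc 1 T) (ω : Ω) :
    X.occ t ω ∈ M.occSet := ⟨_, X.policy_isPolicy t ht ω, rfl⟩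

lemma measurableSet_traj (X : Interaction M T μ 𝓕) {t : ℕ} (ht : t ∈ Finset.Icc 1 T)
    (τ : Trajectory S A L) : MeasurableSet {ω | X.traj t ω = τ} :=
  𝓕.le (t + 1) _ (X.traj_measurable t ht (MeasurableSpace.measurableSet_top (s := {τ})))

/-- The law of the trajectory, given the past. -/
lemma trim_restrict_traj [IsProbabilityMeasure μ] (X : Interaction M T μ 𝓕) {t : ℕ}
    (ht : t ∈ Finset.Icc 1 T) (τ : Trajectory S A L) :
    (μ.restrict {ω | X.traj t ω = τ}).trim (𝓕.le t)
      = (μ.withDensity fun ω => ENNReal.ofReal (M.trajProb (X.policy t ω) τ)).trim (𝓕.le t) := by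
  refine @Measure.ext _ (𝓕 t) _ _ fun E hE => ?_
  have hE' := 𝓕.le t E hE
  have hmeas := X.measurableSet_traj ht τ
  rw [trim_measurableSet_eq _ hE, trim_measurableSet_eq _ hE, Measure.restrict_apply hE',
    withDensity_apply _ hE']
  have h1 := setIntegral_condExp (𝓕.le t)
    ((integrable_const (μ := μ) (1 : ℝ)).indicator hmeas) hE
  have hint : Integrable (fun ω => M.trajProb (X.policy t ω) τ) μ :=
    integrable_condExp.congr (X.traj_law t ht τ)
  rw [setIntegral_congr_ae hE' ((X.traj_law t ht τ).mono fun ω h _ => h),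
    setIntegral_indicator hmeas] at h1
  rw [← ofReal_integral_eq_lintegral_ofReal hint.integrableOn
    (Filter.Eventually.of_forall fun ω => M.trajProb_nonneg (X.policy_isPolicy t ht ω) τ), h1]
  simp

/-- The weights of the estimator are of order `1 / q` and need not be bounded; only their products
with the probability of the trajectory are. The equality of measures on `𝓕 t` transfers
integrability from these products. -/
lemma integrableOn_traj [IsProbabilityMeasure μ] (X : Interaction M T μ 𝓕) {t : ℕ}
    (ht : t ∈ Finset.Icc 1 T) (τ : Trajectory S A L) {g : Ω → ℝ} (hg : Measurable[𝓕 t] g)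
    (hint : Integrable (fun ω => M.trajProb (X.policy t ω) τ * g ω) μ) :
    IntegrableOn g {ω | X.traj t ω = τ} μ := by
  refine integrable_of_integrable_trim (𝓕.le t) ?_
  rw [X.trim_restrict_traj ht τ]
  refine Integrable.trim (𝓕.le t) ?_ hg.stronglyMeasurable
  rw [integrable_withDensity_iff_integrable_smul'
    (((X.measurable_trajProb ht τ).mono (𝓕.le t) le_rfl).ennreal_ofReal)
    (Filter.Eventually.of_forall fun ω => ENNReal.ofReal_lt_top)]
  refine hint.congr (Filter.Eventually.of_forall fun ω => ?_)
  simp [ENNReal.toReal_ofReal (M.trajProb_nonneg (X.policy_isPolicy t ht ω) τ)]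

lemma setIntegral_traj [IsProbabilityMeasure μ] (X : Interaction M T μ 𝓕) {t : ℕ}
    (ht : t ∈ Finset.Icc 1 T) (τ : Trajectory S A L) {g : Ω → ℝ} (hg : Measurable[𝓕 t] g) :
    ∫ ω in {ω | X.traj t ω = τ}, g ω ∂μ = ∫ ω, M.trajProb (X.policy t ω) τ * g ω ∂μ := by
  rw [integral_trim (𝓕.le t) hg.stronglyMeasurable, X.trim_restrict_traj ht τ,
    ← integral_trim (𝓕.le t) hg.stronglyMeasurable,
    integral_withDensity_eq_integral_toReal_smul
      (((X.measurable_trajProb ht τ).mono (𝓕.le t) le_rfl).ennreal_ofReal)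
      (Filter.Eventually.of_forall fun ω => ENNReal.ofReal_lt_top)]
  refine integral_congr_ae (Filter.Eventually.of_forall fun ω => ?_)
  simp [ENNReal.toReal_ofReal (M.trajProb_nonneg (X.policy_isPolicy t ht ω) τ)]

lemma comp_traj_eq_sum (X : Interaction M T μ 𝓕) (t : ℕ) (g : Trajectory S A L → Ω → ℝ) :
    (fun ω => g (X.traj t ω) ω) = fun ω => ∑ τ, {ω | X.traj t ω = τ}.indicator (g τ) ω := by
  funext ω
  rw [Finset.sum_eq_single (X.traj t ω)]
  · simp
  · intro τ _ h
    have : ω ∉ {ω | X.traj t ω = τ} := fun h' : X.traj t ω = τ => h h'.symm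
    exact Set.indicator_of_notMem this _
  · simp

lemma integrable_comp_traj [IsProbabilityMeasure μ] (X : Interaction M T μ 𝓕) {t : ℕ}
    (ht : t ∈ Finset.Icc 1 T) {g : Trajectory S A L → Ω → ℝ} (hg : ∀ τ, Measurable[𝓕 t] (g τ))
    (hint : ∀ τ, Integrable (fun ω => M.trajProb (X.policy t ω) τ * g τ ω) μ) :
    Integrable (fun ω => g (X.traj t ω) ω) μ := by
  rw [X.comp_traj_eq_sum]
  exact integrable_finsetSum _ fun τ _ =>
    (X.integrableOn_traj ht τ (hg τ) (hint τ)).integrable_indicator (X.measurableSet_traj ht τ)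

lemma integral_comp_traj [IsProbabilityMeasure μ] (X : Interaction M T μ 𝓕) {t : ℕ}
    (ht : t ∈ Finset.Icc 1 T) {g : Trajectory S A L → Ω → ℝ} (hg : ∀ τ, Measurable[𝓕 t] (g τ))
    (hint : ∀ τ, Integrable (fun ω => M.trajProb (X.policy t ω) τ * g τ ω) μ) :
    ∫ ω, g (X.traj t ω) ω ∂μ = ∫ ω, ∑ τ, M.trajProb (X.policy t ω) τ * g τ ω ∂μ := by
  rw [X.comp_traj_eq_sum, integral_finsetSum _ fun τ _ =>
    (X.integrableOn_traj ht τ (hg τ) (hint τ)).integrable_indicator (X.measurableSet_traj ht τ),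
    integral_finsetSum _ fun τ _ => hint τ]
  refine Finset.sum_congr rfl fun τ _ => ?_
  rw [integral_indicator (X.measurableSet_traj ht τ), X.setIntegral_traj ht τ (hg τ)]

lemma integrable_feedback_mul [IsProbabilityMeasure μ] (X : Interaction M T μ 𝓕) {t : ℕ}
    (ht : t ∈ Finset.Icc 1 T) {f : Ω → ℝ} (hf : Integrable f μ) :
    Integrable (fun ω => X.feedback t ω * f ω) μ := by
  refine hf.bdd_mul (c := 1)
    ((X.feedback_measurable t ht).mono (𝓕.le _) le_rfl).aestronglyMeasurable
    (Filter.Eventually.of_forall fun ω => ?_)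
  have := X.feedback_mem t ht ω
  rw [Real.norm_eq_abs, abs_le]
  constructor <;> linarith [this.1, this.2]

/-- The weight depends on the past and the trajectory only, so it is measurable for the σ-algebra of
`feedback_mean` and can be pulled out of the conditional expectation. -/
lemma integral_feedback_mul [IsProbabilityMeasure μ] (X : Interaction M T μ 𝓕) {t : ℕ}
    (ht : t ∈ Finset.Icc 1 T) {g : Trajectory S A L → Ω → ℝ} (hg : ∀ τ, Measurable[𝓕 t] (g τ))
    (hint : Integrable (fun ω => g (X.traj t ω) ω) μ) :
    ∫ ω, X.feedback t ω * g (X.traj t ω) ω ∂μ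
      = ∫ ω, (∑ k, X.loss t ω (X.traj t ω k).1 (X.traj t ω k).2) * g (X.traj t ω) ω ∂μ := by
  have hle : 𝓕 t ⊔ MeasurableSpace.comap (X.traj t) ⊤ ≤ mΩ :=
    sup_le (𝓕.le t) ((X.traj_measurable t ht).comap_le.trans (𝓕.le _))
  have hmeas : Measurable[𝓕 t ⊔ MeasurableSpace.comap (X.traj t) ⊤]
      (fun ω => g (X.traj t ω) ω) := by
    rw [X.comp_traj_eq_sum]
    refine Finset.measurable_fun_sum _ fun τ _ => ?_
    refine Measurable.indicator ((hg τ).mono le_sup_left le_rfl) ?_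
    exact (le_sup_right : MeasurableSpace.comap (X.traj t) ⊤ ≤ _) _
      ⟨{τ}, MeasurableSpace.measurableSet_top, rfl⟩
  have hc : Integrable (X.feedback t) μ := by
    simpa using X.integrable_feedback_mul ht (integrable_const (1 : ℝ))
  have h1 := condExp_mul_of_stronglyMeasurable_right (f := X.feedback t) hmeas.stronglyMeasurable
    (X.integrable_feedback_mul ht hint) hc
  rw [← integral_condExp hle]
  refine integral_congr_ae ?_
  filter_upwards [h1, X.feedback_mean t ht] with ω h2 h3
  change (μ[X.feedback t * (fun ω => g (X.traj t ω) ω) | _]) ω = _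
  rw [h2, Pi.mul_apply, h3]

lemma integrable_of_bounded [IsProbabilityMeasure μ] {f : Ω → ℝ} {t : ℕ} (hf : Measurable[𝓕 t] f)
    (C : ℝ) (hC : ∀ ω, |f ω| ≤ C) : Integrable f μ :=
  Integrable.of_bound (hf.mono (𝓕.le t) le_rfl).aestronglyMeasurable C
    (Filter.Eventually.of_forall hC)

/-! ### The loss estimator -/

/-- The weight of the feedback in the loss estimator. -/
noncomputable def score (X : Interaction M T μ 𝓕) (t : ℕ) (s : S) (a : A)
    (τ : Trajectory S A L) (ω : Ω) : ℝ :=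
  visitPair τ s a / X.occ t ω s a - visitState τ s / ∑ a', X.occ t ω s a'

lemma measurable_score (X : Interaction M T μ 𝓕) {t : ℕ} (ht : t ∈ Finset.Icc 1 T) (s : S) (a : A)
    (τ : Trajectory S A L) : Measurable[𝓕 t] (X.score t s a τ) := by
  unfold score
  exact (Measurable.const_div (X.measurable_occ ht s a) _).sub (Measurable.const_div
    (Finset.measurable_fun_sum _ fun a' _ => X.measurable_occ ht s a') _)

/-- A trajectory that visits `(s, a)` is one summand of `occ`, so its probability cancels the small
denominator; likewise for the visit of `s`. -/
lemma abs_trajProb_mul_score_le (X : Interaction M T μ 𝓕) {t : ℕ} (ht : t ∈ Finset.Icc 1 T)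
    {s : S} (a : A) (hs : s ≠ M.terminal) (τ : Trajectory S A L) (ω : Ω) :
    |M.trajProb (X.policy t ω) τ * X.score t s a τ ω| ≤ 2 := by
  have hp := X.policy_isPolicy t ht ω
  have h0 := M.trajProb_nonneg hp
  have h1 : M.trajProb (X.policy t ω) τ * visitPair τ s a ≤ X.occ t ω s a :=
    Finset.single_le_sum (f := fun τ => M.trajProb (X.policy t ω) τ * visitPair τ s a)
      (fun τ _ => mul_nonneg (h0 τ) (by rcases visitPair_mem τ s a with h | h <;> simp [h]))
      (Finset.mem_univ τ)
  have h2 : M.trajProb (X.policy t ω) τ * visitState τ s ≤ ∑ a', X.occ t ω s a' := by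
    refine le_trans ?_ (M.sum_occ hp hs).ge
    exact Finset.single_le_sum (f := fun τ => M.trajProb (X.policy t ω) τ * visitState τ s)
      (fun τ _ => mul_nonneg (h0 τ) (by rcases visitState_mem τ s with h | h <;> simp [h]))
      (Finset.mem_univ τ)
  have h3 : 0 ≤ M.trajProb (X.policy t ω) τ * visitPair τ s a :=
    mul_nonneg (h0 τ) (by rcases visitPair_mem τ s a with h | h <;> simp [h])
  have h4 : 0 ≤ M.trajProb (X.policy t ω) τ * visitState τ s :=
    mul_nonneg (h0 τ) (by rcases visitState_mem τ s with h | h <;> simp [h])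
  unfold score
  rw [mul_sub, ← mul_div_assoc, ← mul_div_assoc]
  have h5 := div_le_one_of_le₀ h1 (h3.trans h1)
  have h6 := div_le_one_of_le₀ h2 (h4.trans h2)
  have h7 := div_nonneg h3 (h3.trans h1)
  have h8 := div_nonneg h4 (h4.trans h2)
  rw [abs_le]
  constructor <;> linarith

lemma measurable_value (X : Interaction M T μ 𝓕) {t : ℕ} (ht : t ∈ Finset.Icc 1 T) :
    Measurable[𝓕 t] fun ω => M.value (X.policy t ω) (X.loss t ω) M.start := by
  have : (fun ω => M.value (X.policy t ω) (X.loss t ω) M.start)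
      = fun ω => ∑ τ, M.trajProb (X.policy t ω) τ * ∑ k, X.loss t ω (τ k).1 (τ k).2 := by
    funext ω
    exact M.value_start (X.policy_isPolicy t ht ω) _
  rw [this]
  exact Finset.measurable_fun_sum _ fun τ _ => (X.measurable_trajProb ht τ).mul
    (Finset.measurable_fun_sum _ fun k _ => X.loss_measurable t ht _ _)

lemma measurable_value_const (X : Interaction M T μ 𝓕) {t : ℕ} (ht : t ∈ Finset.Icc 1 T)
    {p : S → A → ℝ} (hp : M.IsPolicy p) :
    Measurable[𝓕 t] fun ω => M.value p (X.loss t ω) M.start := by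
  have : (fun ω => M.value p (X.loss t ω) M.start)
      = fun ω => ∑ τ, M.trajProb p τ * ∑ k, X.loss t ω (τ k).1 (τ k).2 := by
    funext ω
    exact M.value_start hp _
  rw [this]
  exact Finset.measurable_fun_sum _ fun τ _ => Measurable.const_mul
    (Finset.measurable_fun_sum _ fun k _ => X.loss_measurable t ht _ _) _

lemma value_mem_Icc (X : Interaction M T μ 𝓕) {t : ℕ} (ht : t ∈ Finset.Icc 1 T)
    {p : S → A → ℝ} (hp : M.IsPolicy p) (ω : Ω) :
    M.value p (X.loss t ω) M.start ∈ Set.Icc (0 : ℝ) 1 :=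
  M.value_mem hp (fun s a => (X.loss_mem t ht ω s a).1) (X.loss_sum_le t ht ω)

lemma integrable_value_sub [IsProbabilityMeasure μ] (X : Interaction M T μ 𝓕) {t : ℕ}
    (ht : t ∈ Finset.Icc 1 T) {p : S → A → ℝ} (hp : M.IsPolicy p) :
    Integrable (fun ω => M.value (X.policy t ω) (X.loss t ω) M.start
      - M.value p (X.loss t ω) M.start) μ := by
  refine integrable_of_bounded ((X.measurable_value ht).sub (X.measurable_value_const ht hp)) 1
    fun ω => ?_
  have h1 := X.value_mem_Icc ht (X.policy_isPolicy t ht ω) ω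
  have h2 := X.value_mem_Icc ht hp ω
  rw [abs_le]
  constructor <;> linarith [h1.1, h1.2, h2.1, h2.2]

/-- The combination of scores that multiplies the feedback in `⟨ℓ̂_t, q_t - u⟩`. -/
noncomputable def totalScore (X : Interaction M T μ 𝓕) (t : ℕ) (u : S → A → ℝ)
    (τ : Trajectory S A L) (ω : Ω) : ℝ :=
  ∑ s ∈ Finset.univ.erase M.terminal, ∑ a, X.score t s a τ ω * (X.occ t ω s a - u s a)

lemma pairing_estimator_eq (X : Interaction M T μ 𝓕) (t : ℕ) (u : S → A → ℝ) (ω : Ω) :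
    M.pairing (X.estimator t ω) (X.occ t ω - u)
      = X.feedback t ω * X.totalScore t u (X.traj t ω) ω := by
  unfold LayeredMDP.pairing estimator totalScore score
  simp only [Finset.mul_sum, Pi.sub_apply, mul_assoc]

lemma measurable_totalScore (X : Interaction M T μ 𝓕) {t : ℕ} (ht : t ∈ Finset.Icc 1 T)
    (u : S → A → ℝ) (τ : Trajectory S A L) : Measurable[𝓕 t] (X.totalScore t u τ) := by
  unfold totalScore
  exact Finset.measurable_fun_sum _ fun s _ => Finset.measurable_fun_sum _ fun a _ =>
    (X.measurable_score ht s a τ).mul ((X.measurable_occ ht s a).sub_const _)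

lemma abs_trajProb_mul_totalScore_le (X : Interaction M T μ 𝓕) {t : ℕ} (ht : t ∈ Finset.Icc 1 T)
    {u : S → A → ℝ} (hu : u ∈ M.occSet) (τ : Trajectory S A L) (ω : Ω) :
    |M.trajProb (X.policy t ω) τ * X.totalScore t u τ ω|
      ≤ ∑ _s ∈ Finset.univ.erase M.terminal, ∑ _a : A, (2 : ℝ) := by
  unfold totalScore
  simp only [Finset.mul_sum]
  refine (Finset.abs_sum_le_sum_abs _ _).trans (Finset.sum_le_sum fun s hs => ?_)
  refine (Finset.abs_sum_le_sum_abs _ _).trans (Finset.sum_le_sum fun a _ => ?_)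
  rw [← mul_assoc, abs_mul]
  have h1 := X.abs_trajProb_mul_score_le ht a (Finset.ne_of_mem_erase hs) τ ω
  have h2 : |X.occ t ω s a - u s a| ≤ 1 := by
    have e1 := M.mem_occSet_nonneg (X.occ_mem ht ω) s a
    have e2 := M.mem_occSet_le_one (X.occ_mem ht ω) s a
    have e3 := M.mem_occSet_nonneg hu s a
    have e4 := M.mem_occSet_le_one hu s a
    rw [abs_le]
    constructor <;> linarith
  calc _ ≤ 2 * 1 := mul_le_mul h1 h2 (abs_nonneg _) zero_le_two
    _ = 2 := by norm_num

lemma integrable_totalScore [IsProbabilityMeasure μ] (X : Interaction M T μ 𝓕) {t : ℕ}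
    (ht : t ∈ Finset.Icc 1 T) {u : S → A → ℝ} (hu : u ∈ M.occSet) :
    Integrable (fun ω => X.totalScore t u (X.traj t ω) ω) μ :=
  X.integrable_comp_traj ht (X.measurable_totalScore ht u) fun τ =>
    integrable_of_bounded ((X.measurable_trajProb ht τ).mul (X.measurable_totalScore ht u τ)) _
      (X.abs_trajProb_mul_totalScore_le ht hu τ)

lemma integrable_pairing_estimator [IsProbabilityMeasure μ] (X : Interaction M T μ 𝓕) {t : ℕ}
    (ht : t ∈ Finset.Icc 1 T) {u : S → A → ℝ} (hu : u ∈ M.occSet) :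
    Integrable (fun ω => M.pairing (X.estimator t ω) (X.occ t ω - u)) μ := by
  simp only [pairing_estimator_eq]
  exact X.integrable_feedback_mul ht (X.integrable_totalScore ht hu)

/-- The loss estimator is unbiased for the differences of values. -/
lemma integral_pairing_estimator [IsProbabilityMeasure μ] (X : Interaction M T μ 𝓕) {t : ℕ}
    (ht : t ∈ Finset.Icc 1 T) {p : S → A → ℝ} (hp : M.IsPolicy p)
    (hdom : ∀ᵐ ω ∂μ, X.occ t ω ∈ M.barrierDomain) :
    ∫ ω, M.pairing (X.estimator t ω) (X.occ t ω - M.occ p) ∂μ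
      = ∫ ω, (M.value (X.policy t ω) (X.loss t ω) M.start
        - M.value p (X.loss t ω) M.start) ∂μ := by
  have hu : M.occ p ∈ M.occSet := ⟨p, hp, rfl⟩
  simp only [pairing_estimator_eq]
  rw [X.integral_feedback_mul ht (X.measurable_totalScore ht _) (X.integrable_totalScore ht hu),
    X.integral_comp_traj (g := fun τ ω => (∑ k, X.loss t ω (τ k).1 (τ k).2) *
      X.totalScore t (M.occ p) τ ω) ht]
  rotate_left
  · intro τ
    exact (Finset.measurable_fun_sum _ fun k _ => X.loss_measurable t ht _ _).mul
      (X.measurable_totalScore ht _ τ)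
  · intro τ
    refine integrable_of_bounded (𝓕 := 𝓕) (t := t) ?_
      (L * ∑ _s ∈ Finset.univ.erase M.terminal, ∑ _a : A, (2 : ℝ)) fun ω => ?_
    · exact (X.measurable_trajProb ht τ).mul
        ((Finset.measurable_fun_sum _ fun k _ => X.loss_measurable t ht _ _).mul
          (X.measurable_totalScore ht _ τ))
    · rw [mul_left_comm, abs_mul]
      refine mul_le_mul ?_ (X.abs_trajProb_mul_totalScore_le ht hu τ ω) (abs_nonneg _)
        (Nat.cast_nonneg _)
      refine (Finset.abs_sum_le_sum_abs _ _).trans ?_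
      calc _ ≤ ∑ _k : Fin L, (1 : ℝ) := Finset.sum_le_sum fun k _ => by
            have := X.loss_mem t ht ω (τ k).1 (τ k).2
            rw [abs_le]
            constructor <;> linarith [this.1, this.2]
        _ = L := by simp
  refine integral_congr_ae ?_
  filter_upwards [hdom] with ω hω
  have hpt := X.policy_isPolicy t ht ω
  have h1 : ∑ τ, M.trajProb (X.policy t ω) τ * ((∑ k, X.loss t ω (τ k).1 (τ k).2) *
        X.totalScore t (M.occ p) τ ω)
      = ∑ s ∈ Finset.univ.erase M.terminal, ∑ a, (X.occ t ω s a - M.occ p s a) *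
        ∑ τ, M.trajProb (X.policy t ω) τ * ((∑ k, X.loss t ω (τ k).1 (τ k).2) *
          X.score t s a τ ω) := by
    have e : ∀ τ, M.trajProb (X.policy t ω) τ * ((∑ k, X.loss t ω (τ k).1 (τ k).2) *
          X.totalScore t (M.occ p) τ ω)
        = ∑ s ∈ Finset.univ.erase M.terminal, ∑ a, (X.occ t ω s a - M.occ p s a) *
          (M.trajProb (X.policy t ω) τ * ((∑ k, X.loss t ω (τ k).1 (τ k).2) *
            X.score t s a τ ω)) := by
      intro τ
      unfold totalScore
      simp only [Finset.mul_sum (s := Finset.univ.erase M.terminal),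
        Finset.mul_sum (s := (Finset.univ : Finset A))]
      refine Finset.sum_congr rfl fun s _ => Finset.sum_congr rfl fun a _ => ?_
      ring
    simp only [e]
    rw [Finset.sum_comm]
    refine Finset.sum_congr rfl fun s _ => ?_
    rw [Finset.sum_comm]
    simp only [Finset.mul_sum (s := (Finset.univ : Finset (Trajectory S A L)))]
  rw [h1]
  have h2 : ∀ s ∈ Finset.univ.erase M.terminal, ∀ a, (X.occ t ω s a - M.occ p s a) *
        ∑ τ, M.trajProb (X.policy t ω) τ * ((∑ k, X.loss t ω (τ k).1 (τ k).2) *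
          X.score t s a τ ω)
      = M.advantage (X.policy t ω) (X.loss t ω) s a * X.occ t ω s a
        - M.advantage (X.policy t ω) (X.loss t ω) s a * M.occ p s a := by
    intro s hs a
    have hs := Finset.ne_of_mem_erase hs
    by_cases hpos : 0 < X.occ t ω s a
    · have := M.sum_trajProb_mul_estimator hpt (X.loss t ω) hs hpos
      change ∑ τ, M.trajProb (X.policy t ω) τ * ((∑ k, X.loss t ω (τ k).1 (τ k).2) *
          X.score t s a τ ω) = _ at this
      rw [this]
      ring
    -- Inside the barrier domain `q_t(s, a)` vanishes only if every occupancy measure does. The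
    -- estimator carries no information there, but the coefficient is zero as well.
    · have e0 : ∀ q ∈ M.occSet, q s a = 0 := fun q hq => by
        by_contra hne
        exact hpos (hω.2 s a hs ⟨q, hq, lt_of_le_of_ne (M.mem_occSet_nonneg hq s a)
          (Ne.symm hne)⟩)
      rw [e0 _ (X.occ_mem ht ω), e0 _ hu]
      ring
  -- Comparing the policy with itself shows that its advantage pairs to zero with its own occupancy
  -- measure.
  have h3 := M.value_sub_value (p := X.policy t ω) (p' := X.policy t ω) hpt (X.loss t ω)
  have h4 := M.value_sub_value (p' := X.policy t ω) hp (X.loss t ω)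
  rw [Finset.sum_congr rfl fun s hs => Finset.sum_congr rfl fun a _ => h2 s hs a]
  simp only [Finset.sum_sub_distrib]
  change M.pairing _ (M.occ (X.policy t ω)) - M.pairing _ (M.occ p) = _
  rw [← h3, ← h4]
  ring

/-! ### The variance terms -/

lemma ratio_mem (X : Interaction M T μ 𝓕) {t : ℕ} (ht : t ∈ Finset.Icc 1 T) (ω : Ω) (s : S)
    (a : A) : X.occ t ω s a / ∑ a', X.occ t ω s a' ∈ Set.Icc (0 : ℝ) 1 := by
  have h0 := M.mem_occSet_nonneg (X.occ_mem ht ω) s a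
  have h1 := M.mem_occSet_le_sum (X.occ_mem ht ω) s a
  exact ⟨div_nonneg h0 (h0.trans h1), div_le_one_of_le₀ h1 (h0.trans h1)⟩

lemma rho_nonneg (X : Interaction M T μ 𝓕) (t : ℕ) (ω : Ω) (s : S) (a : A) :
    0 ≤ X.rho t ω s a := by
  unfold rho
  have : 0 ≤ visitState (X.traj t ω) s := by
    rcases visitState_mem (X.traj t ω) s with h | h <;> simp [h]
  positivity

lemma rho_le (X : Interaction M T μ 𝓕) {t : ℕ} (ht : t ∈ Finset.Icc 1 T) (ω : Ω) (s : S) (a : A) :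
    X.rho t ω s a ≤ visitState (X.traj t ω) s *
      (visitPair (X.traj t ω) s a - X.occ t ω s a / ∑ a', X.occ t ω s a') ^ 2 := by
  unfold rho
  rw [mul_assoc]
  have : 0 ≤ visitState (X.traj t ω) s := by
    rcases visitState_mem (X.traj t ω) s with h | h <;> simp [h]
  refine mul_le_of_le_one_left (by positivity) ?_
  have h := X.feedback_mem t ht ω
  exact pow_le_one₀ h.1 h.2

lemma rho_le_one (X : Interaction M T μ 𝓕) {t : ℕ} (ht : t ∈ Finset.Icc 1 T) (ω : Ω) (s : S)
    (a : A) : X.rho t ω s a ≤ 1 := by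
  refine (X.rho_le ht ω s a).trans ?_
  have h := X.ratio_mem ht ω s a
  have h1 : (visitPair (X.traj t ω) s a - X.occ t ω s a / ∑ a', X.occ t ω s a') ^ 2 ≤ 1 := by
    rw [sq_le_one_iff_abs_le_one, abs_le]
    rcases visitPair_mem (X.traj t ω) s a with h' | h' <;> rw [h'] <;>
      constructor <;> linarith [h.1, h.2]
  rcases visitState_mem (X.traj t ω) s with h' | h' <;> rw [h']
  · simp
  · rw [one_mul]; exact h1

lemma measurable_traj_comp (X : Interaction M T μ 𝓕) {t : ℕ} (ht : t ∈ Finset.Icc 1 T)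
    (f : Trajectory S A L → ℝ) : Measurable fun ω => f (X.traj t ω) :=
  ((measurable_from_top (f := f)).comp (X.traj_measurable t ht)).mono (𝓕.le _) le_rfl

lemma measurable_rho (X : Interaction M T μ 𝓕) {t : ℕ} (ht : t ∈ Finset.Icc 1 T) (s : S) (a : A) :
    Measurable fun ω => X.rho t ω s a := by
  have h1 : Measurable (X.feedback t) := (X.feedback_measurable t ht).mono (𝓕.le _) le_rfl
  have h2 : ∀ a, Measurable fun ω => X.occ t ω s a := fun a =>
    (X.measurable_occ ht s a).mono (𝓕.le _) le_rfl
  unfold rho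
  exact ((h1.pow_const 2).mul (X.measurable_traj_comp ht fun τ => visitState τ s)).mul
    (((X.measurable_traj_comp ht fun τ => visitPair τ s a).sub
      ((h2 a).div (Finset.measurable_fun_sum _ fun a' _ => h2 a'))).pow_const 2)

lemma integrable_rho [IsProbabilityMeasure μ] (X : Interaction M T μ 𝓕) {t : ℕ}
    (ht : t ∈ Finset.Icc 1 T) (s : S) (a : A) : Integrable (fun ω => X.rho t ω s a) μ :=
  Integrable.of_bound (X.measurable_rho ht s a).aestronglyMeasurable 1
    (Filter.Eventually.of_forall fun ω => by
      rw [Real.norm_eq_abs, abs_of_nonneg (X.rho_nonneg t ω s a)]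
      exact X.rho_le_one ht ω s a)

lemma measurable_spread (X : Interaction M T μ 𝓕) {t : ℕ} (ht : t ∈ Finset.Icc 1 T) (s : S)
    (a : A) : Measurable[𝓕 t] fun ω => LayeredMDP.spread (X.occ t ω) s a := by
  have h : Measurable[𝓕 t] fun ω => ∑ a', X.occ t ω s a' :=
    Finset.measurable_fun_sum _ fun a' _ => X.measurable_occ ht s a'
  unfold LayeredMDP.spread
  exact ((X.measurable_occ ht s a).mul (h.sub (X.measurable_occ ht s a))).div h

/-- The second moments of the estimator, with a weight that is known in advance. -/
lemma integral_rho_mul_le [IsProbabilityMeasure μ] (X : Interaction M T μ 𝓕) {t : ℕ}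
    (ht : t ∈ Finset.Icc 1 T) {s : S} (a : A) (hs : s ≠ M.terminal) {f : Ω → ℝ}
    (hf : Measurable[𝓕 t] f) (hf0 : ∀ ω, 0 ≤ f ω)
    (hint : Integrable (fun ω => LayeredMDP.spread (X.occ t ω) s a * f ω) μ) :
    Integrable (fun ω => X.rho t ω s a * f ω) μ ∧
      ∫ ω, X.rho t ω s a * f ω ∂μ ≤ ∫ ω, LayeredMDP.spread (X.occ t ω) s a * f ω ∂μ := by
  -- `g` bounds the squared feedback by 1, which leaves a function of the trajectory and the past.
  set g : Trajectory S A L → Ω → ℝ := fun τ ω => visitState τ s *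
    (visitPair τ s a - X.occ t ω s a / ∑ a', X.occ t ω s a') ^ 2 * f ω with hg
  have hg0 : ∀ τ ω, 0 ≤ g τ ω := fun τ ω => by
    have : 0 ≤ visitState τ s := by rcases visitState_mem τ s with h | h <;> simp [h]
    have := hf0 ω
    positivity
  have hsum : ∀ ω, ∑ τ, M.trajProb (X.policy t ω) τ * g τ ω
      = LayeredMDP.spread (X.occ t ω) s a * f ω := fun ω => by
    have := M.sum_trajProb_mul_sq (X.policy_isPolicy t ht ω) a hs
    rw [show X.occ t ω = M.occ (X.policy t ω) from rfl, ← this, Finset.sum_mul]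
    simp only [hg, mul_assoc]
    rfl
  have hgm : ∀ τ, Measurable[𝓕 t] (g τ) := fun τ => by
    have h : Measurable[𝓕 t] fun ω => ∑ a', X.occ t ω s a' :=
      Finset.measurable_fun_sum _ fun a' _ => X.measurable_occ ht s a'
    exact (Measurable.const_mul (((((X.measurable_occ ht s a).div h).const_sub _).pow_const 2))
      _).mul hf
  have hgi : ∀ τ, Integrable (fun ω => M.trajProb (X.policy t ω) τ * g τ ω) μ := fun τ => by
    refine hint.mono' (((X.measurable_trajProb ht τ).mul (hgm τ)).mono (𝓕.le t)
      le_rfl).aestronglyMeasurable (Filter.Eventually.of_forall fun ω => ?_)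
    have h0 := M.trajProb_nonneg (X.policy_isPolicy t ht ω)
    rw [Real.norm_eq_abs, abs_of_nonneg (mul_nonneg (h0 τ) (hg0 τ ω)), ← hsum]
    exact Finset.single_le_sum (f := fun τ => M.trajProb (X.policy t ω) τ * g τ ω)
      (fun τ _ => mul_nonneg (h0 τ) (hg0 τ ω)) (Finset.mem_univ τ)
  have hle : ∀ ω, X.rho t ω s a * f ω ≤ g (X.traj t ω) ω := fun ω =>
    mul_le_mul_of_nonneg_right (X.rho_le ht ω s a) (hf0 ω)
  have hI := X.integrable_comp_traj ht hgm hgi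
  have hJ : Integrable (fun ω => X.rho t ω s a * f ω) μ := by
    refine hI.mono' ((X.measurable_rho ht s a).mul (hf.mono (𝓕.le t)
      le_rfl)).aestronglyMeasurable (Filter.Eventually.of_forall fun ω => ?_)
    rw [Real.norm_eq_abs, abs_of_nonneg (mul_nonneg (X.rho_nonneg t ω s a) (hf0 ω))]
    exact hle ω
  refine ⟨hJ, (integral_mono hJ hI hle).trans ?_⟩
  rw [X.integral_comp_traj ht hgm hgi]
  simp only [hsum, le_refl]

end Interaction

/-! ### Square roots of sums and of integrals -/

lemma sqrt_add_le_add_sqrt {x y : ℝ} (hx : 0 ≤ x) (hy : 0 ≤ y) : √(x + y) ≤ √x + √y := by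
  rw [Real.sqrt_le_left (by positivity), add_sq, Real.sq_sqrt hx, Real.sq_sqrt hy]
  have := mul_nonneg (Real.sqrt_nonneg x) (Real.sqrt_nonneg y)
  linarith

lemma sqrt_sum_le_sum_sqrt {ι : Type*} (s : Finset ι) (f : ι → ℝ) :
    √(∑ i ∈ s, f i) ≤ ∑ i ∈ s, √(f i) := by
  classical
  induction s using Finset.induction_on with
  | empty => simp
  | insert i s hi ih =>
    rw [Finset.sum_insert hi, Finset.sum_insert hi]
    by_cases h : 0 ≤ f i
    · by_cases h' : 0 ≤ ∑ i ∈ s, f i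
      · exact (sqrt_add_le_add_sqrt h h').trans (by linarith)
      · exact (Real.sqrt_le_sqrt (by linarith)).trans
          (le_add_of_nonneg_right (Finset.sum_nonneg fun _ _ => Real.sqrt_nonneg _))
    · rw [Real.sqrt_eq_zero_of_nonpos (not_le.1 h).le, zero_add]
      exact (Real.sqrt_le_sqrt (by linarith)).trans ih

lemma sum_sum_sqrt_mul_sqrt_le {ι κ : Type*} (s : Finset ι) (t : ι → Finset κ) {f g : ι → κ → ℝ}
    (hf : ∀ i j, 0 ≤ f i j) (hg : ∀ i j, 0 ≤ g i j) :
    ∑ i ∈ s, ∑ j ∈ t i, √(f i j) * √(g i j)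
      ≤ √(∑ i ∈ s, ∑ j ∈ t i, f i j) * √(∑ i ∈ s, ∑ j ∈ t i, g i j) := by
  simp only [Finset.sum_sigma']
  exact Real.sum_sqrt_mul_sqrt_le _ (fun x => hf x.1 x.2) (fun x => hg x.1 x.2)

lemma integrable_sqrt {Ω : Type*} [MeasurableSpace Ω] {μ : Measure Ω} [IsProbabilityMeasure μ]
    {f : Ω → ℝ} (hf : Integrable f μ) : Integrable (fun ω => √(f ω)) μ := by
  refine ((integrable_const (1 : ℝ)).add hf.abs).mono'
    (Real.continuous_sqrt.comp_aestronglyMeasurable hf.aestronglyMeasurable)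
    (Filter.Eventually.of_forall fun ω => ?_)
  rw [Real.norm_eq_abs, abs_of_nonneg (Real.sqrt_nonneg _)]
  simp only [Pi.add_apply]
  refine (Real.sqrt_le_sqrt (le_abs_self (f ω))).trans ?_
  rw [Real.sqrt_le_left (by positivity)]
  nlinarith [abs_nonneg (f ω)]

/-- Jensen's inequality, obtained by integrating `(√f - m)² ≥ 0` with `m` the mean of `√f`. -/
lemma integral_sqrt_le {Ω : Type*} [MeasurableSpace Ω] {μ : Measure Ω} [IsProbabilityMeasure μ]
    {f : Ω → ℝ} (hf : Integrable f μ) (h0 : ∀ ω, 0 ≤ f ω) :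
    ∫ ω, √(f ω) ∂μ ≤ √(∫ ω, f ω ∂μ) := by
  refine Real.le_sqrt_of_sq_le ?_
  set m := ∫ ω, √(f ω) ∂μ with hm
  have h1 : ∫ ω, (2 * m * √(f ω) - m ^ 2) ∂μ ≤ ∫ ω, f ω ∂μ := by
    refine integral_mono (((integrable_sqrt hf).const_mul _).sub (integrable_const _)) hf
      fun ω => ?_
    have := Real.sq_sqrt (h0 ω)
    simp only
    nlinarith [sq_nonneg (√(f ω) - m)]
  rw [integral_sub ((integrable_sqrt hf).const_mul _) (integrable_const _),
    integral_const_mul, ← hm] at h1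
  simp only [integral_const, probReal_univ, one_smul] at h1
  linarith

/-- A regret that is bounded by the square root of a quantity that it controls. -/
lemma le_of_self_bounding {R U C G c₁ c₂ : ℝ} (hU : 0 ≤ U) (hC : 0 ≤ C) (hc₁ : 0 ≤ c₁)
    (hc₂ : 0 ≤ c₂) (hG : G ≤ R + C) (hR : R ≤ c₁ * U + c₂ * √(U * G)) :
    R ≤ (2 * c₁ + c₂ ^ 2) * U + 2 * c₂ * √(U * C) := by
  have hs := Real.sqrt_nonneg (U * C)
  by_cases h0 : 0 ≤ R
  · have h1 : √(U * G) ≤ √(U * R) + √(U * C) := by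
      refine (Real.sqrt_le_sqrt (mul_le_mul_of_nonneg_left hG hU)).trans ?_
      rw [mul_add]
      exact sqrt_add_le_add_sqrt (by positivity) (by positivity)
    -- Half of `R` goes back to the left side of the final inequality, which doubles the remaining
    -- constants.
    have h2 : c₂ * √(U * R) ≤ R / 2 + c₂ ^ 2 * U / 2 := by
      rw [Real.sqrt_mul hU]
      have e1 := Real.sq_sqrt hU
      have e2 := Real.sq_sqrt h0
      nlinarith [sq_nonneg (c₂ * √U - √R)]
    have h3 := mul_le_mul_of_nonneg_left h1 hc₂
    nlinarith
  · have : 0 ≤ (2 * c₁ + c₂ ^ 2) * U + 2 * c₂ * √(U * C) := by positivity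
    linarith

/-! ### The regret of follow the regularized leader over occupancy measures -/

namespace LayeredMDP

variable {S A : Type*} [Fintype S] [Fintype A] [DecidableEq S] [DecidableEq A] {L : ℕ}

open Classical in
/-- The pairs at nonterminal states that some policy visits. -/
noncomputable def reachablePairs (M : LayeredMDP S A L) : Finset (S × A) :=
  Finset.univ.filter fun x => x.1 ≠ M.terminal ∧ ∃ q ∈ M.occSet, 0 < q x.1 x.2

lemma mem_reachablePairs {M : LayeredMDP S A L} {x : S × A} :
    x ∈ M.reachablePairs ↔ x.1 ≠ M.terminal ∧ ∃ q ∈ M.occSet, 0 < q x.1 x.2 := by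
  simp [reachablePairs]

lemma eq_zero_of_notMem_reachablePairs {M : LayeredMDP S A L} {s : S} {a : A}
    (hs : s ≠ M.terminal) (h : (s, a) ∉ M.reachablePairs) {q : S → A → ℝ} (hq : q ∈ M.occSet) :
    q s a = 0 := by
  by_contra hne
  exact h (mem_reachablePairs.2 ⟨hs, q, hq,
    lt_of_le_of_ne (M.mem_occSet_nonneg hq s a) (Ne.symm hne)⟩)

lemma sum_reachablePairs {M : LayeredMDP S A L} {f : S → A → ℝ}
    (hf : ∀ s a, s ≠ M.terminal → (s, a) ∉ M.reachablePairs → f s a = 0) :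
    ∑ x ∈ M.reachablePairs, f x.1 x.2 = ∑ s ∈ Finset.univ.erase M.terminal, ∑ a, f s a := by
  rw [← Finset.sum_product']
  refine Finset.sum_subset (fun x hx => ?_) fun x hx hx' => ?_
  · simp [(mem_reachablePairs.1 hx).1]
  · exact hf x.1 x.2 (Finset.ne_of_mem_erase (Finset.mem_product.1 hx).1) hx'

lemma sum_reachablePairs_le {M : LayeredMDP S A L} {f : S → A → ℝ} (hf : ∀ s a, 0 ≤ f s a) :
    ∑ x ∈ M.reachablePairs, f x.1 x.2 ≤ ∑ s ∈ Finset.univ.erase M.terminal, ∑ a, f s a := by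
  rw [← Finset.sum_product']
  refine Finset.sum_le_sum_of_subset_of_nonneg (fun x hx => ?_) fun x _ _ => hf _ _
  simp [(mem_reachablePairs.1 hx).1]

/-- `sum_regret_le` needs positive coordinates, so it is applied on `reachablePairs`; at the other
pairs all occupancy measures vanish and nothing is lost. The barrier part of the penalty telescopes
to `β n * B`, while the entropy part is kept, since its two signs matter later. -/
lemma sum_pairing_le (M : LayeredMDP S A L) {α : ℕ → ℝ} {β r ℓ q : ℕ → S → A → ℝ}
    {B : ℝ} (hα0 : α 0 = 0) (hβ0 : ∀ s a, β 0 s a = 0) (hB : 0 ≤ B) (n : ℕ)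
    (hβ : ∀ s a, ∀ t ∈ Finset.Icc 1 n, β (t - 1) s a ≤ β t s a)
    (hr : ∀ t s a, 0 ≤ r t s a)
    (hq : ∀ t ∈ Finset.Icc 1 n, q t ∈ M.barrierDomain)
    (hmin : ∀ t ∈ Finset.Icc 1 n, IsMinOn (fun y =>
      M.pairing (fun s a => ∑ j ∈ Finset.Ico 1 t, ℓ j s a) y +
        ∑ s ∈ Finset.univ.erase M.terminal, ∑ a,
          (-(2 * α t) * √(y s a) - β t s a * Real.log (y s a))) M.barrierDomain (q t))
    (hstab : ∀ t ∈ Finset.Icc 1 n, ∀ s a, s ≠ M.terminal → 0 < q t s a → ∀ x, 0 < x →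
      ℓ t s a * (q t s a - x) - (α t * (√x - √(q t s a)) ^ 2 / √(q t s a)
        + β t s a * (x / q t s a - 1 - Real.log (x / q t s a))) ≤ r t s a)
    {u : S → A → ℝ} (hu : u ∈ M.barrierDomain)
    (hlog : ∀ t ∈ Finset.Icc 1 n, ∀ s a, 0 < q t s a → Real.log (q t s a / u s a) ≤ B) :
    ∑ t ∈ Finset.Icc 1 n, M.pairing (ℓ t) (q t - u)
      ≤ ∑ t ∈ Finset.Icc 1 n, ∑ s ∈ Finset.univ.erase M.terminal, ∑ a, r t s a
        + ∑ t ∈ Finset.Icc 1 n, 2 * (α t - α (t - 1)) *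
          ∑ s ∈ Finset.univ.erase M.terminal, ∑ a, (√(q t s a) - √(u s a))
        + ∑ s ∈ Finset.univ.erase M.terminal, ∑ a, β n s a * B := by
  set D : Set (S × A → ℝ) := {y | (fun s a => y (s, a)) ∈ M.barrierDomain} with hDdef
  have hD : Convex ℝ D := by
    intro y hy y' hy' a b ha hb hab
    exact M.convex_barrierDomain hy hy' ha hb hab
  have hpos : ∀ y ∈ D, ∀ x ∈ M.reachablePairs, 0 < y x := fun y hy x hx => by
    obtain ⟨h1, h2⟩ := mem_reachablePairs.1 hx
    exact hy.2 x.1 x.2 h1 h2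
  have hobj : ∀ t, ∀ y ∈ D, ∑ x ∈ M.reachablePairs, (∑ j ∈ Finset.Ico 1 t, ℓ j x.1 x.2) * y x
      + hybridReg M.reachablePairs (α t) (fun x => β t x.1 x.2) y
      = M.pairing (fun s a => ∑ j ∈ Finset.Ico 1 t, ℓ j s a) (fun s a => y (s, a)) +
        ∑ s ∈ Finset.univ.erase M.terminal, ∑ a,
          (-(2 * α t) * √(y (s, a)) - β t s a * Real.log (y (s, a))) := by
    intro t y hy
    have h0 : ∀ s a, s ≠ M.terminal → (s, a) ∉ M.reachablePairs → y (s, a) = 0 :=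
      fun s a hs h => eq_zero_of_notMem_reachablePairs hs h hy.1
    unfold pairing hybridReg
    congr 1
    · exact sum_reachablePairs (f := fun s a => (∑ j ∈ Finset.Ico 1 t, ℓ j s a) * y (s, a))
        fun s a hs h => by rw [h0 s a hs h, mul_zero]
    · exact sum_reachablePairs
        (f := fun s a => -(2 * α t) * √(y (s, a)) - β t s a * Real.log (y (s, a)))
        fun s a hs h => by rw [h0 s a hs h]; simp
  have key := sum_regret_le hD hpos (α := α) (β := fun t x => β t x.1 x.2)
    (ℓ := fun t x => ℓ t x.1 x.2) (q := fun t x => q t x.1 x.2)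
    (r := fun t => ∑ s ∈ Finset.univ.erase M.terminal, ∑ a, r t s a)
    hα0 (fun x => hβ0 x.1 x.2) n (fun t ht => hq t ht)
    (fun t ht y hy => by
      have h1 := hmin t ht hy
      simp only [Set.mem_ofPred_eq] at h1 ⊢
      rw [hobj t y hy, hobj t _ (hq t ht)]
      exact h1)
    (fun t ht y hy => by
      refine le_trans ?_ (sum_reachablePairs_le (hr t))
      unfold hybridBreg
      rw [← Finset.sum_sub_distrib]
      refine Finset.sum_le_sum fun x hx => ?_
      exact hstab t ht x.1 x.2 (mem_reachablePairs.1 hx).1 (hpos (fun x => q t x.1 x.2) (hq t ht) x hx) (y x)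
        (hpos y hy x hx))
    (u := fun x => u x.1 x.2) hu
  have hz : ∀ t ∈ Finset.Icc 1 n, ∀ s a, s ≠ M.terminal → (s, a) ∉ M.reachablePairs →
      q t s a = 0 ∧ u s a = 0 := fun t ht s a hs h =>
    ⟨eq_zero_of_notMem_reachablePairs hs h (hq t ht).1, eq_zero_of_notMem_reachablePairs hs h hu.1⟩
  have hleft : ∑ t ∈ Finset.Icc 1 n, M.pairing (ℓ t) (q t - u)
      = ∑ t ∈ Finset.Icc 1 n, ∑ x ∈ M.reachablePairs, ℓ t x.1 x.2 * (q t x.1 x.2 - u x.1 x.2) := by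
    refine Finset.sum_congr rfl fun t ht => ?_
    symm
    exact sum_reachablePairs (f := fun s a => ℓ t s a * (q t s a - u s a)) fun s a hs h => by
      rw [(hz t ht s a hs h).1, (hz t ht s a hs h).2]; simp
  rw [hleft, add_assoc]
  refine key.trans (add_le_add_right ?_ _)
  simp only [Finset.sum_add_distrib]
  refine add_le_add (le_of_eq ?_) ?_
  · refine Finset.sum_congr rfl fun t ht => ?_
    rw [← Finset.mul_sum]
    congr 1
    exact sum_reachablePairs (f := fun s a => √(q t s a) - √(u s a)) fun s a hs h => by
      rw [(hz t ht s a hs h).1, (hz t ht s a hs h).2]; simp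
  · rw [Finset.sum_comm]
    have hβn : ∀ s a, 0 ≤ β n s a := fun s a => by
      have : ∀ m ≤ n, 0 ≤ β m s a := fun m => by
        induction m with
        | zero => intro _; rw [hβ0]
        | succ m ih => intro hm; exact (ih (by omega)).trans (hβ s a (m + 1) (by simp; omega))
      exact this n le_rfl
    refine le_trans (Finset.sum_le_sum fun x hx => ?_)
      (sum_reachablePairs_le (f := fun s a => β n s a * B) fun s a => mul_nonneg (hβn s a) hB)
    exact sum_telescope_mul_le (β := fun t => β t x.1 x.2)
      (x := fun t => Real.log (q t x.1 x.2 / u x.1 x.2)) (hβ0 _ _) n (hβ x.1 x.2)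
      fun t ht => hlog t ht _ _ (hpos (fun x => q t x.1 x.2) (hq t ht) x hx)

end LayeredMDP

/-! ### Variances against square roots, logarithmic ratios, and the size of the estimator -/

namespace LayeredMDP

variable {S A : Type*} [Fintype S] [Fintype A] [DecidableEq S] [DecidableEq A] {L : ℕ}

lemma spread_mul_le (M : LayeredMDP S A L) {q : S → A → ℝ} (hq : q ∈ M.occSet) (s : S) (a : A) :
    spread q s a * (1 / √(q s a)) ≤ √(q s a) := by
  have h0 := M.mem_occSet_nonneg hq s a
  rw [mul_one_div]
  refine div_le_of_le_mul₀ (Real.sqrt_nonneg _) (Real.sqrt_nonneg _) ?_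
  rw [Real.mul_self_sqrt h0]
  exact M.spread_le hq s a

/-- `spread` is at most `q(s, a)` and at most the mass of the other actions, hence at most their
geometric mean. -/
lemma spread_mul_le_sum_erase (M : LayeredMDP S A L) {q : S → A → ℝ} (hq : q ∈ M.occSet) (s : S)
    (a : A) :
    spread q s a * (1 / √(q s a)) ≤ √(∑ a' ∈ Finset.univ.erase a, q s a') := by
  have h0 := M.mem_occSet_nonneg hq s a
  rw [mul_one_div]
  refine div_le_of_le_mul₀ (Real.sqrt_nonneg _) (Real.sqrt_nonneg _) ?_
  rw [← Real.sqrt_mul (Finset.sum_nonneg fun a' _ => M.mem_occSet_nonneg hq s a')]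
  refine Real.le_sqrt_of_sq_le ?_
  rw [sq, mul_comm (∑ a' ∈ Finset.univ.erase a, q s a')]
  exact mul_le_mul (M.spread_le hq s a) (M.spread_le_sum_erase hq s a) (M.spread_nonneg hq s a) h0

lemma card_erase_mul_le (M : LayeredMDP S A L) {c : ℝ} (hc : 0 ≤ c) :
    ∑ _s ∈ Finset.univ.erase M.terminal, ∑ _a : A, c ≤ Fintype.card S * Fintype.card A * c := by
  rw [Finset.sum_const, Finset.sum_const, nsmul_eq_mul, nsmul_eq_mul, ← mul_assoc]
  refine mul_le_mul_of_nonneg_right (mul_le_mul_of_nonneg_right ?_ (Nat.cast_nonneg _)) hc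
  exact_mod_cast Finset.card_le_univ _

lemma nonempty_action {M : LayeredMDP S A L} {p : S → A → ℝ} (hp : M.IsPolicy p) : Nonempty A := by
  by_contra h
  rw [not_nonempty_iff] at h
  simpa using (hp _ M.start_ne_terminal).2

lemma advantage_of_subsingleton [Subsingleton A] {M : LayeredMDP S A L} {p : S → A → ℝ}
    (hp : M.IsPolicy p) (ℓ : S → A → ℝ) {s : S} (hs : s ≠ M.terminal) (a : A) :
    M.advantage p ℓ s a = 0 := by
  unfold advantage
  have hl := (M.ne_terminal_iff s).1 hs
  obtain ⟨n, hn⟩ : ∃ n, L = M.layer s + 1 + n := ⟨L - (M.layer s + 1), by omega⟩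
  have h1 : L - (M.layer s + 1) = n := by omega
  have h2 : L - M.layer s = n + 1 := by omega
  have h3 : ∀ f : A → ℝ, ∑ a', f a' = f a := fun f =>
    Finset.sum_eq_single_of_mem a (Finset.mem_univ a) fun b _ hb => absurd (Subsingleton.elim b a) hb
  have h4 := (hp s hs).2
  rw [h3] at h4
  rw [h1, h2, valueToGo, h3 fun a => p s a * _, h4]
  ring

/-- With `2 ≤ T` and `N ≤ T` the factor `2 N T` is at most `T³`, whence the 3. -/
lemma log_ratio_le {q u N T : ℝ} (hq : 0 < q) (hT : 2 ≤ T) (hN : 0 ≤ N) (hNT : N ≤ T)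
    (h : q ≤ 2 * N * T * u) : Real.log (q / u) ≤ 3 * Real.log T := by
  have hu : 0 < u := by
    by_contra hu
    have : 2 * N * T * u ≤ 0 := mul_nonpos_of_nonneg_of_nonpos (by positivity) (not_lt.1 hu)
    linarith
  have h1 : q / u ≤ T ^ 3 := by
    rw [div_le_iff₀ hu]
    refine h.trans (mul_le_mul_of_nonneg_right ?_ hu.le)
    have : 2 * N ≤ T * T := mul_le_mul hT hNT hN (by linarith)
    nlinarith
  have h2 := Real.log_le_log (div_pos hq hu) h1
  rw [Real.log_pow] at h2
  exact_mod_cast h2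

end LayeredMDP

namespace Interaction

variable {S A : Type*} [Fintype S] [Fintype A] [DecidableEq S] [DecidableEq A] {L : ℕ}
  {M : LayeredMDP S A L} {T : ℕ} {Ω : Type*} [mΩ : MeasurableSpace Ω] {μ : Measure Ω}
  {𝓕 : Filtration ℕ mΩ}

/-- `q ℓ̂` is the quantity `z` of the stability inequalities; its square is what the adaptive rates
accumulate. -/
lemma sq_occ_mul_estimator (X : Interaction M T μ 𝓕) (t : ℕ) (ω : Ω) (s : S) (a : A)
    (h : 0 < X.occ t ω s a) : (X.occ t ω s a * X.estimator t ω s a) ^ 2 = X.rho t ω s a := by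
  unfold estimator rho
  have h3 := visitPair_le_visitState (X.traj t ω) s a
  set d := ∑ a', X.occ t ω s a'
  rcases visitPair_mem (X.traj t ω) s a with h1 | h1 <;>
    rcases visitState_mem (X.traj t ω) s with h2 | h2 <;> rw [h1, h2] at h3 <;> rw [h1, h2]
  · simp
  · simp only [zero_div, zero_sub]
    ring
  · norm_num at h3
  · have : X.occ t ω s a * (X.feedback t ω * (1 / X.occ t ω s a - 1 / d))
        = X.feedback t ω * (1 - X.occ t ω s a / d) := by
      field_simp
    rw [this]
    ring

lemma abs_occ_mul_estimator_le (X : Interaction M T μ 𝓕) {t : ℕ} (ht : t ∈ Finset.Icc 1 T) (ω : Ω)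
    (s : S) (a : A) (h : 0 < X.occ t ω s a) : |X.occ t ω s a * X.estimator t ω s a| ≤ 1 := by
  rw [← sq_le_one_iff_abs_le_one, X.sq_occ_mul_estimator t ω s a h]
  exact X.rho_le_one ht ω s a

/-! ### Elementary bounds on the regret -/

lemma regret_le_episodes [IsProbabilityMeasure μ] (X : Interaction M T μ 𝓕) {p : S → A → ℝ}
    (hp : M.IsPolicy p) : X.regret p ≤ T := by
  have h : X.regret p ≤ ∫ _ω, (∑ _t ∈ Finset.Icc 1 T, (1 : ℝ)) ∂μ := by
    refine integral_mono (integrable_finsetSum _ fun t ht => X.integrable_value_sub ht hp)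
      (integrable_const _) fun ω => Finset.sum_le_sum fun t ht => ?_
    have h1 := X.value_mem_Icc ht (X.policy_isPolicy t ht ω) ω
    have h2 := X.value_mem_Icc ht hp ω
    linarith [h1.2, h2.1]
  simpa using h

lemma regret_of_subsingleton [Subsingleton A] (X : Interaction M T μ 𝓕) {p : S → A → ℝ}
    (hp : M.IsPolicy p) : X.regret p = 0 := by
  unfold regret
  have : ∀ ω, ∑ t ∈ Finset.Icc 1 T, (M.value (X.policy t ω) (X.loss t ω) M.start
      - M.value p (X.loss t ω) M.start) = 0 := fun ω => by
    refine Finset.sum_eq_zero fun t ht => ?_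
    rw [M.value_sub_value (X.policy_isPolicy t ht ω)]
    refine Finset.sum_eq_zero fun s hs => Finset.sum_eq_zero fun a _ => ?_
    rw [LayeredMDP.advantage_of_subsingleton hp _ (Finset.ne_of_mem_erase hs), zero_mul]
  simp [this]

/-- Values lie in `[0, 1]`, so passing from `p` to the mixture `u` costs at most `1 / T` per
episode, in total 1. Against `u` the estimators are unbiased, and a pathwise bound can be
integrated. -/
lemma regret_le_add_integral [IsProbabilityMeasure μ] (X : Interaction M T μ 𝓕) (hT : 1 ≤ T)
    {p : S → A → ℝ} (hp : M.IsPolicy p)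
    (hdom : ∀ᵐ ω ∂μ, ∀ t ∈ Finset.Icc 1 T, X.occ t ω ∈ M.barrierDomain)
    {u q₀ : S → A → ℝ} (hu : u ∈ M.occSet) (hq₀ : q₀ ∈ M.occSet)
    (hmix : ∀ ℓ, M.pairing ℓ u
      = (1 - 1 / (T : ℝ)) * M.pairing ℓ (M.occ p) + 1 / (T : ℝ) * M.pairing ℓ q₀)
    {G : Ω → ℝ} (hG : Integrable G μ)
    (hle : ∀ᵐ ω ∂μ, ∑ t ∈ Finset.Icc 1 T, M.pairing (X.estimator t ω) (X.occ t ω - u) ≤ G ω) :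
    X.regret p ≤ ∫ ω, G ω ∂μ + 1 := by
  obtain ⟨pu, hpu, rfl⟩ := hu
  obtain ⟨p₀, hp₀, rfl⟩ := hq₀
  have hT0 : (0 : ℝ) < T := by exact_mod_cast hT
  have h1 : X.regret p ≤ ∫ ω, (∑ t ∈ Finset.Icc 1 T, (M.value (X.policy t ω) (X.loss t ω) M.start
      - M.value pu (X.loss t ω) M.start) + 1) ∂μ := by
    refine integral_mono (integrable_finsetSum _ fun t ht => X.integrable_value_sub ht hp)
      ((integrable_finsetSum _ fun t ht => X.integrable_value_sub ht hpu).add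
        (integrable_const _)) fun ω => ?_
    have hone : (1 : ℝ) = ∑ t ∈ Finset.Icc 1 T, 1 / (T : ℝ) := by
      simp [hT0.ne']
    simp only
    rw [hone, ← Finset.sum_add_distrib]
    refine Finset.sum_le_sum fun t ht => ?_
    have e1 := X.value_mem_Icc ht hp ω
    have e2 := X.value_mem_Icc ht hp₀ ω
    rw [M.value_eq_pairing hpu, hmix, ← M.value_eq_pairing hp, ← M.value_eq_pairing hp₀]
    have e3 : 0 ≤ 1 / (T : ℝ) := by positivity
    nlinarith [mul_nonneg e3 e1.1, mul_le_mul_of_nonneg_left e2.2 e3]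
  have h2 : ∫ ω, ∑ t ∈ Finset.Icc 1 T, (M.value (X.policy t ω) (X.loss t ω) M.start
        - M.value pu (X.loss t ω) M.start) ∂μ
      = ∫ ω, ∑ t ∈ Finset.Icc 1 T, M.pairing (X.estimator t ω) (X.occ t ω - M.occ pu) ∂μ := by
    rw [integral_finsetSum _ fun t ht => X.integrable_value_sub ht hpu,
      integral_finsetSum _ fun t ht => X.integrable_pairing_estimator ht ⟨pu, hpu, rfl⟩]
    refine Finset.sum_congr rfl fun t ht => ?_
    exact (X.integral_pairing_estimator ht hpu (hdom.mono fun ω h => h t ht)).symm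
  rw [integral_add (integrable_finsetSum _ fun t ht => X.integrable_value_sub ht hpu)
    (integrable_const _), h2] at h1
  have h3 := integral_mono_ae (integrable_finsetSum _ fun t ht =>
    X.integrable_pairing_estimator ht (⟨pu, hpu, rfl⟩ : M.occ pu ∈ M.occSet)) hG hle
  simp only [integral_const, probReal_univ, one_smul] at h1
  linarith

/-! ### Expected visits and expected variances -/

lemma integrable_occ [IsProbabilityMeasure μ] (X : Interaction M T μ 𝓕) {t : ℕ}
    (ht : t ∈ Finset.Icc 1 T) (s : S) (a : A) : Integrable (fun ω => X.occ t ω s a) μ :=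
  integrable_of_bounded (X.measurable_occ ht s a) 1 fun ω => by
    rw [abs_of_nonneg (M.mem_occSet_nonneg (X.occ_mem ht ω) s a)]
    exact M.mem_occSet_le_one (X.occ_mem ht ω) s a

lemma integrable_spread [IsProbabilityMeasure μ] (X : Interaction M T μ 𝓕) {t : ℕ}
    (ht : t ∈ Finset.Icc 1 T) (s : S) (a : A) :
    Integrable (fun ω => LayeredMDP.spread (X.occ t ω) s a) μ :=
  integrable_of_bounded (X.measurable_spread ht s a) 1 fun ω => by
    rw [abs_of_nonneg (M.spread_nonneg (X.occ_mem ht ω) s a)]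
    exact (M.spread_le (X.occ_mem ht ω) s a).trans (M.mem_occSet_le_one (X.occ_mem ht ω) s a)

/-- The expected number of visits to a pair. -/
noncomputable def meanOcc (X : Interaction M T μ 𝓕) (s : S) (a : A) : ℝ :=
  ∑ t ∈ Finset.Icc 1 T, ∫ ω, X.occ t ω s a ∂μ

/-- The expected sum of the conditional variances of the visits to a pair. -/
noncomputable def meanSpread (X : Interaction M T μ 𝓕) (s : S) (a : A) : ℝ :=
  ∑ t ∈ Finset.Icc 1 T, ∫ ω, LayeredMDP.spread (X.occ t ω) s a ∂μ

lemma meanOcc_nonneg (X : Interaction M T μ 𝓕) (s : S) (a : A) : 0 ≤ X.meanOcc s a :=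
  Finset.sum_nonneg fun _ ht => integral_nonneg fun ω => M.mem_occSet_nonneg (X.occ_mem ht ω) s a

lemma meanSpread_nonneg (X : Interaction M T μ 𝓕) (s : S) (a : A) : 0 ≤ X.meanSpread s a :=
  Finset.sum_nonneg fun _ ht => integral_nonneg fun ω => M.spread_nonneg (X.occ_mem ht ω) s a

lemma meanSpread_le [IsProbabilityMeasure μ] (X : Interaction M T μ 𝓕) (s : S) (a : A) :
    X.meanSpread s a ≤ X.meanOcc s a :=
  Finset.sum_le_sum fun _ ht => integral_mono (X.integrable_spread ht s a) (X.integrable_occ ht s a)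
    fun ω => M.spread_le (X.occ_mem ht ω) s a

lemma meanSpread_le_sum_erase [IsProbabilityMeasure μ] (X : Interaction M T μ 𝓕) (s : S) (a : A) :
    X.meanSpread s a ≤ ∑ a' ∈ Finset.univ.erase a, X.meanOcc s a' := by
  unfold meanOcc
  rw [Finset.sum_comm]
  refine Finset.sum_le_sum fun t ht => ?_
  rw [← integral_finsetSum _ fun a' _ => X.integrable_occ ht s a']
  exact integral_mono (X.integrable_spread ht s a)
    (integrable_finsetSum _ fun a' _ => X.integrable_occ ht s a')
    fun ω => M.spread_le_sum_erase (X.occ_mem ht ω) s a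

lemma sum_meanOcc [IsProbabilityMeasure μ] (X : Interaction M T μ 𝓕) :
    ∑ s ∈ Finset.univ.erase M.terminal, ∑ a, X.meanOcc s a = L * T := by
  unfold meanOcc
  have h : ∀ s, ∑ a, ∑ t ∈ Finset.Icc 1 T, ∫ ω, X.occ t ω s a ∂μ
      = ∑ t ∈ Finset.Icc 1 T, ∑ a, ∫ ω, X.occ t ω s a ∂μ := fun s => Finset.sum_comm
  simp only [h]
  rw [Finset.sum_comm]
  have h2 : ∀ t ∈ Finset.Icc 1 T, ∑ s ∈ Finset.univ.erase M.terminal, ∑ a, ∫ ω, X.occ t ω s a ∂μ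
      = L := fun t ht => by
    have e : ∀ s, ∑ a, ∫ ω, X.occ t ω s a ∂μ = ∫ ω, ∑ a, X.occ t ω s a ∂μ := fun s =>
      (integral_finsetSum _ fun a _ => X.integrable_occ ht s a).symm
    simp only [e]
    rw [← integral_finsetSum _ fun s _ => integrable_finsetSum _ fun a _ =>
      X.integrable_occ ht s a]
    simp [fun ω => M.mem_occSet_sum (X.occ_mem ht ω)]
  rw [Finset.sum_congr rfl h2]
  simp [mul_comm]

/-! ### The logarithmic barrier -/

lemma one_div_adaptiveRate (X : Interaction M T μ 𝓕) (hT : 2 ≤ T) (t : ℕ) (ω : Ω) (s : S) (a : A) :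
    1 / X.adaptiveRate t ω s a
      = √(4 + 1 / Real.log T * ∑ j ∈ Finset.Ico 1 t, X.rho j ω s a) := by
  have hlog : 0 < Real.log T := Real.log_pos (by exact_mod_cast hT)
  have h0 : 0 ≤ 4 + 1 / Real.log T * ∑ j ∈ Finset.Ico 1 t, X.rho j ω s a :=
    add_nonneg (by norm_num) (mul_nonneg (by positivity)
      (Finset.sum_nonneg fun j _ => X.rho_nonneg j ω s a))
  unfold adaptiveRate
  rw [Real.rpow_neg h0, one_div, inv_inv, Real.sqrt_eq_rpow]

lemma logBarrier_sum_pairing_le (X : Interaction M T μ 𝓕) (hT : 2 ≤ T) {ω : Ω}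
    (hω : ∀ t ∈ Finset.Icc 1 T, X.occ t ω ∈ M.barrierDomain ∧
      IsMinOn (fun q => M.pairing (fun s a => ∑ j ∈ Finset.Ico 1 t, X.estimator j ω s a) q
        + M.logBarrierReg (X.adaptiveRate t ω) q) M.barrierDomain (X.occ t ω))
    {u : S → A → ℝ} (hu : u ∈ M.barrierDomain)
    (hlog : ∀ t ∈ Finset.Icc 1 T, ∀ s a, 0 < X.occ t ω s a →
      Real.log (X.occ t ω s a / u s a) ≤ 3 * Real.log T) :
    ∑ t ∈ Finset.Icc 1 T, M.pairing (X.estimator t ω) (X.occ t ω - u)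
      ≤ ∑ s ∈ Finset.univ.erase M.terminal, ∑ a, (6 * Real.log T
        + 7 * √(Real.log T * ∑ t ∈ Finset.Icc 1 T, X.rho t ω s a)) := by
  have hl2 : Real.log 2 ≤ Real.log T := Real.log_le_log (by norm_num) (by exact_mod_cast hT)
  have hl3 := Real.log_two_gt_d9
  have hl0 : 0 < Real.log T := by linarith
  set b : ℕ → S → A → ℝ := fun t s a =>
    √(4 + 1 / Real.log T * ∑ j ∈ Finset.Ico 1 t, X.rho j ω s a) with hb
  have hb2 : ∀ t s a, 2 ≤ b t s a := fun t s a => by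
    refine Real.le_sqrt_of_sq_le ?_
    have := mul_nonneg (by positivity : 0 ≤ 1 / Real.log T)
      (Finset.sum_nonneg fun j (_ : j ∈ Finset.Ico 1 t) => X.rho_nonneg j ω s a)
    linarith
  have hbmono : ∀ s a, Monotone fun t => b t s a := fun s a i j hij => by
    refine Real.sqrt_le_sqrt (add_le_add_right (mul_le_mul_of_nonneg_left ?_ (by positivity)) _)
    exact Finset.sum_le_sum_of_subset_of_nonneg (Finset.Ico_subset_Ico_right hij)
      fun j _ _ => X.rho_nonneg j ω s a
  have main := M.sum_pairing_le (α := fun _ => 0)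
    -- The telescoping starts from a zero regularizer, whereas `b 0` would be 2.
    (β := fun t s a => if t = 0 then 0 else b t s a)
    (r := fun t s a => 2 * X.rho t ω s a / b t s a) (ℓ := fun t => X.estimator t ω)
    (q := fun t => X.occ t ω) (B := 3 * Real.log T) rfl (fun s a => if_pos rfl) (by positivity) T
    (fun s a t ht => by
      have h0 : t ≠ 0 := by have := (Finset.mem_Icc.1 ht).1; omega
      simp only [h0, if_false]
      split_ifs
      · exact zero_le_two.trans (hb2 t s a)
      · exact hbmono s a (Nat.sub_le t 1))
    (fun t s a => div_nonneg (mul_nonneg zero_le_two (X.rho_nonneg t ω s a))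
      (zero_le_two.trans (hb2 t s a)))
    (fun t ht => (hω t ht).1)
    (fun t ht => by
      have h0 : t ≠ 0 := by have := (Finset.mem_Icc.1 ht).1; omega
      have e : ∀ y : S → A → ℝ, ∑ s ∈ Finset.univ.erase M.terminal, ∑ a, (-(2 * 0) * √(y s a)
          - (if t = 0 then 0 else b t s a) * Real.log (y s a))
          = M.logBarrierReg (X.adaptiveRate t ω) y := fun y => by
        unfold LayeredMDP.logBarrierReg
        rw [← Finset.sum_neg_distrib]
        refine Finset.sum_congr rfl fun s _ => ?_
        rw [← Finset.sum_neg_distrib]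
        refine Finset.sum_congr rfl fun a _ => ?_
        rw [X.one_div_adaptiveRate hT, if_neg h0]
        simp [hb]
      simp only [e]
      exact (hω t ht).2)
    (fun t ht s a hs hpos x hx => by
      have h0 : t ≠ 0 := by have := (Finset.mem_Icc.1 ht).1; omega
      simp only [h0, if_false]
      have h1 := log_barrier_stability (X.abs_occ_mul_estimator_le ht ω s a hpos) (hb2 t s a)
        (div_pos hx hpos)
      rw [X.sq_occ_mul_estimator t ω s a hpos] at h1
      have h2 : X.occ t ω s a * X.estimator t ω s a * (1 - x / X.occ t ω s a)
          = X.estimator t ω s a * (X.occ t ω s a - x) := by field_simp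
      rw [h2] at h1
      simpa using h1)
    hu hlog
  refine main.trans ?_
  simp only [sub_self, mul_zero, zero_mul, Finset.sum_const_zero, add_zero]
  rw [Finset.sum_comm, ← Finset.sum_add_distrib]
  refine Finset.sum_le_sum fun s _ => ?_
  rw [Finset.sum_comm, ← Finset.sum_add_distrib]
  refine Finset.sum_le_sum fun a _ => ?_
  have hT0 : T ≠ 0 := by omega
  rw [if_neg hT0]
  set R := ∑ t ∈ Finset.Icc 1 T, X.rho t ω s a with hR
  have hR0 : 0 ≤ R := Finset.sum_nonneg fun t _ => X.rho_nonneg t ω s a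
  have h1 := sum_div_sqrt_le (ρ := fun t => X.rho t ω s a) (b := Real.log T) (by linarith) T
    (fun t _ => X.rho_nonneg t ω s a) (fun t ht => X.rho_le_one ht ω s a)
  have h2 : ∑ t ∈ Finset.Icc 1 T, 2 * X.rho t ω s a / b t s a
      = 2 * ∑ t ∈ Finset.Icc 1 T, X.rho t ω s a / b t s a := by
    rw [Finset.mul_sum]
    exact Finset.sum_congr rfl fun t _ => by ring
  -- Three times this bounds the penalty. Together with the stability, at most `2 * 2` roots, it
  -- gives `6 log T` plus seven roots.
  have h3 : b T s a * Real.log T ≤ 2 * Real.log T + √(Real.log T * R) := by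
    have e1 : b T s a ≤ √(4 + 1 / Real.log T * R) := by
      refine Real.sqrt_le_sqrt (add_le_add_right (mul_le_mul_of_nonneg_left ?_ (by positivity)) _)
      refine Finset.sum_le_sum_of_subset_of_nonneg (fun j hj => ?_)
        fun j _ _ => X.rho_nonneg j ω s a
      rw [Finset.mem_Ico] at hj
      exact Finset.mem_Icc.2 ⟨hj.1, hj.2.le⟩
    have e2 : √(4 + 1 / Real.log T * R) ≤ 2 + √(1 / Real.log T * R) := by
      refine (sqrt_add_le_add_sqrt (by norm_num) (by positivity)).trans (le_of_eq ?_)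
      rw [show (4 : ℝ) = 2 ^ 2 by norm_num, Real.sqrt_sq zero_le_two]
    have e3 : √(1 / Real.log T * R) * Real.log T = √(Real.log T * R) := by
      nth_rewrite 2 [← Real.sqrt_sq hl0.le]
      rw [← Real.sqrt_mul (by positivity)]
      congr 1
      field_simp
    nlinarith [mul_le_mul_of_nonneg_right (e1.trans e2) hl0.le]
  rw [h2]
  change ∑ t ∈ Finset.Icc 1 T, X.rho t ω s a / b t s a ≤ _ at h1
  linarith

lemma logBarrier_regret_le [IsProbabilityMeasure μ] (X : Interaction M T μ 𝓕) (hT : 2 ≤ T)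
    (hX : X.UsesLogBarrier) (hN : (Fintype.card S * Fintype.card A : ℝ) ≤ T) {p : S → A → ℝ}
    (hp : M.IsPolicy p) :
    X.regret p ≤ ∑ s ∈ Finset.univ.erase M.terminal, ∑ a, (6 * Real.log T
        + 7 * √(Real.log T * X.meanSpread s a)) + 1 := by
  have := LayeredMDP.nonempty_action hp
  have hT1 : (1 : ℝ) ≤ T := by exact_mod_cast (by omega : 1 ≤ T)
  have hT2 : (2 : ℝ) ≤ T := by exact_mod_cast hT
  have hl0 : 0 ≤ Real.log T := Real.log_nonneg hT1
  obtain ⟨u, hu, q₀, hq₀, hmix, -, hmax⟩ := M.exists_comparator ⟨p, hp, rfl⟩ hT1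
  have hR : ∀ s a, Integrable (fun ω => ∑ t ∈ Finset.Icc 1 T, X.rho t ω s a) μ := fun s a =>
    integrable_finsetSum _ fun t ht => X.integrable_rho ht s a
  have hG : ∀ s a, Integrable (fun ω => 6 * Real.log T
      + 7 * √(Real.log T * ∑ t ∈ Finset.Icc 1 T, X.rho t ω s a)) μ := fun s a =>
    (integrable_const _).add ((integrable_sqrt ((hR s a).const_mul _)).const_mul _)
  refine (X.regret_le_add_integral (by omega) hp (hX.mono fun ω h t ht => (h t ht).1) hu.1 hq₀ hmix
    (G := fun ω => ∑ s ∈ Finset.univ.erase M.terminal, ∑ a, (6 * Real.log T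
        + 7 * √(Real.log T * ∑ t ∈ Finset.Icc 1 T, X.rho t ω s a)))
    (integrable_finsetSum _ fun s _ => integrable_finsetSum _ fun a _ => hG s a) ?_).trans ?_
  · filter_upwards [hX] with ω hω
    exact X.logBarrier_sum_pairing_le hT hω hu fun t ht s a hpos =>
      LayeredMDP.log_ratio_le hpos hT2 (by positivity) hN (hmax _ (X.occ_mem ht ω) s a)
  · refine add_le_add_left ?_ _
    rw [integral_finsetSum _ fun s _ => integrable_finsetSum _ fun a _ => hG s a]
    refine Finset.sum_le_sum fun s hs => ?_
    rw [integral_finsetSum _ fun a _ => hG s a]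
    refine Finset.sum_le_sum fun a _ => ?_
    rw [integral_add (integrable_const _) ((integrable_sqrt ((hR s a).const_mul _)).const_mul _)]
    simp only [integral_const, probReal_univ, one_smul]
    rw [integral_const_mul]
    refine add_le_add_right (mul_le_mul_of_nonneg_left ?_ (by norm_num : (0 : ℝ) ≤ 7)) _
    refine (integral_sqrt_le ((hR s a).const_mul _) fun ω => mul_nonneg hl0
      (Finset.sum_nonneg fun t _ => X.rho_nonneg t ω s a)).trans (Real.sqrt_le_sqrt ?_)
    rw [integral_const_mul, integral_finsetSum _ fun t ht => X.integrable_rho ht s a]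
    refine mul_le_mul_of_nonneg_left (Finset.sum_le_sum fun t ht => ?_) hl0
    have := (X.integral_rho_mul_le ht a (Finset.ne_of_mem_erase hs) (f := fun _ => 1)
      measurable_const (fun _ => zero_le_one) (by simpa using X.integrable_spread ht s a)).2
    simpa using this

/-! ### The Tsallis entropy -/

lemma tsallis_sum_pairing_le (X : Interaction M T μ 𝓕) (hT : 2 ≤ T) {ω : Ω}
    (hω : ∀ t ∈ Finset.Icc 1 T, X.occ t ω ∈ M.barrierDomain ∧
      IsMinOn (fun q => M.pairing (fun s a => ∑ j ∈ Finset.Ico 1 t, X.estimator j ω s a) q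
        + M.tsallisReg t q) M.barrierDomain (X.occ t ω))
    {u : S → A → ℝ} (hu : u ∈ M.barrierDomain)
    (hlog : ∀ t ∈ Finset.Icc 1 T, ∀ s a, 0 < X.occ t ω s a →
      Real.log (X.occ t ω s a / u s a) ≤ 3 * Real.log T) :
    ∑ t ∈ Finset.Icc 1 T, M.pairing (X.estimator t ω) (X.occ t ω - u)
      ≤ ∑ t ∈ Finset.Icc 1 T, ∑ s ∈ Finset.univ.erase M.terminal, ∑ a,
          9 / 4 * (1 / √(t : ℝ)) * (X.rho t ω s a * (1 / √(X.occ t ω s a)))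
        + ∑ t ∈ Finset.Icc 1 T, 2 * (√(t : ℝ) - √((t - 1 : ℕ) : ℝ)) *
          ∑ s ∈ Finset.univ.erase M.terminal, ∑ a, (√(X.occ t ω s a) - √(u s a))
        + 6 * (Fintype.card S * Fintype.card A * Real.log T) := by
  have hl0 : 0 ≤ Real.log T := Real.log_nonneg (by exact_mod_cast (by omega : 1 ≤ T))
  have main := M.sum_pairing_le (α := fun t => √(t : ℝ))
    (β := fun t s a => if t = 0 then 0 else 2)
    (r := fun t s a => 9 / 4 * (1 / √(t : ℝ)) * (X.rho t ω s a * (1 / √(X.occ t ω s a))))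
    (ℓ := fun t => X.estimator t ω)
    (q := fun t => X.occ t ω) (B := 3 * Real.log T) (by simp) (fun s a => if_pos rfl)
    (by positivity) T
    (fun s a t ht => by
      have h0 : t ≠ 0 := by have := (Finset.mem_Icc.1 ht).1; omega
      simp only [h0, if_false]
      split_ifs <;> norm_num)
    (fun t s a => by
      have := X.rho_nonneg t ω s a
      positivity)
    (fun t ht => (hω t ht).1)
    (fun t ht => by
      have h0 : t ≠ 0 := by have := (Finset.mem_Icc.1 ht).1; omega
      have e : ∀ y : S → A → ℝ, ∑ s ∈ Finset.univ.erase M.terminal, ∑ a,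
          (-(2 * √(t : ℝ)) * √(y s a) - (if t = 0 then 0 else 2) * Real.log (y s a))
          = M.tsallisReg t y := fun y => by
        unfold LayeredMDP.tsallisReg LayeredMDP.tsallisRate
        simp only [if_neg h0, Finset.sum_sub_distrib, ← Finset.mul_sum]
        rw [div_div_eq_mul_div, div_one]
      simp only [e]
      exact (hω t ht).2)
    (fun t ht s a hs hpos x hx => by
      have h0 : t ≠ 0 := by have := (Finset.mem_Icc.1 ht).1; omega
      have ht0 : 0 < √(t : ℝ) := Real.sqrt_pos.2 (by exact_mod_cast Nat.pos_of_ne_zero h0)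
      have hs0 : 0 < √(X.occ t ω s a) := Real.sqrt_pos.2 hpos
      simp only [h0, if_false]
      -- In the ratio `y = x / q` the divergence of the entropy has the coefficient `√t √q`, so the
      -- stability cost is of order `ρ / (√t √q)`.
      have h1 := tsallis_stability (X.abs_occ_mul_estimator_le ht ω s a hpos) (mul_pos ht0 hs0)
        (div_pos hx hpos)
      rw [X.sq_occ_mul_estimator t ω s a hpos, Real.sqrt_div hx.le] at h1
      have h2 : X.occ t ω s a * X.estimator t ω s a * (1 - x / X.occ t ω s a)
          = X.estimator t ω s a * (X.occ t ω s a - x) := by field_simp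
      have h3 : √(t : ℝ) * √(X.occ t ω s a) * (√x / √(X.occ t ω s a) - 1) ^ 2
          = √(t : ℝ) * (√x - √(X.occ t ω s a)) ^ 2 / √(X.occ t ω s a) := by field_simp
      have h4 : 9 / 4 * X.rho t ω s a / (√(t : ℝ) * √(X.occ t ω s a))
          = 9 / 4 * (1 / √(t : ℝ)) * (X.rho t ω s a * (1 / √(X.occ t ω s a))) := by field_simp
      rw [h2, h3, h4] at h1
      linarith)
    hu hlog
  refine main.trans (add_le_add_right ?_ _)
  have hT0 : T ≠ 0 := by omega
  simp only [hT0, if_false]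
  refine (M.card_erase_mul_le (by positivity)).trans (le_of_eq ?_)
  ring

lemma integrable_sqrt_occ [IsProbabilityMeasure μ] (X : Interaction M T μ 𝓕) {t : ℕ}
    (ht : t ∈ Finset.Icc 1 T) (s : S) (a : A) : Integrable (fun ω => √(X.occ t ω s a)) μ :=
  integrable_sqrt (X.integrable_occ ht s a)

lemma integrable_spread_mul [IsProbabilityMeasure μ] (X : Interaction M T μ 𝓕) {t : ℕ}
    (ht : t ∈ Finset.Icc 1 T) (s : S) (a : A) :
    Integrable (fun ω => LayeredMDP.spread (X.occ t ω) s a * (1 / √(X.occ t ω s a))) μ := by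
  refine integrable_of_bounded ((X.measurable_spread ht s a).mul
    ((X.measurable_occ ht s a).sqrt.const_div 1)) 1 fun ω => ?_
  rw [abs_of_nonneg (mul_nonneg (M.spread_nonneg (X.occ_mem ht ω) s a) (by positivity))]
  refine (M.spread_mul_le (X.occ_mem ht ω) s a).trans ?_
  exact Real.sqrt_le_iff.2 ⟨zero_le_one, by simpa using M.mem_occSet_le_one (X.occ_mem ht ω) s a⟩

lemma integrable_sum_sqrt_sub [IsProbabilityMeasure μ] (X : Interaction M T μ 𝓕) {t : ℕ}
    (ht : t ∈ Finset.Icc 1 T) (u : S → A → ℝ) :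
    Integrable (fun ω => ∑ s ∈ Finset.univ.erase M.terminal, ∑ a,
      (√(X.occ t ω s a) - √(u s a))) μ :=
  integrable_finsetSum _ fun s _ => integrable_finsetSum _ fun a _ =>
    (X.integrable_sqrt_occ ht s a).sub (integrable_const _)

lemma integrable_sum_spread_mul [IsProbabilityMeasure μ] (X : Interaction M T μ 𝓕) {t : ℕ}
    (ht : t ∈ Finset.Icc 1 T) :
    Integrable (fun ω => ∑ s ∈ Finset.univ.erase M.terminal, ∑ a,
      LayeredMDP.spread (X.occ t ω) s a * (1 / √(X.occ t ω s a))) μ :=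
  integrable_finsetSum _ fun s _ => integrable_finsetSum _ fun a _ =>
    X.integrable_spread_mul ht s a

/-- The comparator `u` stays visible because in the self-bounding regime `√u` has to cancel most of
`√q_t` at the actions of the comparator policy. -/
lemma tsallis_regret_le [IsProbabilityMeasure μ] (X : Interaction M T μ 𝓕) (hT : 2 ≤ T)
    (hX : X.UsesTsallis) (hN : (Fintype.card S * Fintype.card A : ℝ) ≤ T) {p : S → A → ℝ}
    (hp : M.IsPolicy p) :
    ∃ u : S → A → ℝ, (∀ s a, (1 - 1 / (T : ℝ)) * M.occ p s a ≤ u s a) ∧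
      X.regret p ≤ ∑ t ∈ Finset.Icc 1 T, ∫ ω,
        (9 / 4 * (1 / √(t : ℝ)) * ∑ s ∈ Finset.univ.erase M.terminal, ∑ a,
            LayeredMDP.spread (X.occ t ω) s a * (1 / √(X.occ t ω s a))
          + 2 * (√(t : ℝ) - √((t - 1 : ℕ) : ℝ)) *
            ∑ s ∈ Finset.univ.erase M.terminal, ∑ a, (√(X.occ t ω s a) - √(u s a))) ∂μ
        + 6 * (Fintype.card S * Fintype.card A * Real.log T) + 1 := by
  have := LayeredMDP.nonempty_action hp
  have hT1 : (1 : ℝ) ≤ T := by exact_mod_cast (by omega : 1 ≤ T)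
  have hT2 : (2 : ℝ) ≤ T := by exact_mod_cast hT
  obtain ⟨u, hu, q₀, hq₀, hmix, hge, hmax⟩ := M.exists_comparator ⟨p, hp, rfl⟩ hT1
  refine ⟨u, hge, ?_⟩
  have hρ : ∀ t ∈ Finset.Icc 1 T, ∀ s ∈ Finset.univ.erase M.terminal, ∀ a,
      Integrable (fun ω => X.rho t ω s a * (1 / √(X.occ t ω s a))) μ ∧
      ∫ ω, X.rho t ω s a * (1 / √(X.occ t ω s a)) ∂μ
        ≤ ∫ ω, LayeredMDP.spread (X.occ t ω) s a * (1 / √(X.occ t ω s a)) ∂μ :=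
    fun t ht s hs a => X.integral_rho_mul_le ht a (Finset.ne_of_mem_erase hs)
      ((X.measurable_occ ht s a).sqrt.const_div 1) (fun ω => by positivity)
      (X.integrable_spread_mul ht s a)
  have hI1 : ∀ t ∈ Finset.Icc 1 T, Integrable (fun ω => ∑ s ∈ Finset.univ.erase M.terminal, ∑ a,
      9 / 4 * (1 / √(t : ℝ)) * (X.rho t ω s a * (1 / √(X.occ t ω s a)))) μ := fun t ht =>
    integrable_finsetSum _ fun s hs => integrable_finsetSum _ fun a _ =>
      ((hρ t ht s hs a).1).const_mul _
  have hI2 := fun t (ht : t ∈ Finset.Icc 1 T) =>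
    (X.integrable_sum_sqrt_sub ht u).const_mul (2 * (√(t : ℝ) - √((t - 1 : ℕ) : ℝ)))
  have hI3 := fun t (ht : t ∈ Finset.Icc 1 T) =>
    (X.integrable_sum_spread_mul ht).const_mul (9 / 4 * (1 / √(t : ℝ)))
  refine (X.regret_le_add_integral (by omega) hp (hX.mono fun ω h t ht => (h t ht).1) hu.1 hq₀ hmix
    (((integrable_finsetSum _ hI1).add (integrable_finsetSum _ hI2)).add
      (integrable_const (6 * (Fintype.card S * Fintype.card A * Real.log T)))) ?_).trans ?_
  · filter_upwards [hX] with ω hω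
    exact X.tsallis_sum_pairing_le hT hω hu fun t ht s a hpos =>
      LayeredMDP.log_ratio_le hpos hT2 (by positivity) hN (hmax _ (X.occ_mem ht ω) s a)
  · refine add_le_add_left ?_ _
    rw [integral_add' ((integrable_finsetSum _ hI1).add (integrable_finsetSum _ hI2))
      (integrable_const _), integral_add' (integrable_finsetSum _ hI1) (integrable_finsetSum _ hI2),
      integral_finsetSum _ hI1, integral_finsetSum _ hI2, ← Finset.sum_add_distrib]
    simp only [integral_const, probReal_univ, one_smul]
    refine add_le_add_left (Finset.sum_le_sum fun t ht => ?_) _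
    rw [integral_add (hI3 t ht) (hI2 t ht)]
    refine add_le_add_left ?_ _
    rw [integral_finsetSum _ fun s hs => integrable_finsetSum _ fun a _ =>
      ((hρ t ht s hs a).1).const_mul _, integral_const_mul,
      integral_finsetSum _ fun s _ => integrable_finsetSum _ fun a _ =>
      X.integrable_spread_mul ht s a, Finset.mul_sum]
    refine Finset.sum_le_sum fun s hs => ?_
    rw [integral_finsetSum _ fun a _ => ((hρ t ht s hs a).1).const_mul _,
      integral_finsetSum _ fun a _ => X.integrable_spread_mul ht s a, Finset.mul_sum]
    refine Finset.sum_le_sum fun a _ => ?_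
    rw [integral_const_mul]
    exact mul_le_mul_of_nonneg_left (hρ t ht s hs a).2 (by positivity)

end Interaction

namespace LayeredMDP

variable {S A : Type*} [Fintype S] [Fintype A] [DecidableEq S] [DecidableEq A] {L : ℕ}

/-! ### The gaps -/

lemma gapSum_nonneg (M : LayeredMDP S A L) {T : ℕ} (p : S → A) {Δ : S → A → ℝ}
    (hΔ : ∀ s a, 0 ≤ Δ s a) : 0 ≤ M.gapSum T p Δ :=
  Finset.sum_nonneg fun s _ => Finset.sum_nonneg fun a _ =>
    div_nonneg (Real.log_natCast_nonneg T) (hΔ s a)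

lemma gapMin_nonneg (M : LayeredMDP S A L) (p : S → A) {Δ : S → A → ℝ}
    (hΔ : ∀ s a, 0 ≤ Δ s a) : 0 ≤ M.gapMin p Δ := by
  refine Real.sInf_nonneg ?_
  rintro _ ⟨s, a, -, -, rfl⟩
  exact hΔ s a

lemma gapMin_le (M : LayeredMDP S A L) {p : S → A} {Δ : S → A → ℝ} (hΔ : ∀ s a, 0 ≤ Δ s a)
    {s : S} {a : A} (hs : s ≠ M.terminal) (ha : a ≠ p s) : M.gapMin p Δ ≤ Δ s a := by
  refine csInf_le ⟨0, ?_⟩ ⟨s, a, hs, ha, rfl⟩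
  rintro _ ⟨s, a, -, -, rfl⟩
  exact hΔ s a

lemma gapMin_pos [Nontrivial A] (M : LayeredMDP S A L) (p : S → A) {Δ : S → A → ℝ}
    (hΔ : ∀ s a, s ≠ M.terminal → a ≠ p s → 0 < Δ s a) : 0 < M.gapMin p Δ := by
  have hfin : {x | ∃ s a, s ≠ M.terminal ∧ a ≠ p s ∧ x = Δ s a}.Finite := by
    refine (Set.finite_range fun x : S × A => Δ x.1 x.2).subset ?_
    rintro _ ⟨s, a, -, -, rfl⟩
    exact ⟨(s, a), rfl⟩
  have hne : {x | ∃ s a, s ≠ M.terminal ∧ a ≠ p s ∧ x = Δ s a}.Nonempty := by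
    obtain ⟨a, ha⟩ := exists_ne (p M.start)
    exact ⟨_, M.start, a, M.start_ne_terminal, ha, rfl⟩
  obtain ⟨s, a, hs, ha, h⟩ := hne.csInf_mem hfin
  unfold gapMin
  rw [h]
  exact hΔ s a hs ha

lemma two_le_card_states (M : LayeredMDP S A L) : 2 ≤ Fintype.card S := by
  have : Nontrivial S := ⟨_, _, M.start_ne_terminal⟩
  exact Fintype.one_lt_card

/-- Gaps are at most 1, so each of the `(|S| - 1)(|A| - 1)` summands is at least `log T`, and both
cardinalities are at least 2. This absorbs the lower-order terms into `U`. -/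
lemma card_mul_log_le_gapSum [Nontrivial A] (M : LayeredMDP S A L) (T : ℕ) (p : S → A)
    {Δ : S → A → ℝ} (hpos : ∀ s a, s ≠ M.terminal → a ≠ p s → 0 < Δ s a)
    (hle : ∀ s a, Δ s a ≤ 1) :
    Fintype.card S * Fintype.card A * Real.log T ≤ 4 * M.gapSum T p Δ := by
  have hl := Real.log_natCast_nonneg T
  have h1 : ∑ s ∈ Finset.univ.erase M.terminal, ∑ a ∈ Finset.univ.erase (p s), Real.log T
      ≤ M.gapSum T p Δ := by
    refine Finset.sum_le_sum fun s hs => Finset.sum_le_sum fun a ha => ?_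
    exact le_div_self hl (hpos s a (Finset.ne_of_mem_erase hs) (Finset.ne_of_mem_erase ha))
      (hle s a)
  have hA : 2 ≤ Fintype.card A := Fintype.one_lt_card
  have hS := M.two_le_card_states
  simp only [Finset.sum_const, Finset.card_erase_of_mem (Finset.mem_univ _), Finset.card_univ,
    nsmul_eq_mul] at h1
  rw [Nat.cast_sub (by omega), Nat.cast_sub (by omega), Nat.cast_one] at h1
  have hA' : (2 : ℝ) ≤ Fintype.card A := by exact_mod_cast hA
  have hS' : (2 : ℝ) ≤ Fintype.card S := by exact_mod_cast hS
  have h2 : (Fintype.card S * Fintype.card A : ℝ)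
      ≤ 4 * ((Fintype.card S - 1) * (Fintype.card A - 1)) := by nlinarith
  have h3 := mul_le_mul_of_nonneg_right h2 hl
  linarith

lemma one_le_card_mul_log (M : LayeredMDP S A L) [Nonempty A] {T : ℕ} (hT : 2 ≤ T) :
    1 ≤ Fintype.card S * Fintype.card A * Real.log T := by
  have hS' : (2 : ℝ) ≤ Fintype.card S := by exact_mod_cast M.two_le_card_states
  have hA' : (1 : ℝ) ≤ Fintype.card A := by exact_mod_cast Fintype.card_pos (α := A)
  have hl2 : Real.log 2 ≤ Real.log T := Real.log_le_log (by norm_num) (by exact_mod_cast hT)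
  have hl3 := Real.log_two_gt_d9
  have h1 : (2 : ℝ) ≤ Fintype.card S * Fintype.card A := by nlinarith
  nlinarith

/-! ### Bounds on square roots of occupancy measures -/

lemma sum_sqrt_le (M : LayeredMDP S A L) {q : S → A → ℝ} (hq : q ∈ M.occSet) :
    ∑ s ∈ Finset.univ.erase M.terminal, ∑ a, √(q s a)
      ≤ √(Fintype.card S * Fintype.card A * L) := by
  have h := sum_sum_sqrt_mul_sqrt_le (Finset.univ.erase M.terminal) (fun _ => Finset.univ)
    (f := fun (_ : S) (_ : A) => 1) (g := q) (fun _ _ => zero_le_one) (M.mem_occSet_nonneg hq)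
  rw [M.mem_occSet_sum hq] at h
  simp only [Real.sqrt_one, one_mul] at h
  rw [Real.sqrt_mul (by positivity)]
  refine h.trans (mul_le_mul_of_nonneg_right (Real.sqrt_le_sqrt ?_) (Real.sqrt_nonneg _))
  simpa using M.card_erase_mul_le (c := 1) zero_le_one

/-- The action `π s` is charged to the other actions of `s`, which are thus counted twice. -/
lemma sum_spread_mul_le (M : LayeredMDP S A L) (π : S → A) {q : S → A → ℝ} (hq : q ∈ M.occSet) :
    ∑ s ∈ Finset.univ.erase M.terminal, ∑ a, spread q s a * (1 / √(q s a))
      ≤ 2 * ∑ s ∈ Finset.univ.erase M.terminal, ∑ a ∈ Finset.univ.erase (π s), √(q s a) := by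
  rw [Finset.mul_sum]
  refine Finset.sum_le_sum fun s _ => ?_
  rw [← Finset.add_sum_erase _ _ (Finset.mem_univ (π s)), two_mul]
  exact add_le_add ((M.spread_mul_le_sum_erase hq s (π s)).trans (sqrt_sum_le_sum_sqrt _ _))
    (Finset.sum_le_sum fun a _ => M.spread_mul_le hq s a)

/-- Off `π` the terms `-√u` are dropped. At `π s`, `√q - √u` is at most the root of the excess of
`q` over the mass of `π` at `s`, up to `1 / T`; Cauchy-Schwarz over the states and `sum_excess_le`
bound these roots by the deviation. -/
lemma sum_sqrt_sub_le (M : LayeredMDP S A L) (π : S → A) {q u : S → A → ℝ} (hq : q ∈ M.occSet)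
    {T : ℝ} (hT : 1 ≤ T) (hu : ∀ s a, (1 - 1 / T) * M.occ (detPolicy π) s a ≤ u s a) :
    ∑ s ∈ Finset.univ.erase M.terminal, ∑ a, (√(q s a) - √(u s a))
      ≤ ∑ s ∈ Finset.univ.erase M.terminal, ∑ a ∈ Finset.univ.erase (π s), √(q s a)
        + √(Fintype.card S * L * M.deviation π q) + Fintype.card S * (1 / T) := by
  have hocc : M.occ (detPolicy π) ∈ M.occSet := ⟨_, M.detPolicy_isPolicy π, rfl⟩
  have hT0 : 0 < T := by linarith
  have hT1 : 0 ≤ 1 / T := by positivity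
  have hT2 : 0 ≤ 1 - 1 / T := by rw [sub_nonneg, div_le_one hT0]; exact hT
  set g : S → ℝ := fun s => max (∑ a, q s a - M.occ (detPolicy π) s (π s)) 0 with hg
  have hg0 : ∀ s, 0 ≤ g s := fun s => le_max_right _ _
  have hpt : ∀ s, √(q s (π s)) - √(u s (π s)) ≤ √(g s) + 1 / T := fun s => by
    set o := M.occ (detPolicy π) s (π s)
    have ho0 : 0 ≤ o := M.mem_occSet_nonneg hocc s (π s)
    have ho1 : √o ≤ 1 := Real.sqrt_le_iff.2
      ⟨zero_le_one, by simpa using M.mem_occSet_le_one hocc s (π s)⟩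
    have h1 : √(q s (π s)) ≤ √o + √(g s) := by
      refine (Real.sqrt_le_sqrt ?_).trans (sqrt_add_le_add_sqrt ho0 (hg0 s))
      have := M.mem_occSet_le_sum hq s (π s)
      have : ∑ a, q s a - o ≤ g s := le_max_left _ _
      linarith
    -- The square `(1 - 1/T)²` is at most `1 - 1/T`; as `√o ≤ 1`, the loss against `√o` is at most
    -- `1 / T`.
    have h2 : (1 - 1 / T) * √o ≤ √(u s (π s)) := by
      refine Real.le_sqrt_of_sq_le (le_trans ?_ (hu s (π s)))
      rw [mul_pow, Real.sq_sqrt ho0]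
      refine mul_le_mul_of_nonneg_right ?_ ho0
      nlinarith
    nlinarith [Real.sqrt_nonneg o]
  have hsum : ∑ s ∈ Finset.univ.erase M.terminal, √(g s)
      ≤ √(Fintype.card S * L * M.deviation π q) := by
    have h := Real.sum_sqrt_mul_sqrt_le (Finset.univ.erase M.terminal) (f := fun _ => 1) (g := g)
      (fun _ => zero_le_one) hg0
    simp only [Real.sqrt_one, one_mul] at h
    refine h.trans ?_
    rw [← Real.sqrt_mul (Finset.sum_nonneg fun _ _ => zero_le_one), mul_assoc]
    refine Real.sqrt_le_sqrt (mul_le_mul ?_ (M.sum_excess_le π hq)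
      (Finset.sum_nonneg fun s _ => hg0 s) (Nat.cast_nonneg _))
    simp
  have hone : ∑ _s ∈ Finset.univ.erase M.terminal, 1 / T ≤ Fintype.card S * (1 / T) := by
    rw [Finset.sum_const, nsmul_eq_mul]
    exact mul_le_mul_of_nonneg_right (by exact_mod_cast Finset.card_le_univ _) hT1
  have hmain : ∑ s ∈ Finset.univ.erase M.terminal, ∑ a, (√(q s a) - √(u s a))
      ≤ ∑ s ∈ Finset.univ.erase M.terminal,
        (∑ a ∈ Finset.univ.erase (π s), √(q s a) + √(g s) + 1 / T) := by
    refine Finset.sum_le_sum fun s _ => ?_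
    rw [← Finset.add_sum_erase _ _ (Finset.mem_univ (π s))]
    have h1 := hpt s
    have h2 : ∑ a ∈ Finset.univ.erase (π s), (√(q s a) - √(u s a))
        ≤ ∑ a ∈ Finset.univ.erase (π s), √(q s a) :=
      Finset.sum_le_sum fun a _ => sub_le_self _ (Real.sqrt_nonneg _)
    linarith
  simp only [Finset.sum_add_distrib] at hmain
  linarith

end LayeredMDP

/-- Cauchy-Schwarz in time: the harmonic sum of the learning rates produces the `log T`. -/
lemma sum_one_div_sqrt_mul_sqrt_le {T : ℕ} (hT : 2 ≤ T) {x : ℕ → ℝ}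
    (hx : ∀ t ∈ Finset.Icc 1 T, 0 ≤ x t) :
    ∑ t ∈ Finset.Icc 1 T, 1 / √(t : ℝ) * √(x t)
      ≤ √3 * √(Real.log T * ∑ t ∈ Finset.Icc 1 T, x t) := by
  have h := Real.sum_sqrt_mul_sqrt_le (Finset.Icc 1 T) (f := fun t : ℕ => 1 / (t : ℝ))
    (g := fun t => max (x t) 0) (fun t => by positivity) (fun t => le_max_right _ _)
  have e1 : ∑ t ∈ Finset.Icc 1 T, √(1 / (t : ℝ)) * √(max (x t) 0)
      = ∑ t ∈ Finset.Icc 1 T, 1 / √(t : ℝ) * √(x t) :=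
    Finset.sum_congr rfl fun t ht => by
      rw [max_eq_left (hx t ht), Real.sqrt_div zero_le_one, Real.sqrt_one]
  have e2 : ∑ t ∈ Finset.Icc 1 T, max (x t) 0 = ∑ t ∈ Finset.Icc 1 T, x t :=
    Finset.sum_congr rfl fun t ht => max_eq_left (hx t ht)
  rw [e1, e2] at h
  refine h.trans ?_
  rw [Real.sqrt_mul (Real.log_natCast_nonneg T), ← mul_assoc,
    ← Real.sqrt_mul (by norm_num : (0 : ℝ) ≤ 3)]
  exact mul_le_mul_of_nonneg_right (Real.sqrt_le_sqrt (sum_one_div_le hT)) (Real.sqrt_nonneg _)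

namespace Interaction

variable {S A : Type*} [Fintype S] [Fintype A] [DecidableEq S] [DecidableEq A] {L : ℕ}
  {M : LayeredMDP S A L} {T : ℕ} {Ω : Type*} [mΩ : MeasurableSpace Ω] {μ : Measure Ω}
  {𝓕 : Filtration ℕ mΩ}

/-! ### The self-bounding regime -/

lemma integral_gap_eq [IsProbabilityMeasure μ] (X : Interaction M T μ 𝓕) (p : S → A)
    (Δ : S → A → ℝ) :
    ∫ ω, ∑ t ∈ Finset.Icc 1 T, ∑ s ∈ Finset.univ.erase M.terminal,
        ∑ a ∈ Finset.univ.erase (p s), Δ s a * X.occ t ω s a ∂μ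
      = ∑ s ∈ Finset.univ.erase M.terminal, ∑ a ∈ Finset.univ.erase (p s),
        Δ s a * X.meanOcc s a := by
  have hI : ∀ t ∈ Finset.Icc 1 T, ∀ s a, Integrable (fun ω => Δ s a * X.occ t ω s a) μ :=
    fun t ht s a => (X.integrable_occ ht s a).const_mul _
  rw [integral_finsetSum _ fun t ht => integrable_finsetSum _ fun s _ =>
    integrable_finsetSum _ fun a _ => hI t ht s a]
  have h : ∀ t ∈ Finset.Icc 1 T, ∫ ω, ∑ s ∈ Finset.univ.erase M.terminal,
        ∑ a ∈ Finset.univ.erase (p s), Δ s a * X.occ t ω s a ∂μ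
      = ∑ s ∈ Finset.univ.erase M.terminal, ∑ a ∈ Finset.univ.erase (p s),
        Δ s a * ∫ ω, X.occ t ω s a ∂μ := fun t ht => by
    rw [integral_finsetSum _ fun s _ => integrable_finsetSum _ fun a _ => hI t ht s a]
    refine Finset.sum_congr rfl fun s _ => ?_
    rw [integral_finsetSum _ fun a _ => hI t ht s a]
    exact Finset.sum_congr rfl fun a _ => integral_const_mul _ _
  rw [Finset.sum_congr rfl h, Finset.sum_comm]
  refine Finset.sum_congr rfl fun s _ => ?_
  rw [Finset.sum_comm]
  refine Finset.sum_congr rfl fun a _ => ?_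
  rw [meanOcc, Finset.mul_sum]

/-- The expected sum of the gaps of the visited pairs. -/
noncomputable def meanGap (X : Interaction M T μ 𝓕) (p : S → A) (Δ : S → A → ℝ) : ℝ :=
  ∑ s ∈ Finset.univ.erase M.terminal, ∑ a ∈ Finset.univ.erase (p s), Δ s a * X.meanOcc s a

lemma meanGap_nonneg (X : Interaction M T μ 𝓕) (p : S → A) {Δ : S → A → ℝ}
    (hΔ : ∀ s a, 0 ≤ Δ s a) : 0 ≤ X.meanGap p Δ :=
  Finset.sum_nonneg fun s _ => Finset.sum_nonneg fun a _ => mul_nonneg (hΔ s a)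
    (X.meanOcc_nonneg s a)

lemma IsSelfBounding.meanGap_le [IsProbabilityMeasure μ] {X : Interaction M T μ 𝓕} {p : S → A}
    {Δ : S → A → ℝ} {C : ℝ} (h : X.IsSelfBounding p Δ C) :
    X.meanGap p Δ ≤ X.regret (detPolicy p) + C := by
  have := h.le_regret
  rw [X.integral_gap_eq] at this
  change X.meanGap p Δ - C ≤ _ at this
  linarith

/-- Cauchy-Schwarz with each product split as `(log T / Δ) * (Δ * meanOcc)`. -/
lemma sum_sqrt_meanOcc_le (X : Interaction M T μ 𝓕) (p : S → A) {Δ : S → A → ℝ}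
    (hΔ : ∀ s a, 0 ≤ Δ s a) (hpos : ∀ s a, s ≠ M.terminal → a ≠ p s → 0 < Δ s a) :
    ∑ s ∈ Finset.univ.erase M.terminal, ∑ a ∈ Finset.univ.erase (p s),
        √(Real.log T * X.meanOcc s a)
      ≤ √(M.gapSum T p Δ * X.meanGap p Δ) := by
  have hl := Real.log_natCast_nonneg T
  have h := sum_sum_sqrt_mul_sqrt_le (Finset.univ.erase M.terminal)
    (fun s => Finset.univ.erase (p s)) (f := fun s a => Real.log T / Δ s a)
    (g := fun s a => Δ s a * X.meanOcc s a) (fun s a => div_nonneg hl (hΔ s a))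
    (fun s a => mul_nonneg (hΔ s a) (X.meanOcc_nonneg s a))
  rw [Real.sqrt_mul (M.gapSum_nonneg p hΔ)]
  refine le_trans (le_of_eq ?_) h
  refine Finset.sum_congr rfl fun s hs => Finset.sum_congr rfl fun a ha => ?_
  have h0 := hpos s a (Finset.ne_of_mem_erase hs) (Finset.ne_of_mem_erase ha)
  rw [← Real.sqrt_mul (div_nonneg hl (hΔ s a))]
  congr 1
  field_simp

/-! ### The logarithmic barrier -/

lemma logBarrier_regret_le_sqrt [IsProbabilityMeasure μ] (X : Interaction M T μ 𝓕) (hT : 2 ≤ T)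
    (hX : X.UsesLogBarrier) {p : S → A → ℝ} (hp : M.IsPolicy p) :
    X.regret p ≤ 14 * √(Fintype.card S * Fintype.card A * L * T * Real.log T) := by
  have := LayeredMDP.nonempty_action hp
  have hone := M.one_le_card_mul_log hT
  have hl0 := Real.log_natCast_nonneg T
  have hl2 : Real.log 2 ≤ Real.log T := Real.log_le_log (by norm_num) (by exact_mod_cast hT)
  have hl3 := Real.log_two_gt_d9
  have hL : (1 : ℝ) ≤ L := by exact_mod_cast M.L_pos
  have hT0 : (0 : ℝ) ≤ T := Nat.cast_nonneg T
  set N : ℝ := Fintype.card S * Fintype.card A with hN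
  have hN0 : 0 ≤ N := by positivity
  set V := √(N * L * T * Real.log T) with hV
  have hNLT : N * Real.log T * T ≤ N * L * T * Real.log T := by
    have := mul_le_mul_of_nonneg_left hL (by positivity : 0 ≤ N * Real.log T * T)
    linarith
  -- For such small `T` the trivial bound `T` is at most `2 V`. Otherwise `N ≤ T`, as the
  -- logarithmic estimate requires, and `N log T ≤ T` puts the lower-order term below `V`.
  by_cases hcase : (T : ℝ) ≤ 2 * (N * Real.log T)
  · refine (X.regret_le_episodes hp).trans ?_
    have : (T : ℝ) ≤ 2 * V := by
      rw [show 2 * V = √(4 * (N * L * T * Real.log T)) by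
        rw [Real.sqrt_mul (by norm_num), show (4 : ℝ) = 2 ^ 2 by norm_num, Real.sqrt_sq zero_le_two]]
      refine Real.le_sqrt_of_sq_le ?_
      nlinarith [mul_le_mul_of_nonneg_right hcase hT0]
    linarith [Real.sqrt_nonneg (N * L * T * Real.log T)]
  · have hNT : N ≤ T := by nlinarith
    have h := X.logBarrier_regret_le hT hX hNT hp
    simp only [Finset.sum_add_distrib, ← Finset.mul_sum] at h
    have h1 := M.card_erase_mul_le hl0
    have h2 : ∑ s ∈ Finset.univ.erase M.terminal, ∑ a, √(Real.log T * X.meanSpread s a) ≤ V := by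
      have e := sum_sum_sqrt_mul_sqrt_le (Finset.univ.erase M.terminal) (fun _ => Finset.univ)
        (f := fun (_ : S) (_ : A) => Real.log T) (g := X.meanSpread) (fun _ _ => hl0)
        X.meanSpread_nonneg
      simp only [← Real.sqrt_mul hl0] at e
      refine e.trans ?_
      rw [← Real.sqrt_mul (Finset.sum_nonneg fun _ _ => Finset.sum_nonneg fun _ _ => hl0)]
      refine Real.sqrt_le_sqrt ?_
      have e2 : ∑ s ∈ Finset.univ.erase M.terminal, ∑ a, X.meanSpread s a ≤ L * T := by
        rw [← X.sum_meanOcc]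
        exact Finset.sum_le_sum fun s _ => Finset.sum_le_sum fun a _ => X.meanSpread_le s a
      calc _ ≤ N * Real.log T * (L * T) := mul_le_mul h1 e2
            (Finset.sum_nonneg fun s _ => Finset.sum_nonneg fun a _ => X.meanSpread_nonneg s a)
            (by positivity)
        _ = _ := by ring
    have h3 : N * Real.log T ≤ V := by
      refine Real.le_sqrt_of_sq_le (le_trans ?_ hNLT)
      rw [sq]
      exact mul_le_mul_of_nonneg_left (by linarith) (by positivity)
    linarith

lemma logBarrier_regret_le_gap [IsProbabilityMeasure μ] [Nontrivial A] (X : Interaction M T μ 𝓕)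
    (hT : 2 ≤ T) (hX : X.UsesLogBarrier) {p : S → A} {Δ : S → A → ℝ} {C : ℝ}
    (h : X.IsSelfBounding p Δ C) :
    X.regret (detPolicy p)
      ≤ 28 * M.logBarrierU T p Δ + 14 * √(M.logBarrierU T p Δ * X.meanGap p Δ) := by
  have hp := M.detPolicy_isPolicy p
  have hone := M.one_le_card_mul_log hT
  have hl0 := Real.log_natCast_nonneg T
  have hl2 : Real.log 2 ≤ Real.log T := Real.log_le_log (by norm_num) (by exact_mod_cast hT)
  have hl3 := Real.log_two_gt_d9
  have hN4 := M.card_mul_log_le_gapSum T p h.gap_pos fun s a => (h.gap_mem s a).2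
  have hΔ0 : ∀ s a, 0 ≤ Δ s a := fun s a => (h.gap_mem s a).1
  unfold LayeredMDP.logBarrierU
  set N : ℝ := Fintype.card S * Fintype.card A with hN
  have hN0 : 0 ≤ N := by positivity
  by_cases hNT : N ≤ T
  · have hR := X.logBarrier_regret_le hT hX hNT hp
    simp only [Finset.sum_add_distrib, ← Finset.mul_sum] at hR
    have h1 := M.card_erase_mul_le hl0
    -- The 2 comes from charging the action `p s` to the other actions of `s`.
    have h2 : ∑ s ∈ Finset.univ.erase M.terminal, ∑ a, √(Real.log T * X.meanSpread s a)
        ≤ 2 * √(M.gapSum T p Δ * X.meanGap p Δ) := by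
      refine le_trans ?_ (mul_le_mul_of_nonneg_left (X.sum_sqrt_meanOcc_le p hΔ0 h.gap_pos)
        zero_le_two)
      rw [Finset.mul_sum]
      refine Finset.sum_le_sum fun s _ => ?_
      rw [← Finset.add_sum_erase _ _ (Finset.mem_univ (p s)), two_mul]
      refine add_le_add ((Real.sqrt_le_sqrt ?_).trans (sqrt_sum_le_sum_sqrt _ _))
        (Finset.sum_le_sum fun a _ => Real.sqrt_le_sqrt
          (mul_le_mul_of_nonneg_left (X.meanSpread_le s a) hl0))
      rw [← Finset.mul_sum]
      exact mul_le_mul_of_nonneg_left (X.meanSpread_le_sum_erase s (p s)) hl0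
    linarith
  · have h1 := X.regret_le_episodes hp
    have h2 : N ≤ 2 * (N * Real.log T) := by nlinarith
    have h3 := Real.sqrt_nonneg (M.gapSum T p Δ * X.meanGap p Δ)
    have h4 := M.gapSum_nonneg (T := T) p hΔ0
    linarith

/-! ### The Tsallis entropy -/

lemma tsallis_regret_le_sqrt [IsProbabilityMeasure μ] (X : Interaction M T μ 𝓕) (hT : 2 ≤ T)
    (hX : X.UsesTsallis) {p : S → A → ℝ} (hp : M.IsPolicy p) :
    X.regret p ≤ 9 * (√(Fintype.card S * Fintype.card A * L * T)
      + Fintype.card S * Fintype.card A * Real.log T) := by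
  have := LayeredMDP.nonempty_action hp
  have hone := M.one_le_card_mul_log hT
  have hL : (1 : ℝ) ≤ L := by exact_mod_cast M.L_pos
  have hT0 : (0 : ℝ) ≤ T := Nat.cast_nonneg T
  by_cases hNT : (Fintype.card S * Fintype.card A : ℝ) ≤ T
  · obtain ⟨u, -, hR⟩ := X.tsallis_regret_le hT hX hNT hp
    set N : ℝ := Fintype.card S * Fintype.card A with hN
    have hN0 : 0 ≤ N := by positivity
    -- Stability contributes `9/4` and the penalty 2; here `-√u` is simply dropped.
    have hterm : ∀ t ∈ Finset.Icc 1 T, ∫ ω,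
        (9 / 4 * (1 / √(t : ℝ)) * ∑ s ∈ Finset.univ.erase M.terminal, ∑ a,
            LayeredMDP.spread (X.occ t ω) s a * (1 / √(X.occ t ω s a))
          + 2 * (√(t : ℝ) - √((t - 1 : ℕ) : ℝ)) *
            ∑ s ∈ Finset.univ.erase M.terminal, ∑ a, (√(X.occ t ω s a) - √(u s a))) ∂μ
        ≤ 17 / 4 * √(N * L) * (1 / √(t : ℝ)) := fun t ht => by
      have h1 := sqrt_sub_sqrt_pred_le (Finset.mem_Icc.1 ht).1
      have h0 : 0 ≤ √(t : ℝ) - √((t - 1 : ℕ) : ℝ) :=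
        sub_nonneg.2 (Real.sqrt_le_sqrt (by exact_mod_cast Nat.sub_le t 1))
      refine (integral_mono (((X.integrable_sum_spread_mul ht).const_mul _).add
        ((X.integrable_sum_sqrt_sub ht u).const_mul _))
        (integrable_const (17 / 4 * √(N * L) * (1 / √(t : ℝ)))) fun ω => ?_).trans (by simp)
      have hq := X.occ_mem ht ω
      have e0 := M.sum_sqrt_le hq
      have e1 : ∑ s ∈ Finset.univ.erase M.terminal, ∑ a,
          LayeredMDP.spread (X.occ t ω) s a * (1 / √(X.occ t ω s a)) ≤ √(N * L) :=
        le_trans (Finset.sum_le_sum fun s _ => Finset.sum_le_sum fun a _ =>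
          M.spread_mul_le hq s a) e0
      have e2 : ∑ s ∈ Finset.univ.erase M.terminal, ∑ a, (√(X.occ t ω s a) - √(u s a))
          ≤ √(N * L) :=
        le_trans (Finset.sum_le_sum fun s _ => Finset.sum_le_sum fun a _ =>
          sub_le_self _ (Real.sqrt_nonneg _)) e0
      have e3 := mul_le_mul_of_nonneg_left e1 (by positivity : 0 ≤ 9 / 4 * (1 / √(t : ℝ)))
      have e4 := mul_le_mul_of_nonneg_left e2 (mul_nonneg zero_le_two h0)
      have e5 := mul_le_mul_of_nonneg_right h1 (Real.sqrt_nonneg (N * L))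
      simp only [Pi.add_apply]
      linarith
    have hsum := Finset.sum_le_sum hterm
    rw [← Finset.mul_sum] at hsum
    have h1 := mul_le_mul_of_nonneg_left (sum_one_div_sqrt_le T)
      (by positivity : 0 ≤ 17 / 4 * √(N * L))
    rw [Real.sqrt_mul (by positivity)]
    have h2 : 0 ≤ √(N * L) * √(T : ℝ) := by positivity
    linarith
  · refine (X.regret_le_episodes hp).trans ?_
    have h1 : (T : ℝ) ≤ √(Fintype.card S * Fintype.card A * L * T) := by
      refine Real.le_sqrt_of_sq_le ?_
      rw [sq]
      refine mul_le_mul_of_nonneg_right ?_ hT0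
      nlinarith
    have h2 := Real.sqrt_nonneg (Fintype.card S * Fintype.card A * L * T : ℝ)
    linarith

lemma integrable_deviation [IsProbabilityMeasure μ] (X : Interaction M T μ 𝓕) {t : ℕ}
    (ht : t ∈ Finset.Icc 1 T) (p : S → A) :
    Integrable (fun ω => M.deviation p (X.occ t ω)) μ :=
  integrable_finsetSum _ fun s _ => integrable_finsetSum _ fun a _ => X.integrable_occ ht s a

lemma deviation_nonneg (X : Interaction M T μ 𝓕) {t : ℕ} (ht : t ∈ Finset.Icc 1 T) (p : S → A)
    (ω : Ω) : 0 ≤ M.deviation p (X.occ t ω) :=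
  Finset.sum_nonneg fun s _ => Finset.sum_nonneg fun a _ =>
    M.mem_occSet_nonneg (X.occ_mem ht ω) s a

lemma gapMin_mul_sum_deviation_le [IsProbabilityMeasure μ] (X : Interaction M T μ 𝓕) (p : S → A)
    {Δ : S → A → ℝ} (hΔ : ∀ s a, 0 ≤ Δ s a) :
    M.gapMin p Δ * ∑ t ∈ Finset.Icc 1 T, ∫ ω, M.deviation p (X.occ t ω) ∂μ ≤ X.meanGap p Δ := by
  have h : ∑ t ∈ Finset.Icc 1 T, ∫ ω, M.deviation p (X.occ t ω) ∂μ
      = ∑ s ∈ Finset.univ.erase M.terminal, ∑ a ∈ Finset.univ.erase (p s), X.meanOcc s a := by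
    have := X.integral_gap_eq p (fun _ _ => 1)
    simp only [one_mul] at this
    rw [← this]
    exact (integral_finsetSum _ fun t ht => X.integrable_deviation ht p).symm
  rw [h, Finset.mul_sum]
  refine Finset.sum_le_sum fun s hs => ?_
  rw [Finset.mul_sum]
  exact Finset.sum_le_sum fun a ha => mul_le_mul_of_nonneg_right
    (M.gapMin_le hΔ (Finset.ne_of_mem_erase hs) (Finset.ne_of_mem_erase ha)) (X.meanOcc_nonneg s a)

/-- Every leading term is charged to deviations from `p`. The factor `13/2` is twice `9/4` from the
stability plus 2 from the penalty; the last term sums to `2 |S|` over the episodes. -/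
lemma tsallis_term_le [IsProbabilityMeasure μ] (X : Interaction M T μ 𝓕) (p : S → A)
    {u : S → A → ℝ} (hu : ∀ s a, (1 - 1 / (T : ℝ)) * M.occ (detPolicy p) s a ≤ u s a) {t : ℕ}
    (ht : t ∈ Finset.Icc 1 T) :
    ∫ ω, (9 / 4 * (1 / √(t : ℝ)) * ∑ s ∈ Finset.univ.erase M.terminal, ∑ a,
            LayeredMDP.spread (X.occ t ω) s a * (1 / √(X.occ t ω s a))
          + 2 * (√(t : ℝ) - √((t - 1 : ℕ) : ℝ)) *
            ∑ s ∈ Finset.univ.erase M.terminal, ∑ a, (√(X.occ t ω s a) - √(u s a))) ∂μ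
      ≤ 13 / 2 * ∑ s ∈ Finset.univ.erase M.terminal, ∑ a ∈ Finset.univ.erase (p s),
            1 / √(t : ℝ) * √(∫ ω, X.occ t ω s a ∂μ)
          + 2 * (1 / √(t : ℝ) * √(∫ ω, Fintype.card S * L * M.deviation p (X.occ t ω) ∂μ))
          + 2 * (Fintype.card S * (1 / (T : ℝ))) := by
  have hT1 : (1 : ℝ) ≤ T := by
    have := Finset.mem_Icc.1 ht
    exact_mod_cast this.1.trans this.2
  have ht1 : (1 : ℝ) ≤ t := by exact_mod_cast (Finset.mem_Icc.1 ht).1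
  set w := 1 / √(t : ℝ) with hw
  have hw0 : 0 ≤ w := by positivity
  have hw1 : w ≤ 1 := by
    rw [hw, div_le_one (by positivity)]
    exact Real.one_le_sqrt.2 ht1
  have h1 := sqrt_sub_sqrt_pred_le (Finset.mem_Icc.1 ht).1
  have h0 : 0 ≤ √(t : ℝ) - √((t - 1 : ℕ) : ℝ) :=
    sub_nonneg.2 (Real.sqrt_le_sqrt (by exact_mod_cast Nat.sub_le t 1))
  have hI1 : Integrable (fun ω => ∑ s ∈ Finset.univ.erase M.terminal,
      ∑ a ∈ Finset.univ.erase (p s), √(X.occ t ω s a)) μ :=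
    integrable_finsetSum _ fun s _ => integrable_finsetSum _ fun a _ =>
      X.integrable_sqrt_occ ht s a
  have hI2 : Integrable (fun ω => Fintype.card S * L * M.deviation p (X.occ t ω)) μ :=
    (X.integrable_deviation ht p).const_mul _
  have hpt : ∀ ω, 9 / 4 * w * ∑ s ∈ Finset.univ.erase M.terminal, ∑ a,
            LayeredMDP.spread (X.occ t ω) s a * (1 / √(X.occ t ω s a))
          + 2 * (√(t : ℝ) - √((t - 1 : ℕ) : ℝ)) *
            ∑ s ∈ Finset.univ.erase M.terminal, ∑ a, (√(X.occ t ω s a) - √(u s a))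
      ≤ 13 / 2 * w * ∑ s ∈ Finset.univ.erase M.terminal,
          ∑ a ∈ Finset.univ.erase (p s), √(X.occ t ω s a)
        + 2 * w * √(Fintype.card S * L * M.deviation p (X.occ t ω))
        + 2 * (Fintype.card S * (1 / (T : ℝ))) := fun ω => by
    have hq := X.occ_mem ht ω
    have e1 := mul_le_mul_of_nonneg_left (M.sum_spread_mul_le p hq)
      (by positivity : 0 ≤ 9 / 4 * w)
    have e2 := M.sum_sqrt_sub_le p hq hT1 hu
    set B₁ := ∑ s ∈ Finset.univ.erase M.terminal, ∑ a ∈ Finset.univ.erase (p s), √(X.occ t ω s a)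
    set B₂ := √(Fintype.card S * L * M.deviation p (X.occ t ω))
    have hB₁ : 0 ≤ B₁ := Finset.sum_nonneg fun s _ => Finset.sum_nonneg fun a _ =>
      Real.sqrt_nonneg _
    have hB₂ : 0 ≤ B₂ := Real.sqrt_nonneg _
    have hB₃ : (0 : ℝ) ≤ Fintype.card S * (1 / (T : ℝ)) := by positivity
    have e3 := mul_le_mul_of_nonneg_left e2 (mul_nonneg zero_le_two h0)
    have e4 := mul_le_mul_of_nonneg_right h1 (add_nonneg (add_nonneg hB₁ hB₂) hB₃)
    have e5 := mul_le_mul_of_nonneg_right hw1 hB₃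
    linarith
  refine (integral_mono (((X.integrable_sum_spread_mul ht).const_mul _).add
    ((X.integrable_sum_sqrt_sub ht u).const_mul _)) (((hI1.const_mul _).add
    ((integrable_sqrt hI2).const_mul _)).add (integrable_const _)) hpt).trans ?_
  rw [integral_add' ((hI1.const_mul _).add ((integrable_sqrt hI2).const_mul _))
    (integrable_const _), integral_add' (hI1.const_mul _) ((integrable_sqrt hI2).const_mul _),
    integral_const_mul, integral_const_mul]
  simp only [integral_const, probReal_univ, one_smul]
  refine add_le_add_left (add_le_add ?_ ?_) _
  · rw [mul_assoc]
    refine mul_le_mul_of_nonneg_left ?_ (by norm_num)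
    rw [integral_finsetSum _ fun s _ => integrable_finsetSum _ fun a _ =>
      X.integrable_sqrt_occ ht s a, Finset.mul_sum]
    refine Finset.sum_le_sum fun s _ => ?_
    rw [integral_finsetSum _ fun a _ => X.integrable_sqrt_occ ht s a, Finset.mul_sum]
    exact Finset.sum_le_sum fun a _ => mul_le_mul_of_nonneg_left
      (integral_sqrt_le (X.integrable_occ ht s a) fun ω =>
        M.mem_occSet_nonneg (X.occ_mem ht ω) s a) hw0
  · rw [mul_assoc]
    refine mul_le_mul_of_nonneg_left (mul_le_mul_of_nonneg_left ?_ hw0) zero_le_two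
    exact integral_sqrt_le hI2 fun ω => mul_nonneg (by positivity) (X.deviation_nonneg ht p ω)

lemma tsallis_regret_le_gap [IsProbabilityMeasure μ] [Nontrivial A] (X : Interaction M T μ 𝓕)
    (hT : 2 ≤ T) (hX : X.UsesTsallis) {p : S → A} {Δ : S → A → ℝ} {C : ℝ}
    (h : X.IsSelfBounding p Δ C) :
    X.regret (detPolicy p)
      ≤ 44 * M.tsallisU T p Δ + 17 * √(M.tsallisU T p Δ * X.meanGap p Δ) := by
  have hp := M.detPolicy_isPolicy p
  have hone := M.one_le_card_mul_log hT
  have hl0 := Real.log_natCast_nonneg T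
  have hl2 : Real.log 2 ≤ Real.log T := Real.log_le_log (by norm_num) (by exact_mod_cast hT)
  have hl3 := Real.log_two_gt_d9
  have hN4 := M.card_mul_log_le_gapSum T p h.gap_pos fun s a => (h.gap_mem s a).2
  have hΔ0 : ∀ s a, 0 ≤ Δ s a := fun s a => (h.gap_mem s a).1
  have hU1 := M.gapSum_nonneg (T := T) p hΔ0
  have hmin := M.gapMin_pos p h.gap_pos
  have hG0 := X.meanGap_nonneg p hΔ0
  have hU2 : 0 ≤ L * Fintype.card S * Real.log T / M.gapMin p Δ := by positivity
  have hUle : M.gapSum T p Δ ≤ M.tsallisU T p Δ := by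
    unfold LayeredMDP.tsallisU
    linarith
  have hUle2 : L * Fintype.card S * Real.log T / M.gapMin p Δ ≤ M.tsallisU T p Δ := by
    unfold LayeredMDP.tsallisU
    linarith
  set V := √(M.tsallisU T p Δ * X.meanGap p Δ) with hV
  have hV0 : 0 ≤ V := Real.sqrt_nonneg _
  by_cases hNT : (Fintype.card S * Fintype.card A : ℝ) ≤ T
  · obtain ⟨u, hu, hR⟩ := X.tsallis_regret_le hT hX hNT hp
    have hsum := Finset.sum_le_sum fun t ht => X.tsallis_term_le p hu ht
    simp only [Finset.sum_add_distrib, ← Finset.mul_sum] at hsum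
    have h1 : ∑ t ∈ Finset.Icc 1 T, ∑ s ∈ Finset.univ.erase M.terminal,
        ∑ a ∈ Finset.univ.erase (p s), 1 / √(t : ℝ) * √(∫ ω, X.occ t ω s a ∂μ) ≤ √3 * V := by
      rw [Finset.sum_comm]
      calc _ ≤ ∑ s ∈ Finset.univ.erase M.terminal, ∑ a ∈ Finset.univ.erase (p s),
            √3 * √(Real.log T * X.meanOcc s a) := by
            refine Finset.sum_le_sum fun s _ => ?_
            rw [Finset.sum_comm]
            exact Finset.sum_le_sum fun a _ => sum_one_div_sqrt_mul_sqrt_le hT fun t ht =>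
              integral_nonneg fun ω => M.mem_occSet_nonneg (X.occ_mem ht ω) s a
        _ = √3 * ∑ s ∈ Finset.univ.erase M.terminal, ∑ a ∈ Finset.univ.erase (p s),
            √(Real.log T * X.meanOcc s a) := by simp only [Finset.mul_sum]
        _ ≤ √3 * V := by
            refine mul_le_mul_of_nonneg_left ?_ (Real.sqrt_nonneg _)
            refine (X.sum_sqrt_meanOcc_le p hΔ0 h.gap_pos).trans (Real.sqrt_le_sqrt ?_)
            exact mul_le_mul_of_nonneg_right hUle hG0
    have h2 : ∑ t ∈ Finset.Icc 1 T, 1 / √(t : ℝ) *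
        √(∫ ω, Fintype.card S * L * M.deviation p (X.occ t ω) ∂μ) ≤ √3 * V := by
      refine (sum_one_div_sqrt_mul_sqrt_le hT fun t ht => integral_nonneg fun ω =>
        mul_nonneg (by positivity) (X.deviation_nonneg ht p ω)).trans ?_
      refine mul_le_mul_of_nonneg_left (Real.sqrt_le_sqrt ?_) (Real.sqrt_nonneg _)
      simp only [integral_const_mul, ← Finset.mul_sum]
      -- The deviations are weighted by `gapMin` to compare them with `meanGap`; the compensating `1
      -- / gapMin` forms the second part of `tsallisU`.
      have e1 := X.gapMin_mul_sum_deviation_le p hΔ0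
      refine le_trans (le_of_eq ?_) (mul_le_mul hUle2 e1 (mul_nonneg hmin.le
        (Finset.sum_nonneg fun t ht => integral_nonneg fun ω => X.deviation_nonneg ht p ω))
        (hU1.trans hUle))
      field_simp
    have h3 : ∑ _t ∈ Finset.Icc 1 T, Fintype.card S * (1 / (T : ℝ)) = Fintype.card S := by
      have : (T : ℝ) ≠ 0 := by positivity
      simp only [Finset.sum_const, Nat.card_Icc, Nat.add_sub_cancel, nsmul_eq_mul]
      field_simp
    simp only [← Finset.mul_sum] at h1 h3
    -- The constants: `(13/2 + 2) √3 ≤ 17`, and `6 + 1 + 2 * 2 = 11` multiples of `|S||A| log T` are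
    -- at most `44 * gapSum`.
    have h4 : √3 ≤ 2 := Real.sqrt_le_iff.2 ⟨zero_le_two, by norm_num⟩
    have h5 := mul_le_mul_of_nonneg_right h4 hV0
    have h6 : (Fintype.card S : ℝ) ≤ 2 * (Fintype.card S * Fintype.card A * Real.log T) := by
      have hA : (1 : ℝ) ≤ Fintype.card A := by exact_mod_cast Fintype.card_pos (α := A)
      have hS : (0 : ℝ) ≤ Fintype.card S := Nat.cast_nonneg _
      have : (1 : ℝ) ≤ 2 * (Fintype.card A * Real.log T) := by nlinarith
      nlinarith
    linarith
  · have h1 := X.regret_le_episodes hp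
    have h2 : (Fintype.card S * Fintype.card A : ℝ)
        ≤ 2 * (Fintype.card S * Fintype.card A * Real.log T) := by
      have : (0 : ℝ) ≤ Fintype.card S * Fintype.card A := by positivity
      nlinarith
    linarith

end Interaction

/-! ### The main theorem -/

theorem mainTheorem1 :
    ∃ K : ℝ, 0 < K ∧
      ∀ (S A : Type*) [Fintype S] [Fintype A] [DecidableEq S] [DecidableEq A] (L : ℕ)
        (M : LayeredMDP S A L) (T : ℕ) (_ : 2 ≤ T)
        (Ω : Type*) [mΩ : MeasurableSpace Ω] (μ : Measure Ω) [IsProbabilityMeasure μ]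
        (𝓕 : Filtration ℕ mΩ) (X : Interaction M T μ 𝓕),
        (X.UsesTsallis →
          (∀ p, M.IsPolicy p →
            X.regret p ≤ K * (√(Fintype.card S * Fintype.card A * L * T)
              + Fintype.card S * Fintype.card A * Real.log T)) ∧
          (∀ (p : S → A) (Δ : S → A → ℝ) (C : ℝ), X.IsSelfBounding p Δ C →
            X.regret (detPolicy p)
              ≤ K * (M.tsallisU T p Δ + √(M.tsallisU T p Δ * C)))) ∧
        (X.UsesLogBarrier →
          (∀ p, M.IsPolicy p →
            X.regret p ≤ K * √(Fintype.card S * Fintype.card A * L * T * Real.log T)) ∧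
          (∀ (p : S → A) (Δ : S → A → ℝ) (C : ℝ), X.IsSelfBounding p Δ C →
            X.regret (detPolicy p)
              ≤ K * (M.logBarrierU T p Δ + √(M.logBarrierU T p Δ * C)))) := by
  refine ⟨1000, by norm_num, fun S A _ _ _ _ L M T hT Ω mΩ μ _ 𝓕 X => ?_⟩
  have hl0 := Real.log_natCast_nonneg T
  have hfinal : ∀ {p : S → A} {Δ : S → A → ℝ} {C U : ℝ}, X.IsSelfBounding p Δ C → 0 ≤ U →
      (Nontrivial A → X.regret (detPolicy p) ≤ 44 * U + 17 * √(U * X.meanGap p Δ)) →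
      X.regret (detPolicy p) ≤ 1000 * (U + √(U * C)) := by
    intro p Δ C U h hU hle
    have hs := Real.sqrt_nonneg (U * C)
    -- With a single action `gapMin` is the infimum of the empty set, that is 0, and the gap
    -- estimates are not available; the regret vanishes then.
    rcases subsingleton_or_nontrivial A with hA | hA
    · rw [X.regret_of_subsingleton (M.detPolicy_isPolicy p)]
      positivity
    -- The constants 44 and 17 become `2 * 44 + 17² = 377` and `2 * 17 = 34`, both below 1000.
    · have := le_of_self_bounding hU h.corruption_nonneg (by norm_num) (by norm_num)
        h.meanGap_le (hle hA)
      linarith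
  refine ⟨fun hX => ⟨fun p hp => ?_, fun p Δ C h => ?_⟩,
    fun hX => ⟨fun p hp => ?_, fun p Δ C h => ?_⟩⟩
  · refine (X.tsallis_regret_le_sqrt hT hX hp).trans
      (mul_le_mul_of_nonneg_right (by norm_num) ?_)
    positivity
  · have hΔ0 : ∀ s a, 0 ≤ Δ s a := fun s a => (h.gap_mem s a).1
    refine hfinal h (add_nonneg (M.gapSum_nonneg p hΔ0)
      (div_nonneg (by positivity) (M.gapMin_nonneg p hΔ0))) fun hA => ?_
    exact X.tsallis_regret_le_gap hT hX h
  · exact (X.logBarrier_regret_le_sqrt hT hX hp).trans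
      (mul_le_mul_of_nonneg_right (by norm_num) (Real.sqrt_nonneg _))
  · have hΔ0 : ∀ s a, 0 ≤ Δ s a := fun s a => (h.gap_mem s a).1
    have hU : 0 ≤ M.logBarrierU T p Δ := M.gapSum_nonneg p hΔ0
    refine hfinal h hU fun hA => (X.logBarrier_regret_le_gap hT hX h).trans ?_
    have := Real.sqrt_nonneg (M.logBarrierU T p Δ * X.meanGap p Δ)
    linarith
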